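/- For integers $n\ge 2$ let $d=d(n)\ge 1$ and $p=p(n)$ be integers with $d<n^{1/2}$, put $N=\binom{n}{d}$, and suppose $N/p\to\gamma\in(0,\infty)$ as $n\to\infty$. For each $n$ let $x_1,\dots,x_n$ be i.i.d. real random variables whose common law may depend on $n$, such that $x_1\overset{d}{=}-x_1$, $\mathbb{E}[x_1^2]=1$, and for some $C=C(n)\ge 2$, $$\mathbb{E}[x_1^{2k}]\le (Ck)^k\quad(k\in\mathbb{N}),\qquad \lim_{n\to\infty}\frac{\log C(n)}{\log\left(n^{1/2}/d(n)\right)}=0 .$$ Let $Z_0\in\mathbb{R}^N$ be the random vector with entries $x_{i_1}x_{i_2}\cdots x_{i_d}$, indexed by $1\le i_1<\dots<i_d\le n$. Let $T=T(n)\in\mathbb{R}^{N\times N}$ be deterministic, symmetric, positive semidefinite matrices with $\sup_n\|T(n)\|<\infty$ (operator norm), whose empirical spectral distributions (mass $1/N$ at each eigenvalue, counted with multiplicity) converge weakly to a deterministic probability measure $H$ on $\mathbb{R}$. Let $\tilde Z=\tilde Z(n)\in\mathbb{R}^{N\times p}$, $n\ge2$, be random matrices on a common probability space such that, for each $n$,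 the columns of $\tilde Z(n)$ are i.i.d. with the law of $T^{1/2}Z_0$ (no assumption is made on the dependence between different $n$). Then there is a (deterministic) probability measure $\mu$ on $\mathbb{R}$ such that, almost surely, the empirical spectral distribution of $\tilde S=\frac1p\tilde Z\tilde Z^T$ converges weakly to $\mu$ as $n\to\infty$. Moreover, the Stieltjes transform $m(z)=\int_{\mathbb{R}}\frac{1}{z-t}\,d\mu(t)$ satisfies $$m(z)=\int_{\mathbb{R}}\frac{1}{z-t\left(1-\gamma+\gamma z\,m(z)\right)}\,dH(t)\qquad\text{for all } z\in\mathbb{C}\text{ with } \operatorname{Im} z>0,$$ where the integrand on the right is defined for $H$-almost every $t$ and is $H$-integrable. -/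

import Mathlib

open MeasureTheory ProbabilityTheory Filter Topology
open scoped NNReal MatrixOrder

noncomputable section

/-- The `d`-element subsets `{i₁ < ⋯ < i_d}` of `{1, …, n}`, indexing the `N = n.choose d`
features of the random tensor product model. -/
abbrev TensorIndex (n d : ℕ) : Type := {s : Finset (Fin n) // s.card = d}

theorem card_tensorIndex (n d : ℕ) : Fintype.card (TensorIndex n d) = n.choose d := by
  simp [TensorIndex]

/-- The vector with entries `x_{i₁} x_{i₂} ⋯ x_{i_d}`, for `i₁ < ⋯ < i_d`. -/
def tensorVector {n : ℕ} (d : ℕ) (x : Fin n → ℝ) : TensorIndex n d → ℝ :=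
  fun s => ∏ i ∈ s.1, x i

/-- The law of the tensor vector of `n` i.i.d. real random variables with common law `ν`. -/
def tensorLaw (n d : ℕ) (ν : Measure ℝ) : Measure (TensorIndex n d → ℝ) :=
  (Measure.pi fun _ : Fin n => ν).map (tensorVector d)

/-- The law of `T^{1/2} Z₀`, where `Z₀` has law `tensorLaw n d ν`; for a positive semidefinite
`T`, `CFC.sqrt T` is its positive semidefinite square root. -/
def colouredTensorLaw {n d : ℕ} (ν : Measure ℝ)
    (T : Matrix (TensorIndex n d) (TensorIndex n d) ℝ) : Measure (TensorIndex n d → ℝ) :=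
  (tensorLaw n d ν).map fun v => (CFC.sqrt T).mulVec v

/-- The empirical spectral distribution of a real symmetric matrix, as a measure: mass
`1 / N` at each of its `N` eigenvalues, counted with multiplicity. -/
def esd {ι : Type*} [Fintype ι] [DecidableEq ι] {A : Matrix ι ι ℝ} (hA : A.IsHermitian) :
    FiniteMeasure ℝ :=
  (Fintype.card ι : ℝ≥0)⁻¹ • ∑ j, (diracProba (hA.eigenvalues j)).toFiniteMeasure

/-- The sample covariance matrix `(1 / p) Z Zᵀ` of a data matrix with `p` columns. -/
def sampleCov {ι : Type*} {p : ℕ} (Z : Matrix ι (Fin p) ℝ) : Matrix ι ι ℝ :=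
  (1 / (p : ℝ)) • (Z * Z.transpose)

theorem isHermitian_sampleCov {ι : Type*} {p : ℕ} (Z : Matrix ι (Fin p) ℝ) :
    (sampleCov Z).IsHermitian := by
  ext i j
  simp [sampleCov, Matrix.mul_apply, mul_comm]

/-- The Stieltjes transform `m(z) = ∫ 1 / (z - t) dμ(t)`. -/
def stieltjesTransform (μ : Measure ℝ) (z : ℂ) : ℂ := ∫ t : ℝ, 1 / (z - (t : ℂ)) ∂μ

end

/-!
For `v = T^{1/2} Z₀`, a quadratic form `vᵀ B v` has mean `tr (T B)`. Symmetry of the law makes most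
of the products `X_s X_t` of entries of `Z₀` uncorrelated, and the standard deviation of the form is
at most `‖T‖ ‖B‖ N` up to a factor whose square is of order `d² κ / n`, with `κ` the fourth moment.
Since `κ ≤ 4 C²` and `C = (√n / d)^{o(1)}`, this factor tends to `0`, and quadratic forms
concentrate. That is the only property of the columns used afterwards.

Changing one column of the data matrix changes the trace of the resolvent `(z - S)⁻¹` by at most
`2 / Im z`, since removing a column is a rank one perturbation. Hence the normalized trace `m_n(z)`
concentrates around its mean, by bounded differences and Borel–Cantelli. Comparing `(z - S)⁻¹` with
`(z - s T)⁻¹`, where `s = 1 - γ + γ z m`, by rank one updates, column by column, shows that the mean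
of `m_n(z)` satisfies the limiting equation up to `o(1)`.

With `g = s / z`, the equation becomes `z = g⁻¹ + γ ∫ t / (1 - t g) dH(t)`, and the difference of
two solutions gives `1 = γ g g' ∫ t² / ((1 - t g) (1 - t g')) dH(t)`. Imaginary parts of the
equation give `γ |g|² ∫ t² / |1 - t g|² dH(t) < 1`, so the inequality of arithmetic and geometric
means excludes two solutions in the lower half plane. So `m_n(z)` converges almost surely for every
`z`, and by tightness its limit is the Stieltjes transform of the weak limit.
-/

section StieltjesTransform

open scoped BoundedContinuousFunction

theorem im_le_norm_sub_ofReal (z : ℂ) (t : ℝ) : z.im ≤ ‖z - t‖ := by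
  simpa using (le_abs_self _).trans (Complex.abs_im_le_norm (z - t))

theorem sub_ofReal_ne_zero {z : ℂ} (hz : 0 < z.im) (t : ℝ) : z - t ≠ 0 :=
  norm_pos_iff.1 (hz.trans_le (im_le_norm_sub_ofReal z t))

theorem norm_one_div_sub_ofReal_le {z : ℂ} (hz : 0 < z.im) (t : ℝ) :
    ‖1 / (z - t)‖ ≤ 1 / z.im := by
  rw [norm_div, norm_one]
  exact one_div_le_one_div_of_le hz (im_le_norm_sub_ofReal z t)

/-- The function `t ↦ 1 / (z - t)`, for `z` in the upper half plane, as a bounded continuous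
function on the real line. -/
noncomputable def stieltjesKernel (z : ℂ) (hz : 0 < z.im) : ℝ →ᵇ ℂ :=
  BoundedContinuousFunction.ofNormedAddCommGroup (fun t : ℝ => 1 / (z - t))
    (continuous_const.div (by fun_prop) (sub_ofReal_ne_zero hz)) (1 / z.im)
    (norm_one_div_sub_ofReal_le hz)

theorem integrable_one_div_sub_ofReal (μ : Measure ℝ) [IsFiniteMeasure μ] {z : ℂ}
    (hz : 0 < z.im) : Integrable (fun t : ℝ => 1 / (z - t)) μ :=
  (stieltjesKernel z hz).integrable μ

theorem tendsto_stieltjesTransform {ι : Type*} {l : Filter ι} {μs : ι → FiniteMeasure ℝ}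
    {μ : FiniteMeasure ℝ} (h : Tendsto μs l (𝓝 μ)) {z : ℂ} (hz : 0 < z.im) :
    Tendsto (fun i => stieltjesTransform (μs i) z) l (𝓝 (stieltjesTransform μ z)) :=
  (FiniteMeasure.tendsto_iff_forall_integral_rclike_tendsto ℂ).1 h (stieltjesKernel z hz)

theorem norm_stieltjesTransform_sub_le (μ : Measure ℝ) [IsProbabilityMeasure μ] {z w : ℂ}
    (hz : 0 < z.im) (hw : 0 < w.im) :
    ‖stieltjesTransform μ z - stieltjesTransform μ w‖ ≤ ‖z - w‖ / (z.im * w.im) := by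
  have kernel_sub (t : ℝ) :
      1 / (z - t) - 1 / (w - t) = (w - z) * ((1 / (z - t)) * (1 / (w - t))) := by
    have hzt := sub_ofReal_ne_zero hz t
    have hwt := sub_ofReal_ne_zero hw t
    field_simp
    ring
  rw [stieltjesTransform, stieltjesTransform,
    ← integral_sub (integrable_one_div_sub_ofReal μ hz) (integrable_one_div_sub_ofReal μ hw)]
  refine (norm_integral_le_of_norm_le_const (C := ‖z - w‖ / (z.im * w.im))
    (ae_of_all _ fun t => ?_)).trans_eq (by simp)
  rw [kernel_sub, norm_mul, norm_mul, norm_sub_rev w z,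
    div_eq_mul_one_div ‖z - w‖, ← one_div_mul_one_div]
  gcongr <;> exact norm_one_div_sub_ofReal_le ‹_› t

theorem neg_im_one_div_sub_ofReal (x t : ℝ) (y : ℝ≥0) :
    -(1 / ((x : ℂ) + y * Complex.I - t)).im = Real.pi * cauchyPDFReal t y x := by
  simp [cauchyPDFReal_def, Complex.normSq_apply]
  field_simp

theorem lintegral_cauchyPDF (μ : Measure ℝ) [IsFiniteMeasure μ] {y : ℝ≥0} (hy : y ≠ 0) (x : ℝ) :
    ∫⁻ t, cauchyPDF t y x ∂μ
      = ENNReal.ofReal (-(stieltjesTransform μ (x + y * Complex.I)).im / Real.pi) := by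
  have hz : 0 < ((x : ℂ) + y * Complex.I).im := by simpa using pos_iff_ne_zero.2 hy
  have hint := integrable_one_div_sub_ofReal μ hz
  have hpdf (t : ℝ) : cauchyPDFReal t y x
      = -(1 / ((x : ℂ) + y * Complex.I - t)).im / Real.pi := by
    rw [neg_im_one_div_sub_ofReal, mul_div_cancel_left₀ _ Real.pi_ne_zero]
  simp only [cauchyPDF_def]
  rw [← ofReal_integral_eq_lintegral_ofReal]
  · simp only [hpdf]
    rw [integral_div, integral_neg]
    exact congrArg (fun a : ℝ => ENNReal.ofReal (-a / Real.pi)) (integral_im hint)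
  · simp only [hpdf]
    exact hint.im.neg.div_const _
  · exact ae_of_all _ fun t => (cauchyPDF_pos t hy x).le

theorem conv_cauchyMeasure_eq_withDensity (μ : Measure ℝ) [IsFiniteMeasure μ] {y : ℝ≥0}
    (hy : y ≠ 0) : μ ∗ cauchyMeasure 0 y = volume.withDensity fun x : ℝ =>
      ENNReal.ofReal (-(stieltjesTransform μ (x + y * Complex.I)).im / Real.pi) := by
  have hpdf_measurable : Measurable fun q : ℝ × ℝ => cauchyPDF q.1 y q.2 := by
    unfold cauchyPDF cauchyPDFReal
    fun_prop
  refine Measure.ext_of_lintegral _ fun f hf => ?_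
  simp_rw [← lintegral_cauchyPDF μ hy]
  rw [Measure.lintegral_conv hf, lintegral_withDensity_eq_lintegral_mul _
    hpdf_measurable.lintegral_prod_left' hf]
  simp only [Pi.mul_apply]
  calc ∫⁻ t, ∫⁻ u, f (t + u) ∂cauchyMeasure 0 y ∂μ
      = ∫⁻ t, ∫⁻ x, cauchyPDF t y x * f x ∂volume ∂μ := by
        refine lintegral_congr fun t => ?_
        rw [cauchyMeasure_of_scale_ne_zero _ hy, lintegral_withDensity_eq_lintegral_mul _
          (measurable_cauchyPDF _ _) (by fun_prop),
          ← lintegral_add_left_eq_self (fun x => cauchyPDF t y x * f x) t]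
        simp [cauchyPDF_def, cauchyPDFReal_def]
    _ = ∫⁻ x, (∫⁻ t, cauchyPDF t y x ∂μ) * f x := by
        rw [lintegral_lintegral_swap (by fun_prop)]
        exact lintegral_congr fun x => lintegral_mul_const _ (by fun_prop)

theorem charFun_cauchyMeasure_zero (y : ℝ≥0) (t : ℝ) :
    charFun (cauchyMeasure 0 y) t = charFun (cauchyMeasure 0 1) (y * t) := by
  rcases eq_or_ne y 0 with rfl | hy
  · simp [charFun_dirac]
  have hint (w : ℝ≥0) (hw : w ≠ 0) (r : ℝ) : charFun (cauchyMeasure 0 w) r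
      = ∫ x : ℝ, cauchyPDFReal 0 w x • Complex.exp (r * x * Complex.I) := by
    rw [charFun_apply_real, cauchyMeasure_of_scale_ne_zero _ hw,
      integral_withDensity_eq_integral_toReal_smul (measurable_cauchyPDF _ _)
        (ae_of_all _ fun _ => by simp [cauchyPDF_def])]
    simp only [cauchyPDF_def, ENNReal.toReal_ofReal (cauchyPDF_pos 0 hw _).le]
  have hscale (x : ℝ) : cauchyPDFReal 0 y x • Complex.exp (t * x * Complex.I)
      = (y : ℝ)⁻¹ • (fun u : ℝ => cauchyPDFReal 0 1 u •
        Complex.exp ((y * t : ℝ) * u * Complex.I)) (x / y) := by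
    have hexp : ((y * t : ℝ) : ℂ) * (x / y : ℝ) = t * x := by
      rw [← Complex.ofReal_mul, ← Complex.ofReal_mul]
      congr 1
      field_simp
    simp only [hexp, smul_smul]
    congr 1
    simp only [cauchyPDFReal_def', sub_zero, NNReal.coe_one, NNReal.coe_inv, inv_one,
      div_one, mul_one]
    ring
  rw [hint y hy, hint 1 one_ne_zero, integral_congr_ae (ae_of_all _ hscale), integral_smul,
    Measure.integral_comp_div (fun u : ℝ => cauchyPDFReal 0 1 u •
      Complex.exp ((y * t : ℝ) * u * Complex.I)), abs_of_nonneg y.coe_nonneg, smul_smul,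
    inv_mul_cancel₀ (by simpa using hy), one_smul]

theorem exists_charFun_cauchyMeasure_ne_zero (t : ℝ) :
    ∃ y : ℝ≥0, y ≠ 0 ∧ charFun (cauchyMeasure 0 y) t ≠ 0 := by
  have hcont : Continuous fun y : ℝ≥0 => charFun (cauchyMeasure 0 1) (y * t) :=
    continuous_charFun.comp (by fun_prop)
  have h0 : charFun (cauchyMeasure 0 1) (((0 : ℝ≥0) : ℝ) * t) ≠ 0 := by simp
  have hev := (hcont.tendsto 0).eventually_ne h0
  obtain ⟨y, hy, hy0⟩ := ((hev.filter_mono nhdsWithin_le_nhds).and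
    (eventually_mem_nhdsWithin (s := Set.Ioi (0 : ℝ≥0)))).exists
  exact ⟨y, (pos_iff_ne_zero.1 hy0), by rwa [charFun_cauchyMeasure_zero]⟩

theorem measure_ext_of_stieltjesTransform {μ ν : Measure ℝ} [IsFiniteMeasure μ]
    [IsFiniteMeasure ν] (h : ∀ z : ℂ, 0 < z.im → stieltjesTransform μ z = stieltjesTransform ν z) :
    μ = ν := by
  refine Measure.ext_of_charFun (funext fun t => ?_)
  obtain ⟨y, hy, hchar⟩ := exists_charFun_cauchyMeasure_ne_zero t
  have hconv : μ ∗ cauchyMeasure 0 y = ν ∗ cauchyMeasure 0 y := by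
    rw [conv_cauchyMeasure_eq_withDensity μ hy, conv_cauchyMeasure_eq_withDensity ν hy]
    refine congrArg volume.withDensity (funext fun x => ?_)
    rw [h _ (by simpa using pos_iff_ne_zero.2 hy)]
  refine mul_right_cancel₀ hchar ?_
  rw [← charFun_conv, ← charFun_conv, hconv]

theorem equicontinuous_stieltjesTransform {ι : Type*} (μs : ι → ProbabilityMeasure ℝ) :
    Equicontinuous fun i (z : {z : ℂ // 0 < z.im}) => stieltjesTransform (μs i) z := by
  intro w
  have hbound : ContinuousAt
      (fun z : {z : ℂ // 0 < z.im} => ‖(w : ℂ) - z‖ / (w.1.im * z.1.im)) w :=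
    ContinuousAt.div (by fun_prop) (by fun_prop) (mul_pos w.2 w.2).ne'
  refine Metric.equicontinuousAt_of_continuity_modulus _
    (by simpa [ContinuousAt] using hbound) _ (Eventually.of_forall fun z i => ?_)
  rw [dist_eq_norm]
  exact norm_stieltjesTransform_sub_le (μs i : Measure ℝ) w.2 z.2

/-- The Stieltjes transforms are equi-Lipschitz away from the real axis, so convergence on a
countable dense set of points suffices. -/
theorem ae_tendsto_stieltjesTransform {ι Ω : Type*} [MeasurableSpace Ω] {P : Measure Ω}
    [NeZero P] {l : Filter ι} [l.NeBot] {μs : ι → Ω → ProbabilityMeasure ℝ} {m : ℂ → ℂ}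
    (h : ∀ z : ℂ, 0 < z.im →
      ∀ᵐ ω ∂P, Tendsto (fun i => stieltjesTransform (μs i ω) z) l (𝓝 (m z))) :
    ∀ᵐ ω ∂P, ∀ z : ℂ, 0 < z.im →
      Tendsto (fun i => stieltjesTransform (μs i ω) z) l (𝓝 (m z)) := by
  have lipschitz_limit (w z : {z : ℂ // 0 < z.im}) :
      dist (m w) (m z) ≤ ‖(w : ℂ) - z‖ / (w.1.im * z.1.im) := by
    obtain ⟨ω, hωw, hωz⟩ := ((h w w.2).and (h z z.2)).exists
    rw [dist_eq_norm]
    exact le_of_tendsto (hωw.sub hωz).norm (Eventually.of_forall fun i =>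
      norm_stieltjesTransform_sub_le (μs i ω : Measure ℝ) w.2 z.2)
  have continuous_limit : Continuous fun z : {z : ℂ // 0 < z.im} => m z := by
    refine continuous_iff_continuousAt.2 fun w => tendsto_iff_dist_tendsto_zero.2 ?_
    have hbound : ContinuousAt
        (fun z : {z : ℂ // 0 < z.im} => ‖(z : ℂ) - w‖ / (z.1.im * w.1.im)) w :=
      ContinuousAt.div (by fun_prop) (by fun_prop) (mul_pos w.2 w.2).ne'
    exact squeeze_zero (fun _ => dist_nonneg) (lipschitz_limit · w)
      (by simpa [ContinuousAt] using hbound)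
  obtain ⟨D, hD_countable, hD_dense⟩ :=
    TopologicalSpace.exists_countable_dense {z : ℂ // 0 < z.im}
  filter_upwards [(ae_ball_iff hD_countable).2 fun z _ => h z z.2] with ω hω z hz
  have hclosed := (equicontinuous_stieltjesTransform fun i => μs i ω).isClosed_setOfPred_tendsto
    continuous_limit (l := l)
  exact hclosed.closure_subset_iff.2 hω (hD_dense ⟨z, hz⟩)

theorem re_one_sub_mul_one_div_sub {k : ℝ} (hk : 0 < k) (t : ℝ) :
    (1 - k * Complex.I * (1 / (k * Complex.I - t))).re = t ^ 2 / (k ^ 2 + t ^ 2) := by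
  have hsq : k ^ 2 + t ^ 2 = t * t + k * k := by ring
  simp only [one_div, Complex.sub_re, Complex.one_re, Complex.mul_re, Complex.mul_im,
    Complex.inv_re, Complex.inv_im, Complex.normSq_apply, Complex.sub_im, Complex.ofReal_re,
    Complex.ofReal_im, Complex.I_re, Complex.I_im, hsq]
  simp only [mul_zero, zero_mul, mul_one, sub_zero, zero_sub, add_zero, neg_mul_neg]
  field_simp
  ring

theorem re_one_sub_mul_stieltjesTransform (μ : Measure ℝ) [IsProbabilityMeasure μ] {k : ℝ}
    (hk : 0 < k) :
    (1 - k * Complex.I * stieltjesTransform μ (k * Complex.I)).re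
      = ∫ t, t ^ 2 / (k ^ 2 + t ^ 2) ∂μ := by
  have hint : Integrable (fun t : ℝ => k * Complex.I * (1 / (k * Complex.I - t))) μ :=
    (integrable_one_div_sub_ofReal μ (by simpa using hk)).const_mul _
  calc (1 - k * Complex.I * stieltjesTransform μ (k * Complex.I)).re
      = (∫ t : ℝ, (1 - k * Complex.I * (1 / (k * Complex.I - t))) ∂μ).re := by
        rw [integral_sub (integrable_const _) hint, integral_const_mul, integral_const,
          probReal_univ, one_smul, stieltjesTransform]
    _ = ∫ t : ℝ, (1 - k * Complex.I * (1 / (k * Complex.I - t))).re ∂μ :=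
        (integral_re ((integrable_const (1 : ℂ)).sub hint)).symm
    _ = ∫ t, t ^ 2 / (k ^ 2 + t ^ 2) ∂μ := by simp_rw [re_one_sub_mul_one_div_sub hk]

theorem measureReal_norm_gt_le (μ : Measure ℝ) [IsProbabilityMeasure μ] {k : ℝ} (hk : 0 < k) :
    μ.real {x | k < ‖x‖} ≤ 2 * (1 - k * Complex.I * stieltjesTransform μ (k * Complex.I)).re := by
  rw [re_one_sub_mul_stieltjesTransform μ hk]
  have hpos (t : ℝ) : 0 < k ^ 2 + t ^ 2 := by positivity
  have hint : Integrable (fun t : ℝ => t ^ 2 / (k ^ 2 + t ^ 2)) μ := by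
    refine Integrable.of_bound (Measurable.aestronglyMeasurable (by fun_prop)) 1
      (ae_of_all _ fun t => ?_)
    rw [Real.norm_of_nonneg (by positivity), div_le_one (hpos t)]
    exact le_add_of_nonneg_left (sq_nonneg k)
  have hsub : {x : ℝ | k < ‖x‖} ⊆ {x | 1 / 2 ≤ x ^ 2 / (k ^ 2 + x ^ 2)} := fun x hx => by
    have hkx : k ^ 2 < x ^ 2 := sq_lt_sq.2 (by rwa [abs_of_pos hk])
    exact (le_div_iff₀ (hpos x)).2 (by linarith)
  have hmarkov := mul_meas_ge_le_integral_of_nonneg (μ := μ)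
    (ae_of_all _ fun t : ℝ => (by positivity : 0 ≤ t ^ 2 / (k ^ 2 + t ^ 2))) hint (1 / 2)
  linarith [measureReal_mono (μ := μ) hsub]

theorem isTightMeasureSet_of_tendsto_stieltjesTransform {μs : ℕ → ProbabilityMeasure ℝ}
    {m : ℂ → ℂ} (h : ∀ z : ℂ, 0 < z.im →
      Tendsto (fun n => stieltjesTransform (μs n) z) atTop (𝓝 (m z)))
    (hm : Tendsto (fun y : ℝ => y * Complex.I * m (y * Complex.I)) atTop (𝓝 1)) :
    IsTightMeasureSet (Set.range fun n => (μs n : Measure ℝ)) := by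
  refine isTightMeasureSet_range_of_tendsto_limsup_measure_norm_gt ?_
  have hre : Tendsto (fun k : ℝ => ENNReal.ofReal
      (2 * (1 - k * Complex.I * m (k * Complex.I)).re)) atTop (𝓝 0) := by
    have hcont : Continuous fun w : ℂ => ENNReal.ofReal (2 * (1 - w).re) :=
      ENNReal.continuous_ofReal.comp (by fun_prop)
    have hlim := (hcont.tendsto 1).comp hm
    rwa [sub_self, Complex.zero_re, mul_zero, ENNReal.ofReal_zero] at hlim
  refine tendsto_of_tendsto_of_tendsto_of_le_of_le' tendsto_const_nhds hre
    (Eventually.of_forall fun _ => zero_le) ?_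
  filter_upwards [eventually_gt_atTop 0] with k hk
  have hlim : Tendsto (fun n => ENNReal.ofReal
      (2 * (1 - k * Complex.I * stieltjesTransform (μs n) (k * Complex.I)).re)) atTop
      (𝓝 (ENNReal.ofReal (2 * (1 - k * Complex.I * m (k * Complex.I)).re))) := by
    have hcont : Continuous fun w : ℂ => ENNReal.ofReal (2 * (1 - k * Complex.I * w).re) :=
      ENNReal.continuous_ofReal.comp (by fun_prop)
    exact (hcont.tendsto _).comp (h _ (by simpa using hk))
  rw [← hlim.limsup_eq]
  refine limsup_le_limsup (Eventually.of_forall fun n => ?_)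
  refine (ofReal_measureReal (measure_ne_top _ _)).symm.trans_le ?_
  exact ENNReal.ofReal_le_ofReal (measureReal_norm_gt_le (μs n : Measure ℝ) hk)

/-- The condition on `m` along the imaginary axis says that no mass escapes to infinity. -/
theorem exists_tendsto_of_tendsto_stieltjesTransform {μs : ℕ → ProbabilityMeasure ℝ} {m : ℂ → ℂ}
    (h : ∀ z : ℂ, 0 < z.im → Tendsto (fun n => stieltjesTransform (μs n) z) atTop (𝓝 (m z)))
    (hm : Tendsto (fun y : ℝ => y * Complex.I * m (y * Complex.I)) atTop (𝓝 1)) :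
    ∃ μ : ProbabilityMeasure ℝ, Tendsto μs atTop (𝓝 μ) ∧
      ∀ z : ℂ, 0 < z.im → stieltjesTransform μ z = m z := by
  have hcompact : IsCompact (closure (Set.range μs)) := by
    refine isCompact_closure_of_isTightMeasureSet ?_
    convert isTightMeasureSet_of_tendsto_stieltjesTransform h hm using 1
    ext μ
    simp
  have hmem (n : ℕ) : μs n ∈ closure (Set.range μs) := subset_closure ⟨n, rfl⟩
  have transform_cluster {μ : ProbabilityMeasure ℝ} {φ : ℕ → ℕ} (hφ : StrictMono φ)
      (hμ : Tendsto (μs ∘ φ) atTop (𝓝 μ)) (z : ℂ) (hz : 0 < z.im) :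
      stieltjesTransform μ z = m z :=
    tendsto_nhds_unique (tendsto_stieltjesTransform
      ((ProbabilityMeasure.tendsto_nhds_iff_toFiniteMeasure_tendsto_nhds _).1 hμ) hz)
      ((h z hz).comp hφ.tendsto_atTop)
  obtain ⟨μ, -, φ, hφ, hμ⟩ := hcompact.tendsto_subseq hmem
  refine ⟨μ, hcompact.tendsto_nhds_of_unique_mapClusterPt (Eventually.of_forall hmem)
    fun μ' _ hμ' => ?_, transform_cluster hφ hμ⟩
  obtain ⟨ψ, hψ, hψμ'⟩ := hμ'.tendsto_subseq
  exact Subtype.ext (measure_ext_of_stieltjesTransform (μ := (μ' : Measure ℝ))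
    (ν := (μ : Measure ℝ)) fun z hz =>
    (transform_cluster hψ hψμ' z hz).trans (transform_cluster hφ hμ z hz).symm)

theorem exists_ae_tendsto_of_ae_tendsto_stieltjesTransform {Ω : Type*} [MeasurableSpace Ω]
    {P : Measure Ω} [NeZero P] {μs : ℕ → Ω → ProbabilityMeasure ℝ} {m : ℂ → ℂ}
    (h : ∀ z : ℂ, 0 < z.im →
      ∀ᵐ ω ∂P, Tendsto (fun n => stieltjesTransform (μs n ω) z) atTop (𝓝 (m z)))
    (hm : Tendsto (fun y : ℝ => y * Complex.I * m (y * Complex.I)) atTop (𝓝 1)) :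
    ∃ μ : ProbabilityMeasure ℝ, (∀ᵐ ω ∂P, Tendsto (fun n => μs n ω) atTop (𝓝 μ)) ∧
      ∀ z : ℂ, 0 < z.im → stieltjesTransform μ z = m z := by
  have hlim := (ae_tendsto_stieltjesTransform h).mono fun ω hω =>
    exists_tendsto_of_tendsto_stieltjesTransform hω hm
  obtain ⟨ω₀, μ, -, hμ⟩ := hlim.exists
  refine ⟨μ, hlim.mono fun ω ⟨μ', hμ'_lim, hμ'⟩ => ?_, hμ⟩
  have heq : μ' = μ := Subtype.ext (measure_ext_of_stieltjesTransform (μ := (μ' : Measure ℝ))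
    (ν := (μ : Measure ℝ)) fun z hz => (hμ' z hz).trans (hμ z hz).symm)
  rwa [← heq]

end StieltjesTransform

section BoundedDifferences

theorem measurePreserving_update_pi {ι : Type*} [Fintype ι] [DecidableEq ι] {E : ι → Type*}
    [∀ i, MeasurableSpace (E i)] (μ : ∀ i, Measure (E i)) [∀ i, IsProbabilityMeasure (μ i)]
    (j : ι) :
    MeasurePreserving (fun q : (∀ i, E i) × E j => Function.update q.1 j q.2)
      ((Measure.pi μ).prod (μ j)) (Measure.pi μ) := by
  have hmeas : Measurable fun q : (∀ i, E i) × E j => Function.update q.1 j q.2 := by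
    fun_prop
  refine ⟨hmeas, (Measure.pi_eq fun s hs => ?_).symm⟩
  have hpre : (fun q : (∀ i, E i) × E j => Function.update q.1 j q.2) ⁻¹' Set.univ.pi s
      = (Set.univ.pi (Function.update s j Set.univ)) ×ˢ s j := by
    ext q
    simp only [Set.mem_preimage, Set.mem_univ_pi, Set.mem_prod]
    rw [Function.forall_update_iff (p := fun i y => y ∈ s i),
      Function.forall_update_iff (p := fun i t => q.1 i ∈ t)]
    simp [and_comm]
  rw [Measure.map_apply hmeas (MeasurableSet.univ_pi hs), hpre, Measure.prod_prod, Measure.pi_pi,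
    ← Finset.mul_prod_erase _ _ (Finset.mem_univ j), Function.update_self, measure_univ, one_mul,
    mul_comm, ← Finset.mul_prod_erase Finset.univ (fun i => μ i (s i)) (Finset.mem_univ j)]
  congr 1
  refine Finset.prod_congr rfl fun i hi => ?_
  rw [Function.update_of_ne (Finset.ne_of_mem_erase hi)]

theorem integral_pi_eq_integral_update {ι : Type*} [Fintype ι] [DecidableEq ι] {E : ι → Type*}
    [∀ i, MeasurableSpace (E i)] (μ : ∀ i, Measure (E i)) [∀ i, IsProbabilityMeasure (μ i)]
    (j : ι) {F : Type*} [NormedAddCommGroup F] [NormedSpace ℝ F] {f : (∀ i, E i) → F}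
    (hf : Integrable f (Measure.pi μ)) :
    ∫ x, f x ∂Measure.pi μ = ∫ x, ∫ v, f (Function.update x j v) ∂μ j ∂Measure.pi μ := by
  have hmp := measurePreserving_update_pi μ j
  calc ∫ x, f x ∂Measure.pi μ
      = ∫ q, f (Function.update q.1 j q.2) ∂(Measure.pi μ).prod (μ j) := by
        rw [← integral_map (φ := fun q : (∀ i, E i) × E j => Function.update q.1 j q.2)
          hmp.measurable.aemeasurable (by rw [hmp.map_eq]; exact hf.aestronglyMeasurable),
          hmp.map_eq]
    _ = _ := integral_prod _ (hmp.integrable_comp_of_integrable hf)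

theorem hasSubgaussianMGF_sub_integral_of_abs_sub_le {Ω : Type*} [MeasurableSpace Ω]
    {P : Measure Ω} [IsProbabilityMeasure P] {X : Ω → ℝ} (hX : Measurable X) {c : ℝ≥0}
    (hc : ∀ v w, |X v - X w| ≤ c) :
    HasSubgaussianMGF (fun v => X v - ∫ w, X w ∂P) ((c / 2) ^ 2) P := by
  have : Nonempty Ω := nonempty_of_isProbabilityMeasure P
  have hbdd : BddBelow (Set.range X) := by
    obtain ⟨w⟩ := ‹Nonempty Ω›
    exact ⟨X w - c, by rintro _ ⟨v, rfl⟩; linarith [(abs_le.1 (hc v w)).1]⟩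
  have hmem : ∀ v, X v ∈ Set.Icc (⨅ w, X w) ((⨅ w, X w) + c) := fun v =>
    ⟨ciInf_le hbdd v, by
      have : X v - c ≤ ⨅ w, X w := le_ciInf fun w => by linarith [(abs_le.1 (hc v w)).2]
      linarith⟩
  simpa using hasSubgaussianMGF_of_mem_Icc hX.aemeasurable (ae_of_all P hmem)

theorem hasSubgaussianMGF_add_prod {Ω Ω' : Type*} [MeasurableSpace Ω] [MeasurableSpace Ω']
    {P : Measure Ω} {L : Measure Ω'} [SFinite P] [SFinite L] {X : Ω → ℝ} {Y : Ω × Ω' → ℝ}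
    {a b : ℝ≥0} (hX : HasSubgaussianMGF X a P) (hYm : Measurable Y)
    (hY : ∀ x, HasSubgaussianMGF (fun v => Y (x, v)) b L) :
    HasSubgaussianMGF (fun q => X q.1 + Y q) (a + b) (P.prod L) := by
  have hexp : ∀ (t : ℝ) x v, Real.exp (t * (X x + Y (x, v)))
      = Real.exp (t * X x) * Real.exp (t * Y (x, v)) := fun t x v => by rw [← Real.exp_add, mul_add]
  have hinner : ∀ (t : ℝ) x, ∫ v, Real.exp (t * X x) * Real.exp (t * Y (x, v)) ∂L
      ≤ Real.exp (t * X x) * Real.exp (b * t ^ 2 / 2) := fun t x => by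
    rw [integral_const_mul]
    exact mul_le_mul_of_nonneg_left ((hY x).mgf_le t) (Real.exp_nonneg _)
  have hint : ∀ t : ℝ, Integrable (fun q => Real.exp (t * (X q.1 + Y q))) (P.prod L) := by
    intro t
    have hXt := hX.integrable_exp_mul t
    have hmeas : AEStronglyMeasurable (fun q => Real.exp (t * (X q.1 + Y q))) (P.prod L) := by
      have := hX.aemeasurable.comp_fst (ν := L)
      exact (Real.measurable_exp.comp_aemeasurable
        ((this.add hYm.aemeasurable).const_mul t)).aestronglyMeasurable
    refine (integrable_prod_iff hmeas).2 ⟨ae_of_all _ fun x => ?_, ?_⟩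
    · simpa only [hexp] using ((hY x).integrable_exp_mul t).const_mul (Real.exp (t * X x))
    · refine (hXt.mul_const (Real.exp (b * t ^ 2 / 2))).mono' hmeas.norm.integral_prod_right'
        (ae_of_all _ fun x => ?_)
      rw [Real.norm_of_nonneg (integral_nonneg fun _ => norm_nonneg _)]
      simpa only [hexp, Real.norm_eq_abs, abs_mul, Real.abs_exp] using hinner t x
  refine ⟨hint, fun t => ?_⟩
  calc mgf (fun q => X q.1 + Y q) (P.prod L) t
      = ∫ x, ∫ v, Real.exp (t * X x) * Real.exp (t * Y (x, v)) ∂L ∂P := by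
        rw [mgf, integral_prod _ (hint t)]
        simp only [hexp]
    _ ≤ ∫ x, Real.exp (t * X x) * Real.exp (b * t ^ 2 / 2) ∂P :=
        integral_mono_of_nonneg (ae_of_all _ fun x => integral_nonneg fun v => by positivity)
          ((hX.integrable_exp_mul t).mul_const _) (ae_of_all _ (hinner t))
    _ ≤ Real.exp (a * t ^ 2 / 2) * Real.exp (b * t ^ 2 / 2) := by
        rw [integral_mul_const]
        exact mul_le_mul_of_nonneg_right (hX.mgf_le t) (Real.exp_nonneg _)
    _ = Real.exp ((a + b : ℝ≥0) * t ^ 2 / 2) := by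
        rw [← Real.exp_add, NNReal.coe_add]
        ring_nf

/-- The bounded differences condition: changing the `j`-th argument of `f` changes its value by at
most `c j`. -/
def HasBoundedDifferences {ι F : Type*} [DecidableEq ι] [SeminormedAddCommGroup F] {E : ι → Type*}
    (f : (∀ i, E i) → F) (c : ι → ℝ≥0) : Prop :=
  ∀ x j v, ‖f (Function.update x j v) - f x‖ ≤ c j

theorem HasBoundedDifferences.cons_left {p : ℕ} {E : Fin (p + 1) → Type*}
    {f : (∀ i, E i) → ℝ} {c : Fin (p + 1) → ℝ≥0} (hf : HasBoundedDifferences f c)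
    (x : ∀ i : Fin p, E i.succ) (v w : E 0) :
    |f (Fin.cons v x : ∀ i, E i) - f (Fin.cons w x : ∀ i, E i)| ≤ c 0 := by
  simpa only [Fin.update_cons_zero, Real.norm_eq_abs] using hf (Fin.cons w x : ∀ i, E i) 0 v

theorem HasBoundedDifferences.cons_right {p : ℕ} {E : Fin (p + 1) → Type*}
    {f : (∀ i, E i) → ℝ} {c : Fin (p + 1) → ℝ≥0} (hf : HasBoundedDifferences f c) (v : E 0) :
    HasBoundedDifferences (fun x : ∀ i : Fin p, E i.succ => f (Fin.cons v x : ∀ i, E i))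
      (fun j => c j.succ) := fun x j w => by
  simpa only [Fin.cons_update] using hf (Fin.cons v x : ∀ i, E i) j.succ w

theorem HasBoundedDifferences.integral {ι Ω : Type*} [DecidableEq ι] {E : ι → Type*}
    [MeasurableSpace Ω] {P : Measure Ω} [IsProbabilityMeasure P] {f : Ω → (∀ i, E i) → ℝ}
    {c : ι → ℝ≥0} (hf : ∀ ω, HasBoundedDifferences (f ω) c)
    (hint : ∀ x, Integrable (fun ω => f ω x) P) :
    HasBoundedDifferences (fun x => ∫ ω, f ω x ∂P) c := fun x j v => by
  rw [← integral_sub (hint _) (hint _)]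
  simpa using norm_integral_le_of_norm_le_const (μ := P)
    (f := fun ω => f ω (Function.update x j v) - f ω x) (ae_of_all _ fun ω => hf ω x j v)

theorem measurePreserving_cons {p : ℕ} {E : Fin (p + 1) → Type*} [∀ i, MeasurableSpace (E i)]
    (μ : ∀ i, Measure (E i)) [∀ i, SigmaFinite (μ i)] :
    MeasurePreserving (fun q : (∀ i : Fin p, E i.succ) × E 0 => (Fin.cons q.2 q.1 : ∀ i, E i))
      ((Measure.pi fun i : Fin p => μ i.succ).prod (μ 0)) (Measure.pi μ) := by
  have h := (measurePreserving_piFinSuccAbove μ 0).symm.comp Measure.measurePreserving_swap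
  have hfun : ⇑(MeasurableEquiv.piFinSuccAbove E 0).symm ∘ Prod.swap
      = fun q : (∀ i : Fin p, E i.succ) × E 0 => (Fin.cons q.2 q.1 : ∀ i, E i) :=
    funext fun q => Fin.insertNth_zero q.2 q.1
  exact hfun ▸ h

theorem HasBoundedDifferences.hasSubgaussianMGF_sub_integral : ∀ {p : ℕ} {E : Fin p → Type*}
    [∀ i, MeasurableSpace (E i)] (μ : ∀ i, Measure (E i)) [∀ i, IsProbabilityMeasure (μ i)]
    {f : (∀ i, E i) → ℝ} {c : Fin p → ℝ≥0}, HasBoundedDifferences f c → Measurable f →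
      HasSubgaussianMGF (fun x => f x - ∫ y, f y ∂Measure.pi μ) (∑ i, (c i / 2) ^ 2)
        (Measure.pi μ)
  | 0, E, _, μ, _, f, c, _, _ => by
    have hconst : (fun x => f x - ∫ y, f y ∂Measure.pi μ) = fun _ => 0 := by
      have : ∀ x, f x = f default := fun x => by rw [Subsingleton.elim x default]
      simp [this]
    simp [hconst]
  | p + 1, E, _, μ, _, f, c, hf, hfm => by
    have hcons := measurePreserving_cons μ
    set P := Measure.pi fun i : Fin p => μ i.succ
    let F : (∀ i : Fin p, E i.succ) × E 0 → ℝ := fun q => f (Fin.cons q.2 q.1 : ∀ i, E i)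
    have hF : Measurable F := hfm.comp hcons.measurable
    have hFx : ∀ x, HasSubgaussianMGF (fun v => F (x, v) - ∫ w, F (x, w) ∂μ 0) ((c 0 / 2) ^ 2)
        (μ 0) := fun x => hasSubgaussianMGF_sub_integral_of_abs_sub_le
      (hF.comp measurable_prodMk_left) (hf.cons_left x)
    have hFint : ∀ x, Integrable (fun v => F (x, v)) (μ 0) := fun x => by
      simpa only [Pi.add_def, sub_add_cancel] using
        (hFx x).integrable.add (integrable_const (∫ w, F (x, w) ∂μ 0))
    let g : (∀ i : Fin p, E i.succ) → ℝ := fun x => ∫ v, F (x, v) ∂μ 0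
    have hg : Measurable g := hF.stronglyMeasurable.integral_prod_right'.measurable
    have hgc : HasBoundedDifferences g fun j => c j.succ :=
      HasBoundedDifferences.integral (fun v => hf.cons_right v) hFint
    have hsum : HasSubgaussianMGF (fun q => F q - ∫ x, g x ∂P) (∑ i, (c i / 2) ^ 2)
        (P.prod (μ 0)) := by
      rw [Fin.sum_univ_succ, add_comm ((c 0 / 2) ^ 2)]
      exact (hasSubgaussianMGF_add_prod (hgc.hasSubgaussianMGF_sub_integral _ hg)
        (hF.sub (hg.comp measurable_fst)) hFx).congr (ae_of_all _ fun q => by simp [P])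
    have hFprod : Integrable F (P.prod (μ 0)) := by
      simpa only [Pi.add_def, sub_add_cancel] using
        hsum.integrable.add (integrable_const (∫ x, g x ∂P))
    have hmean : ∫ y, f y ∂Measure.pi μ = ∫ x, g x ∂P := by
      rw [← hcons.map_eq, integral_map hcons.measurable.aemeasurable hfm.aestronglyMeasurable]
      exact integral_prod _ hFprod
    refine hsum.congr_identDistrib ⟨by fun_prop, by fun_prop, ?_⟩
    rw [hmean, ← hcons.map_eq, Measure.map_map (by fun_prop) hcons.measurable]
    rfl

theorem HasBoundedDifferences.measureReal_abs_sub_integral_ge_le {p : ℕ} {E : Fin p → Type*}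
    [∀ i, MeasurableSpace (E i)] (μ : ∀ i, Measure (E i)) [∀ i, IsProbabilityMeasure (μ i)]
    {f : (∀ i, E i) → ℝ} {c : Fin p → ℝ≥0} (hf : HasBoundedDifferences f c) (hfm : Measurable f)
    {ε : ℝ} (hε : 0 ≤ ε) :
    (Measure.pi μ).real {x | ε ≤ |f x - ∫ y, f y ∂Measure.pi μ|}
      ≤ 2 * Real.exp (-(2 * ε ^ 2 / ∑ i, (c i : ℝ) ^ 2)) := by
  set a := ∫ y, f y ∂Measure.pi μ
  have hsub := hf.hasSubgaussianMGF_sub_integral μ hfm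
  have hexponent :
      -ε ^ 2 / (2 * (∑ i, (c i / 2) ^ 2 : ℝ≥0)) = -(2 * ε ^ 2 / ∑ i, (c i : ℝ) ^ 2) := by
    push_cast
    simp only [div_pow, ← Finset.sum_div]
    ring
  have hcover : {x | ε ≤ |f x - a|} ⊆ {x | ε ≤ f x - a} ∪ {x | ε ≤ (-fun x => f x - a) x} :=
    fun x hx => le_abs.1 (show ε ≤ |f x - a| from hx)
  have hunion := (measureReal_mono (μ := Measure.pi μ) hcover).trans (measureReal_union_le _ _)
  have hupper := hsub.measure_ge_le hε
  have hlower := hsub.neg.measure_ge_le hε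
  rw [hexponent] at hupper hlower
  linarith

theorem HasBoundedDifferences.re {ι : Type*} [DecidableEq ι] {E : ι → Type*} {f : (∀ i, E i) → ℂ}
    {c : ι → ℝ≥0} (hf : HasBoundedDifferences f c) :
    HasBoundedDifferences (fun x => (f x).re) c := fun x j v =>
  (Complex.abs_re_le_norm (f (Function.update x j v) - f x)).trans (hf x j v)

theorem HasBoundedDifferences.im {ι : Type*} [DecidableEq ι] {E : ι → Type*} {f : (∀ i, E i) → ℂ}
    {c : ι → ℝ≥0} (hf : HasBoundedDifferences f c) :
    HasBoundedDifferences (fun x => (f x).im) c := fun x j v =>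
  (Complex.abs_im_le_norm (f (Function.update x j v) - f x)).trans (hf x j v)

theorem HasBoundedDifferences.measureReal_norm_sub_integral_ge_le {p : ℕ} {E : Fin p → Type*}
    [∀ i, MeasurableSpace (E i)] (μ : ∀ i, Measure (E i)) [∀ i, IsProbabilityMeasure (μ i)]
    {f : (∀ i, E i) → ℂ} {c : Fin p → ℝ≥0} (hf : HasBoundedDifferences f c)
    (hint : Integrable f (Measure.pi μ)) (hfm : Measurable f) {ε : ℝ} (hε : 0 ≤ ε) :
    (Measure.pi μ).real {x | ε ≤ ‖f x - ∫ y, f y ∂Measure.pi μ‖}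
      ≤ 4 * Real.exp (-(ε ^ 2 / (2 * ∑ i, (c i : ℝ) ^ 2))) := by
  have hre := hf.re.measureReal_abs_sub_integral_ge_le μ
    (Complex.measurable_re.comp hfm) (div_nonneg hε zero_le_two)
  have him := hf.im.measureReal_abs_sub_integral_ge_le μ
    (Complex.measurable_im.comp hfm) (div_nonneg hε zero_le_two)
  have hmean_re : ∫ x, (f x).re ∂Measure.pi μ = (∫ x, f x ∂Measure.pi μ).re := integral_re hint
  have hmean_im : ∫ x, (f x).im ∂Measure.pi μ = (∫ x, f x ∂Measure.pi μ).im := integral_im hint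
  rw [hmean_re] at hre
  rw [hmean_im] at him
  set a := ∫ y, f y ∂Measure.pi μ
  have hcover : {x | ε ≤ ‖f x - a‖} ⊆ {x | ε / 2 ≤ |(f x).re - a.re|} ∪
      {x | ε / 2 ≤ |(f x).im - a.im|} := by
    intro x (hx : ε ≤ ‖f x - a‖)
    have hle := hx.trans (Complex.norm_le_abs_re_add_abs_im (f x - a))
    by_contra! hlt
    simp only [Set.mem_union, Set.mem_ofPred_eq, not_or, not_le] at hlt
    rw [Complex.sub_re, Complex.sub_im] at hle
    linarith [hlt.1, hlt.2]
  have hexponent : 2 * (ε / 2) ^ 2 / ∑ i, (c i : ℝ) ^ 2 = ε ^ 2 / (2 * ∑ i, (c i : ℝ) ^ 2) := by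
    rw [div_pow, ← div_div]
    ring
  rw [hexponent] at hre him
  exact (measureReal_mono hcover).trans ((measureReal_union_le _ _).trans (by linarith))

end BoundedDifferences

section TensorMoments

open scoped symmDiff Finset

variable {n d : ℕ}

theorem descFactorial_mul_pow_le (hdn : d ≤ n) (k : ℕ) :
    d.descFactorial k * n ^ k ≤ n.descFactorial k * d ^ k := by
  induction k with
  | zero => simp
  | succ k ih =>
    have hstep : (d - k) * n ≤ (n - k) * d := by
      rcases le_total d k with h | h
      · simp [Nat.sub_eq_zero_of_le h]
      · zify [h, h.trans hdn]
        nlinarith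
    calc d.descFactorial (k + 1) * n ^ (k + 1)
        = (d.descFactorial k * n ^ k) * ((d - k) * n) := by
          rw [Nat.descFactorial_succ, pow_succ]; ring
      _ ≤ (n.descFactorial k * d ^ k) * ((n - k) * d) := Nat.mul_le_mul ih hstep
      _ = n.descFactorial (k + 1) * d ^ (k + 1) := by
          rw [Nat.descFactorial_succ, pow_succ]; ring

theorem choose_mul_pow_le (hdn : d ≤ n) (k : ℕ) :
    d.choose k * n ^ k ≤ n.choose k * d ^ k := by
  have h := descFactorial_mul_pow_le hdn k
  rw [Nat.descFactorial_eq_factorial_mul_choose, Nat.descFactorial_eq_factorial_mul_choose,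
    mul_assoc, mul_assoc] at h
  exact Nat.le_of_mul_le_mul_left h k.factorial_pos

theorem choose_sub_mul_pow_le {k : ℕ} (hkd : k ≤ d) (hdn : d ≤ n) :
    (n - k).choose (d - k) * n ^ k ≤ n.choose d * d ^ k := by
  refine Nat.le_of_mul_le_mul_left ?_ (Nat.choose_pos (hkd.trans hdn))
  calc n.choose k * ((n - k).choose (d - k) * n ^ k)
      = n.choose d * (d.choose k * n ^ k) := by rw [← mul_assoc, ← Nat.choose_mul hkd, mul_assoc]
    _ ≤ n.choose d * (n.choose k * d ^ k) := Nat.mul_le_mul_left _ (choose_mul_pow_le hdn k)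
    _ = n.choose k * (n.choose d * d ^ k) := Nat.mul_left_comm ..

theorem card_superset_le_choose (e : Finset (Fin n)) :
    #{u : TensorIndex n d | e ⊆ u.1} ≤ (n - #e).choose (d - #e) := by
  calc #{u : TensorIndex n d | e ⊆ u.1} ≤ #((Finset.univ \ e).powersetCard (d - #e)) := by
        refine Finset.card_le_card_of_injOn (fun u => u.1 \ e) (fun u hu => ?_)
          fun u hu v hv huv => Subtype.ext ?_
        · have hu' : e ⊆ u.1 := by simpa using hu
          refine Finset.mem_coe.2 (Finset.mem_powersetCard.2
            ⟨Finset.sdiff_subset_sdiff (Finset.subset_univ _) le_rfl, ?_⟩)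
          rw [Finset.card_sdiff_of_subset hu', u.2]
        · have hu' : e ⊆ u.1 := by simpa using hu
          have hv' : e ⊆ v.1 := by simpa using hv
          rw [← Finset.sdiff_union_of_subset hu', ← Finset.sdiff_union_of_subset hv',
            show u.1 \ e = v.1 \ e from huv]
    _ = (n - #e).choose (d - #e) := by
        rw [Finset.card_powersetCard, Finset.card_sdiff_of_subset (Finset.subset_univ _),
          Finset.card_univ, Fintype.card_fin]

theorem card_superset_le (e : Finset (Fin n)) :
    (#{u : TensorIndex n d | e ⊆ u.1} : ℝ) ≤ n.choose d * ((d : ℝ) / n) ^ #e := by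
  by_cases hex : ∃ u : TensorIndex n d, e ⊆ u.1
  · obtain ⟨u, hu⟩ := hex
    have hed : #e ≤ d := (Finset.card_le_card hu).trans_eq u.2
    have hdn : d ≤ n := by simpa [u.2] using Finset.card_le_univ u.1
    have hpow : 0 < n ^ #e := by
      rcases n.eq_zero_or_pos with h | h
      · simp [show #e = 0 by lia]
      · exact pow_pos h _
    have hcard := (Nat.mul_le_mul_right (n ^ #e) (card_superset_le_choose (d := d) e)).trans
      (choose_sub_mul_pow_le hed hdn)
    rw [div_pow, ← mul_div_assoc, le_div_iff₀ (mod_cast hpow)]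
    exact_mod_cast hcard
  · rw [Finset.filter_false_of_mem fun u _ hu => hex ⟨u, hu⟩, Finset.card_empty, Nat.cast_zero]
    positivity

theorem sum_pow_card_inter_le {κ : ℝ} (hκ : 1 ≤ κ) {a b : Finset (Fin n)}
    (hab : Disjoint a b) :
    ∑ u : TensorIndex n d with b ⊆ u.1, κ ^ #(a ∩ u.1)
      ≤ n.choose d * ((d : ℝ) / n) ^ #b * (1 + (κ - 1) * ((d : ℝ) / n)) ^ #a := by
  have hbinom : ∀ (x : ℝ) (c : Finset (Fin n)), (1 + x) ^ #c = ∑ w ∈ c.powerset, x ^ #w := by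
    intro x c
    simpa [add_comm] using (Finset.sum_pow_mul_eq_add_pow x 1 c).symm
  have hexpand : ∀ u : TensorIndex n d, κ ^ #(a ∩ u.1)
      = ∑ w ∈ a.powerset, if w ⊆ u.1 then (κ - 1) ^ #w else 0 := by
    intro u
    rw [← Finset.sum_filter, ← add_sub_cancel 1 κ, hbinom, add_sub_cancel]
    refine Finset.sum_congr ?_ fun _ _ => rfl
    ext w
    simp only [Finset.mem_powerset, Finset.mem_filter, Finset.subset_inter_iff]
  simp_rw [hexpand]
  rw [Finset.sum_comm, hbinom, Finset.mul_sum]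
  refine Finset.sum_le_sum fun w hw => ?_
  have hbw : Disjoint b w := (Finset.disjoint_of_subset_left (Finset.mem_powerset.1 hw) hab).symm
  calc ∑ u : TensorIndex n d with b ⊆ u.1, (if w ⊆ u.1 then (κ - 1) ^ #w else 0)
      = #{u : TensorIndex n d | b ∪ w ⊆ u.1} * (κ - 1) ^ #w := by
        simp only [← Finset.sum_filter, Finset.filter_filter, Finset.sum_const, nsmul_eq_mul,
          Finset.union_subset_iff]
    _ ≤ n.choose d * ((d : ℝ) / n) ^ #(b ∪ w) * (κ - 1) ^ #w :=
        mul_le_mul_of_nonneg_right (card_superset_le _) (pow_nonneg (sub_nonneg.2 hκ) _)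
    _ = n.choose d * ((d : ℝ) / n) ^ #b * ((κ - 1) * ((d : ℝ) / n)) ^ #w := by
        rw [Finset.card_union_of_disjoint hbw, pow_add, mul_pow]
        ring

/-- The law of a symmetric real random variable with unit variance and finite fourth moment. -/
structure IsSymmUnit (ν : Measure ℝ) : Prop where
  map_neg : ν.map (fun x => -x) = ν
  integral_sq : ∫ x, x ^ 2 ∂ν = 1
  integrable_pow_four : Integrable (fun x : ℝ => x ^ 4) ν

namespace IsSymmUnit

variable {ν : Measure ℝ}

theorem integrable_pow [IsFiniteMeasure ν] (h : IsSymmUnit ν) {k : ℕ} (hk : k ≤ 4) :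
    Integrable (fun x : ℝ => x ^ k) ν := by
  refine ((integrable_const 1).add h.integrable_pow_four).mono' (by fun_prop)
    (ae_of_all _ fun x => ?_)
  rw [norm_pow, Pi.add_apply, ← Even.pow_abs (by decide : Even 4) x, Real.norm_eq_abs]
  rcases le_total |x| 1 with hx | hx
  · exact (pow_le_one₀ (abs_nonneg x) hx).trans (le_add_of_nonneg_right (by positivity))
  · exact (pow_le_pow_right₀ hx hk).trans (le_add_of_nonneg_left zero_le_one)

theorem integral_pow_of_odd (h : IsSymmUnit ν) {k : ℕ} (hk : Odd k) : ∫ x, x ^ k ∂ν = 0 := by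
  have hneg : ∫ x, x ^ k ∂ν = ∫ x, (-x) ^ k ∂ν := by
    conv_lhs => rw [← h.map_neg, integral_map (by fun_prop) (by fun_prop)]
  simp only [hk.neg_pow, integral_neg] at hneg
  linarith

theorem one_le_integral_pow_four [IsProbabilityMeasure ν] (h : IsSymmUnit ν) :
    1 ≤ ∫ x, x ^ 4 ∂ν := by
  have hsq := (h.integrable_pow (k := 2) (by norm_num)).const_mul 2
  calc (1 : ℝ) = ∫ x, (2 * x ^ 2 - 1) ∂ν := by
        rw [integral_sub hsq (integrable_const _), integral_const_mul, h.integral_sq]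
        norm_num
    _ ≤ ∫ x, x ^ 4 ∂ν := integral_mono (hsq.sub (integrable_const _)) h.integrable_pow_four
        fun x => by nlinarith only [sq_nonneg (x ^ 2 - 1)]

end IsSymmUnit

/-- The exponent of `x i` in the monomial `∏ i ∈ s, x i`. -/
def incidence (s : Finset (Fin n)) (i : Fin n) : ℕ := if i ∈ s then 1 else 0

theorem incidence_le_one (s : Finset (Fin n)) (i : Fin n) : incidence s i ≤ 1 := by
  unfold incidence
  split_ifs <;> simp

theorem tensorVector_mul_eq_prod (x : Fin n → ℝ) (s t : TensorIndex n d) :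
    tensorVector d x s * tensorVector d x t
      = ∏ i, x i ^ (incidence s.1 i + incidence t.1 i) := by
  simp only [tensorVector, incidence, pow_add, Finset.prod_mul_distrib, pow_ite, pow_one, pow_zero,
    Finset.prod_ite_mem, Finset.univ_inter]

theorem tensorVector_mul_mul_eq_prod (x : Fin n → ℝ) (s t u v : TensorIndex n d) :
    (tensorVector d x s * tensorVector d x t) * (tensorVector d x u * tensorVector d x v)
      = ∏ i, x i ^ ((incidence s.1 i + incidence t.1 i)
        + (incidence u.1 i + incidence v.1 i)) := by
  simp only [tensorVector_mul_eq_prod, ← Finset.prod_mul_distrib, ← pow_add]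

theorem tensorIndex_eq_iff_symmDiff_eq_empty (s t : TensorIndex n d) : s = t ↔ s.1 ∆ t.1 = ∅ := by
  rw [← Finset.bot_eq_empty, symmDiff_eq_bot, Subtype.ext_iff]

variable {ν : Measure ℝ} [IsProbabilityMeasure ν]

theorem integrable_prod_pow (h : IsSymmUnit ν) {m : Fin n → ℕ} (hm : ∀ i, m i ≤ 4) :
    Integrable (fun x : Fin n → ℝ => ∏ i, x i ^ m i) (Measure.pi fun _ => ν) :=
  Integrable.fintype_prod (f := fun i (x : ℝ) => x ^ m i) fun i => h.integrable_pow (hm i)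

theorem integral_prod_pow (m : Fin n → ℕ) :
    ∫ x : Fin n → ℝ, ∏ i, x i ^ m i ∂(Measure.pi fun _ => ν) = ∏ i, ∫ x, x ^ m i ∂ν :=
  integral_fintype_prod_eq_prod fun i (x : ℝ) => x ^ m i

theorem integral_prod_pow_eq_zero_of_odd (h : IsSymmUnit ν) {m : Fin n → ℕ} {i : Fin n}
    (hi : Odd (m i)) : ∫ x : Fin n → ℝ, ∏ i, x i ^ m i ∂(Measure.pi fun _ => ν) = 0 := by
  rw [integral_prod_pow]
  exact Finset.prod_eq_zero (Finset.mem_univ i) (h.integral_pow_of_odd hi)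

theorem integrable_tensorVector_mul (h : IsSymmUnit ν) (s t : TensorIndex n d) :
    Integrable (fun x => tensorVector d x s * tensorVector d x t)
      (Measure.pi fun _ : Fin n => ν) := by
  simp_rw [tensorVector_mul_eq_prod]
  refine integrable_prod_pow h fun i => ?_
  linarith [incidence_le_one s.1 i, incidence_le_one t.1 i]

theorem integrable_tensorVector_mul_mul (h : IsSymmUnit ν) (s t u v : TensorIndex n d) :
    Integrable (fun x => (tensorVector d x s * tensorVector d x t)
      * (tensorVector d x u * tensorVector d x v)) (Measure.pi fun _ : Fin n => ν) := by
  simp_rw [tensorVector_mul_mul_eq_prod]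
  refine integrable_prod_pow h fun i => ?_
  linarith [incidence_le_one s.1 i, incidence_le_one t.1 i, incidence_le_one u.1 i,
    incidence_le_one v.1 i]

theorem integral_tensorVector_mul (h : IsSymmUnit ν) (s t : TensorIndex n d) :
    ∫ x, tensorVector d x s * tensorVector d x t ∂(Measure.pi fun _ : Fin n => ν)
      = if s = t then 1 else 0 := by
  simp_rw [tensorVector_mul_eq_prod]
  split_ifs with hst
  · subst hst
    rw [integral_prod_pow]
    refine Finset.prod_eq_one fun i _ => ?_
    by_cases hi : i ∈ s.1 <;> simp [incidence, hi, h.integral_sq]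
  · obtain ⟨i, hi⟩ := Finset.nonempty_iff_ne_empty.2
      (mt (tensorIndex_eq_iff_symmDiff_eq_empty s t).2 hst)
    refine integral_prod_pow_eq_zero_of_odd h (i := i) ?_
    rcases Finset.mem_symmDiff.1 hi with ⟨hs, ht⟩ | ⟨hs, ht⟩ <;> simp [incidence, hs, ht]

theorem integral_tensorVector_mul_mul (h : IsSymmUnit ν) (s t u v : TensorIndex n d) :
    ∫ x, (tensorVector d x s * tensorVector d x t) * (tensorVector d x u * tensorVector d x v)
      ∂(Measure.pi fun _ : Fin n => ν)
      = if s.1 ∆ t.1 = u.1 ∆ v.1 then (∫ x, x ^ 4 ∂ν) ^ #(s.1 ∩ t.1 ∩ (u.1 ∩ v.1)) else 0 := by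
  simp_rw [tensorVector_mul_mul_eq_prod]
  split_ifs with hst
  · rw [integral_prod_pow, ← Finset.prod_const, ← Finset.prod_filter_mul_prod_filter_not
      Finset.univ (fun i => i ∈ s.1 ∩ t.1 ∩ (u.1 ∩ v.1)), Finset.filter_univ_mem]
    rw [Finset.prod_eq_one (s := Finset.univ.filter fun i => i ∉ s.1 ∩ t.1 ∩ (u.1 ∩ v.1)), mul_one]
    · refine Finset.prod_congr rfl fun i hi => ?_
      simp only [Finset.mem_inter] at hi
      simp [incidence, hi]
    · intro i hi
      have hiff := Finset.ext_iff.1 hst i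
      simp only [Finset.mem_symmDiff] at hiff
      simp only [Finset.mem_filter, Finset.mem_univ, true_and, Finset.mem_inter] at hi
      by_cases hs : i ∈ s.1 <;> by_cases ht : i ∈ t.1 <;> by_cases hu : i ∈ u.1 <;>
        by_cases hv : i ∈ v.1 <;> simp_all [incidence, h.integral_sq]
  · obtain ⟨i, hi⟩ := not_forall.1 (mt Finset.ext hst)
    refine integral_prod_pow_eq_zero_of_odd h (i := i) ?_
    simp only [Finset.mem_symmDiff] at hi
    by_cases hs : i ∈ s.1 <;> by_cases ht : i ∈ t.1 <;> by_cases hu : i ∈ u.1 <;>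
      by_cases hv : i ∈ v.1 <;> grind [incidence]

/-- The covariance of `X_s X_t` and `X_u X_v`, for `p = (s, t)` and `q = (u, v)`, where `X` is the
tensor vector and `κ` is the fourth moment of its factors. -/
noncomputable def tensorCov (κ : ℝ) (p q : TensorIndex n d × TensorIndex n d) : ℝ :=
  (if p.1.1 ∆ p.2.1 = q.1.1 ∆ q.2.1 then κ ^ #(p.1.1 ∩ p.2.1 ∩ (q.1.1 ∩ q.2.1)) else 0)
    - (if p.1 = p.2 then 1 else 0) * (if q.1 = q.2 then 1 else 0)

theorem tensorCov_nonneg {κ : ℝ} (hκ : 1 ≤ κ) (p q : TensorIndex n d × TensorIndex n d) :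
    0 ≤ tensorCov κ p q := by
  have hpow : ∀ k : ℕ, 1 ≤ κ ^ k := fun k => one_le_pow₀ hκ
  unfold tensorCov
  by_cases hpq : p.1 = p.2 ∧ q.1 = q.2
  · simp [hpq.1, hpq.2, hpow]
  · have hzero : ((if p.1 = p.2 then 1 else 0) * (if q.1 = q.2 then 1 else 0) : ℝ) = 0 := by
      rcases not_and_or.1 hpq with h | h <;> simp [h]
    rw [hzero, sub_zero]
    split_ifs
    exacts [zero_le_one.trans (hpow _), le_rfl]

/-- The variance of a quadratic form in the tensor vector of order `d` in `n` variables with fourth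
moment `κ`, relative to `n.choose d` times the squared Frobenius norm of its matrix. -/
noncomputable def tensorVarianceRatio (n d : ℕ) (κ : ℝ) : ℝ :=
  ((1 + (κ - 1) * ((d : ℝ) / n)) ^ d - 1)
    + 2 * d * ((d : ℝ) / n) * (1 + (κ - 1) * ((d : ℝ) / n)) ^ d

theorem one_le_one_add_mul_div {κ : ℝ} (hκ : 1 ≤ κ) (n d : ℕ) :
    1 ≤ 1 + (κ - 1) * ((d : ℝ) / n) :=
  le_add_of_nonneg_right (mul_nonneg (sub_nonneg.2 hκ) (by positivity))

theorem tensorVarianceRatio_nonneg {κ : ℝ} (hκ : 1 ≤ κ) : 0 ≤ tensorVarianceRatio n d κ := by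
  have hpow := one_le_pow₀ (one_le_one_add_mul_div hκ n d) (n := d)
  exact add_nonneg (sub_nonneg.2 hpow)
    (mul_nonneg (by positivity) (zero_le_one.trans hpow))

theorem sum_tensorCov_diag_le {κ : ℝ} (hκ : 1 ≤ κ) (s : TensorIndex n d) :
    ∑ q, tensorCov κ (s, s) q ≤ n.choose d * ((1 + (κ - 1) * ((d : ℝ) / n)) ^ d - 1) := by
  have hterm : ∀ u v : TensorIndex n d, tensorCov κ (s, s) (u, v)
      = if u = v then κ ^ #(s.1 ∩ u.1) - 1 else 0 := by
    intro u v
    by_cases h : u = v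
    · simp [tensorCov, h]
    · have hne : ∅ ≠ u.1 ∆ v.1 := fun he =>
        h ((tensorIndex_eq_iff_symmDiff_eq_empty u v).2 he.symm)
      simp [tensorCov, h, hne]
  have hsum : ∑ u : TensorIndex n d, κ ^ #(s.1 ∩ u.1)
      ≤ n.choose d * (1 + (κ - 1) * ((d : ℝ) / n)) ^ d := by
    simpa [s.2] using sum_pow_card_inter_le (d := d) hκ (Finset.disjoint_empty_right s.1)
  simp only [Fintype.sum_prod_type, hterm, Finset.sum_ite_eq, Finset.mem_univ, if_true,
    Finset.sum_sub_distrib, Finset.sum_const, Finset.card_univ, card_tensorIndex, nsmul_eq_mul]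
  linarith

theorem symmDiff_inter_nonempty {s t u v : TensorIndex n d} (hst : s ≠ t)
    (h : s.1 ∆ t.1 = u.1 ∆ v.1) : (s.1 ∆ t.1 ∩ u.1).Nonempty := by
  by_contra hempty
  rw [Finset.not_nonempty_iff_eq_empty, h, Finset.eq_empty_iff_forall_notMem] at hempty
  have hsub : u.1 ⊆ v.1 := fun i hi => by
    by_contra hiv
    exact hempty i (by simp [Finset.mem_symmDiff, hi, hiv])
  have huv : u = v := Subtype.ext (Finset.eq_of_subset_of_card_le hsub (by rw [u.2, v.2]))
  exact hst ((tensorIndex_eq_iff_symmDiff_eq_empty s t).2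
    (h.trans ((tensorIndex_eq_iff_symmDiff_eq_empty u v).1 huv)))

theorem sum_tensorCov_row_le {κ : ℝ} (hκ : 1 ≤ κ) {s t : TensorIndex n d} (hst : s ≠ t)
    (u : TensorIndex n d) :
    ∑ v, tensorCov κ (s, t) (u, v) ≤ ∑ i ∈ s.1 ∆ t.1 with i ∈ u.1, κ ^ #(s.1 ∩ t.1 ∩ u.1) := by
  have : 0 ≤ κ := zero_le_one.trans hκ
  have hterm : ∀ v : TensorIndex n d, tensorCov κ (s, t) (u, v)
      = if s.1 ∆ t.1 = u.1 ∆ v.1 then κ ^ #(s.1 ∩ t.1 ∩ (u.1 ∩ v.1)) else 0 := fun v => by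
    simp [tensorCov, hst]
  simp only [hterm]
  by_cases hex : ∃ v : TensorIndex n d, s.1 ∆ t.1 = u.1 ∆ v.1
  · obtain ⟨v, hv⟩ := hex
    have huniq : ∀ v' : TensorIndex n d, v' ≠ v → s.1 ∆ t.1 ≠ u.1 ∆ v'.1 := fun v' hne hv' =>
      hne (Subtype.ext (symmDiff_right_injective u.1 (hv'.symm.trans hv)))
    obtain ⟨i, hi⟩ := symmDiff_inter_nonempty hst hv
    rw [Finset.sum_eq_single v (fun v' _ hne => if_neg (huniq v' hne))
      (fun h => absurd (Finset.mem_univ v) h), if_pos hv]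
    calc κ ^ #(s.1 ∩ t.1 ∩ (u.1 ∩ v.1)) ≤ κ ^ #(s.1 ∩ t.1 ∩ u.1) :=
          pow_le_pow_right₀ hκ (Finset.card_le_card (by grind))
      _ ≤ ∑ i ∈ s.1 ∆ t.1 with i ∈ u.1, κ ^ #(s.1 ∩ t.1 ∩ u.1) :=
          Finset.single_le_sum (f := fun _ => κ ^ #(s.1 ∩ t.1 ∩ u.1)) (fun _ _ => by positivity)
            (Finset.mem_filter.2 (Finset.mem_inter.1 hi))
  · rw [Finset.sum_eq_zero fun v _ => if_neg (not_exists.1 hex v)]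
    positivity

theorem sum_tensorCov_offDiag_le {κ : ℝ} (hκ : 1 ≤ κ) {s t : TensorIndex n d} (hst : s ≠ t) :
    ∑ q, tensorCov κ (s, t) q ≤ n.choose d *
      (2 * d * ((d : ℝ) / n) * (1 + (κ - 1) * ((d : ℝ) / n)) ^ d) := by
  have hbase := one_le_one_add_mul_div hκ n d
  have hcol : ∀ i ∈ s.1 ∆ t.1, ∑ u : TensorIndex n d with i ∈ u.1, κ ^ #(s.1 ∩ t.1 ∩ u.1)
      ≤ n.choose d * ((d : ℝ) / n) * (1 + (κ - 1) * ((d : ℝ) / n)) ^ d := by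
    intro i hi
    have hdisj : Disjoint (s.1 ∩ t.1) {i} := by
      rw [Finset.disjoint_singleton_right]
      grind [Finset.mem_symmDiff]
    have hsum := sum_pow_card_inter_le (d := d) hκ hdisj
    simp only [Finset.singleton_subset_iff, Finset.card_singleton, pow_one] at hsum
    refine hsum.trans (mul_le_mul_of_nonneg_left (pow_le_pow_right₀ hbase ?_) (by positivity))
    exact (Finset.card_le_card Finset.inter_subset_left).trans s.2.le
  have hcard : (#(s.1 ∆ t.1) : ℝ) ≤ 2 * d := by
    have : #(s.1 ∆ t.1) ≤ #s.1 + #t.1 :=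
      (Finset.card_le_card symmDiff_le_sup).trans (Finset.card_union_le _ _)
    rw [s.2, t.2, ← two_mul] at this
    exact_mod_cast this
  calc ∑ q, tensorCov κ (s, t) q
      ≤ ∑ u : TensorIndex n d, ∑ i ∈ s.1 ∆ t.1 with i ∈ u.1, κ ^ #(s.1 ∩ t.1 ∩ u.1) := by
        rw [Fintype.sum_prod_type]
        exact Finset.sum_le_sum fun u _ => sum_tensorCov_row_le hκ hst u
    _ = ∑ i ∈ s.1 ∆ t.1, ∑ u : TensorIndex n d with i ∈ u.1, κ ^ #(s.1 ∩ t.1 ∩ u.1) := by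
        simp only [Finset.sum_filter]
        exact Finset.sum_comm
    _ ≤ #(s.1 ∆ t.1) * (n.choose d * ((d : ℝ) / n) * (1 + (κ - 1) * ((d : ℝ) / n)) ^ d) := by
        simpa using Finset.sum_le_sum hcol
    _ ≤ 2 * d * (n.choose d * ((d : ℝ) / n) * (1 + (κ - 1) * ((d : ℝ) / n)) ^ d) :=
        mul_le_mul_of_nonneg_right hcard (by positivity)
    _ = _ := by ring

theorem sum_tensorCov_le {κ : ℝ} (hκ : 1 ≤ κ) (p : TensorIndex n d × TensorIndex n d) :
    ∑ q, tensorCov κ p q ≤ n.choose d * tensorVarianceRatio n d κ := by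
  have hpow := one_le_pow₀ (one_le_one_add_mul_div hκ n d) (n := d)
  obtain ⟨s, t⟩ := p
  rw [tensorVarianceRatio, mul_add]
  by_cases h : s = t
  · subst h
    exact (sum_tensorCov_diag_le hκ s).trans (le_add_of_nonneg_right (by positivity))
  · exact (sum_tensorCov_offDiag_le hκ h).trans
      (le_add_of_nonneg_left (mul_nonneg (by positivity) (sub_nonneg.2 hpow)))

theorem sum_mul_mul_le_of_row_sum_le {ι : Type*} [Fintype ι] {V : ι → ι → ℝ} {e : ℝ}
    (hnonneg : ∀ p q, 0 ≤ V p q) (hcomm : ∀ p q, V p q = V q p) (hrow : ∀ p, ∑ q, V p q ≤ e)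
    (a : ι → ℝ) : ∑ p, ∑ q, a p * a q * V p q ≤ e * ∑ p, a p ^ 2 := by
  calc ∑ p, ∑ q, a p * a q * V p q
      ≤ ∑ p, ∑ q, (a p ^ 2 / 2 * V p q + a q ^ 2 / 2 * V q p) := by
        refine Finset.sum_le_sum fun p _ => Finset.sum_le_sum fun q _ => ?_
        rw [hcomm q p]
        nlinarith [mul_nonneg (sq_nonneg (a p - a q)) (hnonneg p q)]
    _ = ∑ p, a p ^ 2 * ∑ q, V p q := by
        simp only [Finset.sum_add_distrib]
        rw [Finset.sum_comm (f := fun p q => a q ^ 2 / 2 * V q p), ← Finset.sum_add_distrib]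
        simp only [← Finset.mul_sum, ← add_mul, add_halves]
    _ ≤ ∑ p, a p ^ 2 * e :=
        Finset.sum_le_sum fun p _ => mul_le_mul_of_nonneg_left (hrow p) (sq_nonneg _)
    _ = e * ∑ p, a p ^ 2 := by rw [← Finset.sum_mul, mul_comm]

section SecondMoment

variable {ι Ω E : Type*} [Fintype ι] [MeasurableSpace Ω] {P : Measure Ω} [NormedAddCommGroup E]
  [InnerProductSpace ℝ E] {W : ι → Ω → ℝ}

theorem norm_sum_smul_sq (w : ι → ℝ) (b : ι → E) :
    ‖∑ p, w p • b p‖ ^ 2 = ∑ p, ∑ q, inner ℝ (b p) (b q) * (w p * w q) := by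
  rw [← real_inner_self_eq_norm_sq, sum_inner]
  simp only [inner_sum, real_inner_smul_left, real_inner_smul_right]
  exact Finset.sum_congr rfl fun p _ => Finset.sum_congr rfl fun q _ => by ring

theorem integrable_norm_sum_smul_sq (hW : ∀ p q, Integrable (fun ω => W p ω * W q ω) P)
    (b : ι → E) : Integrable (fun ω => ‖∑ p, W p ω • b p‖ ^ 2) P := by
  simp only [norm_sum_smul_sq]
  exact integrable_finsetSum _ fun p _ => integrable_finsetSum _ fun q _ => (hW p q).const_mul _

theorem integral_norm_sum_smul_sq_le (hW : ∀ p q, Integrable (fun ω => W p ω * W q ω) P)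
    (hnonneg : ∀ p q, 0 ≤ ∫ ω, W p ω * W q ω ∂P) {e : ℝ}
    (hrow : ∀ p, ∑ q, ∫ ω, W p ω * W q ω ∂P ≤ e) (b : ι → E) :
    ∫ ω, ‖∑ p, W p ω • b p‖ ^ 2 ∂P ≤ e * ∑ p, ‖b p‖ ^ 2 := by
  have hint : ∀ p q, Integrable (fun ω => inner ℝ (b p) (b q) * (W p ω * W q ω)) P :=
    fun p q => (hW p q).const_mul _
  calc ∫ ω, ‖∑ p, W p ω • b p‖ ^ 2 ∂P
      = ∑ p, ∑ q, inner ℝ (b p) (b q) * ∫ ω, W p ω * W q ω ∂P := by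
        simp only [norm_sum_smul_sq]
        rw [integral_finsetSum _ fun p _ => integrable_finsetSum _ fun q _ => hint p q]
        refine Finset.sum_congr rfl fun p _ => ?_
        rw [integral_finsetSum _ fun q _ => hint p q]
        simp only [integral_const_mul]
    _ ≤ ∑ p, ∑ q, ‖b p‖ * ‖b q‖ * ∫ ω, W p ω * W q ω ∂P :=
        Finset.sum_le_sum fun p _ => Finset.sum_le_sum fun q _ =>
          mul_le_mul_of_nonneg_right (real_inner_le_norm _ _) (hnonneg p q)
    _ ≤ e * ∑ p, ‖b p‖ ^ 2 :=
        sum_mul_mul_le_of_row_sum_le hnonneg (fun p q => by simp only [mul_comm]) hrow _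

end SecondMoment

/-- The centred products `X_s X_t - E[X_s X_t]` of two entries of the tensor vector `X`. -/
noncomputable def tensorFluctuation (p : TensorIndex n d × TensorIndex n d) (x : Fin n → ℝ) : ℝ :=
  tensorVector d x p.1 * tensorVector d x p.2 - if p.1 = p.2 then 1 else 0

theorem integrable_tensorFluctuation_mul (h : IsSymmUnit ν)
    (p q : TensorIndex n d × TensorIndex n d) :
    Integrable (fun x => tensorFluctuation p x * tensorFluctuation q x)
      (Measure.pi fun _ : Fin n => ν) := by
  have hp := integrable_tensorVector_mul h p.1 p.2
  have hq := integrable_tensorVector_mul h q.1 q.2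
  have hpq := integrable_tensorVector_mul_mul h p.1 p.2 q.1 q.2
  simp only [tensorFluctuation, sub_mul, mul_sub]
  exact (hpq.sub (hq.const_mul _)).sub ((hp.mul_const _).sub (integrable_const _))

theorem integral_tensorFluctuation_mul (h : IsSymmUnit ν)
    (p q : TensorIndex n d × TensorIndex n d) :
    ∫ x, tensorFluctuation p x * tensorFluctuation q x ∂(Measure.pi fun _ : Fin n => ν)
      = tensorCov (∫ x, x ^ 4 ∂ν) p q := by
  set X : (Fin n → ℝ) → ℝ := fun x => tensorVector d x p.1 * tensorVector d x p.2
  set Y : (Fin n → ℝ) → ℝ := fun x => tensorVector d x q.1 * tensorVector d x q.2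
  have hX : Integrable X _ := integrable_tensorVector_mul h p.1 p.2
  have hY : Integrable Y _ := integrable_tensorVector_mul h q.1 q.2
  have hXY : Integrable (fun x => X x * Y x) _ :=
    integrable_tensorVector_mul_mul h p.1 p.2 q.1 q.2
  have expand : ∀ x, tensorFluctuation p x * tensorFluctuation q x
      = X x * Y x - (if p.1 = p.2 then 1 else 0) * Y x
        - (if q.1 = q.2 then 1 else 0) * tensorFluctuation p x := fun x => by
    simp only [tensorFluctuation, X, Y]
    ring
  have centred : ∫ x, tensorFluctuation p x ∂(Measure.pi fun _ : Fin n => ν) = 0 := by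
    simp only [tensorFluctuation]
    rw [integral_sub hX (integrable_const _), integral_tensorVector_mul h]
    simp
  have hfluc : Integrable (tensorFluctuation p) (Measure.pi fun _ : Fin n => ν) :=
    hX.sub (integrable_const _)
  have hsub : Integrable (fun x => X x * Y x - (if p.1 = p.2 then 1 else 0) * Y x)
      (Measure.pi fun _ : Fin n => ν) := hXY.sub (hY.const_mul _)
  simp_rw [expand]
  rw [integral_sub hsub (hfluc.const_mul _),
    integral_sub hXY (hY.const_mul _), integral_const_mul, integral_const_mul, centred,
    integral_tensorVector_mul_mul h, integral_tensorVector_mul h, mul_zero, sub_zero, tensorCov]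

theorem integral_norm_sum_tensorFluctuation_smul_sq_le (h : IsSymmUnit ν) {E : Type*}
    [NormedAddCommGroup E] [InnerProductSpace ℝ E] (b : TensorIndex n d × TensorIndex n d → E) :
    ∫ x, ‖∑ p, tensorFluctuation p x • b p‖ ^ 2 ∂(Measure.pi fun _ : Fin n => ν)
      ≤ n.choose d * tensorVarianceRatio n d (∫ x, x ^ 4 ∂ν) * ∑ p, ‖b p‖ ^ 2 := by
  have hκ := h.one_le_integral_pow_four
  refine integral_norm_sum_smul_sq_le (integrable_tensorFluctuation_mul h) (fun p q => ?_)
    (fun p => ?_) b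
  · rw [integral_tensorFluctuation_mul h]
    exact tensorCov_nonneg hκ p q
  · simp only [integral_tensorFluctuation_mul h]
    exact sum_tensorCov_le hκ p

end TensorMoments

section EuclideanNorm

open Matrix WithLp
open scoped Matrix.Norms.L2Operator

variable {ι 𝕜 : Type*} [Fintype ι] [RCLike 𝕜]

theorem norm_toLp_star (u : ι → 𝕜) : ‖toLp 2 (star u)‖ = ‖toLp 2 u‖ := by
  simp [EuclideanSpace.norm_eq]

theorem star_dotProduct_self_eq_norm_sq (u : ι → 𝕜) : star u ⬝ᵥ u = (‖toLp 2 u‖ : 𝕜) ^ 2 := by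
  rw [dotProduct_comm, ← EuclideanSpace.inner_toLp_toLp, inner_self_eq_norm_sq_to_K]

theorem norm_dotProduct_le_norm_mul_norm (u v : ι → 𝕜) :
    ‖u ⬝ᵥ v‖ ≤ ‖toLp 2 u‖ * ‖toLp 2 v‖ := by
  have h := norm_inner_le_norm (𝕜 := 𝕜) (toLp 2 (star u)) (toLp 2 v)
  rwa [EuclideanSpace.inner_toLp_toLp, star_star, dotProduct_comm, norm_toLp_star] at h

variable [DecidableEq ι]

theorem norm_toLp_mulVec_le (B : Matrix ι ι 𝕜) (u : ι → 𝕜) :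
    ‖toLp 2 (B *ᵥ u)‖ ≤ ‖B‖ * ‖toLp 2 u‖ :=
  l2_opNorm_mulVec B (toLp 2 u)

theorem norm_dotProduct_mulVec_le (B : Matrix ι ι 𝕜) (u : ι → 𝕜) :
    ‖u ⬝ᵥ B *ᵥ u‖ ≤ ‖B‖ * ‖toLp 2 u‖ ^ 2 :=
  calc ‖u ⬝ᵥ B *ᵥ u‖ ≤ ‖toLp 2 u‖ * (‖B‖ * ‖toLp 2 u‖) :=
        (norm_dotProduct_le_norm_mul_norm _ _).trans
          (mul_le_mul_of_nonneg_left (norm_toLp_mulVec_le B u) (norm_nonneg _))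
    _ = ‖B‖ * ‖toLp 2 u‖ ^ 2 := by ring

theorem norm_trace_le_card_mul (B : Matrix ι ι 𝕜) : ‖B.trace‖ ≤ Fintype.card ι * ‖B‖ := by
  have hdiag : ∀ i, ‖B i i‖ ≤ ‖B‖ := fun i => by
    simpa using norm_dotProduct_mulVec_le B (Pi.single i 1)
  calc ‖B.trace‖ ≤ ∑ i, ‖B i i‖ := norm_sum_le _ _
    _ ≤ ∑ _i : ι, ‖B‖ := Finset.sum_le_sum fun i _ => hdiag i
    _ = Fintype.card ι * ‖B‖ := by simp

theorem sum_norm_sq_apply_le_card_mul (B : Matrix ι ι 𝕜) :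
    ∑ p : ι × ι, ‖B p.1 p.2‖ ^ 2 ≤ Fintype.card ι * ‖B‖ ^ 2 := by
  have hcol : ∀ j, ∑ i, ‖B i j‖ ^ 2 ≤ ‖B‖ ^ 2 := fun j => by
    have h := pow_le_pow_left₀ (norm_nonneg _) (norm_toLp_mulVec_le B (Pi.single j 1)) 2
    simpa [EuclideanSpace.norm_sq_eq] using h
  calc ∑ p : ι × ι, ‖B p.1 p.2‖ ^ 2 = ∑ j, ∑ i, ‖B i j‖ ^ 2 := Fintype.sum_prod_type_right _
    _ ≤ ∑ _j : ι, ‖B‖ ^ 2 := Finset.sum_le_sum fun j _ => hcol j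
    _ = Fintype.card ι * ‖B‖ ^ 2 := by simp

theorem isUnit_of_mul_norm_le_norm_mulVec {M : Matrix ι ι 𝕜} {y : ℝ} (hy : 0 < y)
    (hM : ∀ u, y * ‖toLp 2 u‖ ≤ ‖toLp 2 (M *ᵥ u)‖) : IsUnit M := by
  rw [← mulVec_injective_iff_isUnit]
  refine (injective_iff_map_eq_zero M.mulVecLin).2 fun u hu => ?_
  have hle : y * ‖toLp 2 u‖ ≤ 0 := by simpa [show M *ᵥ u = 0 from hu] using hM u
  have hzero : ‖toLp 2 u‖ = 0 :=
    le_antisymm (nonpos_of_mul_nonpos_right hle hy) (norm_nonneg _)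
  simpa using hzero

theorem norm_inv_le_of_mul_norm_le_norm_mulVec {M : Matrix ι ι 𝕜} {y : ℝ} (hy : 0 < y)
    (hM : ∀ u, y * ‖toLp 2 u‖ ≤ ‖toLp 2 (M *ᵥ u)‖) : ‖M⁻¹‖ ≤ 1 / y := by
  have hdet := (isUnit_iff_isUnit_det M).1 (isUnit_of_mul_norm_le_norm_mulVec hy hM)
  rw [l2_opNorm_def]
  refine ContinuousLinearMap.opNorm_le_bound _ (by positivity) fun v => ?_
  have h := hM (M⁻¹ *ᵥ v.ofLp)
  rw [mulVec_mulVec, mul_nonsing_inv _ hdet, one_mulVec] at h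
  rw [one_div_mul_eq_div, le_div_iff₀' hy]
  exact h

end EuclideanNorm

section Resolvent

open Matrix WithLp
open scoped Matrix.Norms.L2Operator ComplexOrder

variable {ι : Type*}

/-- The complex matrix with the same entries as a real matrix. -/
noncomputable abbrev complexify {κ : Type*} (A : Matrix ι κ ℝ) : Matrix ι κ ℂ :=
  A.map Complex.ofReal

theorem complexify_mul {κ l : Type*} [Fintype κ] (A : Matrix ι κ ℝ) (B : Matrix κ l ℝ) :
    complexify (A * B) = complexify A * complexify B :=
  Matrix.map_mul (f := Complex.ofRealHom)

theorem isHermitian_complexify {A : Matrix ι ι ℝ} (hA : A.IsHermitian) :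
    (complexify A).IsHermitian :=
  hA.map _ fun x => by simp

theorem transpose_complexify {A : Matrix ι ι ℝ} (hA : A.IsHermitian) :
    (complexify A)ᵀ = complexify A := by
  rw [complexify, ← transpose_map, ← conjTranspose_eq_transpose_of_trivial, hA]

theorem posSemidef_smul_vecMulVec [Finite ι] {c : ℝ} (hc : 0 ≤ c) (v : ι → ℝ) :
    (c • vecMulVec v v).PosSemidef :=
  PosSemidef.smul (by simpa using posSemidef_vecMulVec_self_star v) hc

theorem posSemidef_complexify [Finite ι] {A : Matrix ι ι ℝ} (hA : A.PosSemidef) :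
    (complexify A).PosSemidef := by
  classical
  have := Fintype.ofFinite ι
  have hsqrt : (CFC.sqrt A).IsHermitian :=
    (nonneg_iff_posSemidef.1 (CFC.sqrt_nonneg A)).isHermitian
  have h := posSemidef_conjTranspose_mul_self (complexify (CFC.sqrt A))
  rwa [isHermitian_complexify hsqrt, ← complexify_mul,
    CFC.sqrt_mul_sqrt_self A (nonneg_iff_posSemidef.2 hA)] at h

variable [Fintype ι]

theorem complexify_mulVec {κ : Type*} (A : Matrix κ ι ℝ) (v : ι → ℝ) :
    complexify A *ᵥ (Complex.ofReal ∘ v) = Complex.ofReal ∘ (A *ᵥ v) :=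
  funext fun i => (Complex.ofRealHom.map_mulVec A v i).symm

theorem norm_sq_toLp_eq_add (u : ι → ℂ) :
    ‖toLp 2 u‖ ^ 2 = ‖toLp 2 fun i => (u i).re‖ ^ 2 + ‖toLp 2 fun i => (u i).im‖ ^ 2 := by
  rw [EuclideanSpace.norm_sq_eq, EuclideanSpace.real_norm_sq_eq, EuclideanSpace.real_norm_sq_eq,
    ← Finset.sum_add_distrib]
  exact Finset.sum_congr rfl fun i _ => by rw [Complex.sq_norm, Complex.normSq_apply, sq, sq]

theorem norm_toLp_ofReal_comp (v : ι → ℝ) : ‖toLp 2 (Complex.ofReal ∘ v)‖ = ‖toLp 2 v‖ := by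
  simp [EuclideanSpace.norm_eq]

variable [DecidableEq ι]

theorem norm_complexify_le (A : Matrix ι ι ℝ) : ‖complexify A‖ ≤ ‖A‖ := by
  rw [l2_opNorm_def]
  refine ContinuousLinearMap.opNorm_le_bound _ (norm_nonneg _) fun u => ?_
  change ‖toLp 2 (complexify A *ᵥ u.ofLp)‖ ≤ ‖A‖ * ‖toLp 2 u.ofLp‖
  have hre : (fun i => ((complexify A *ᵥ u.ofLp) i).re) = A *ᵥ fun i => (u i).re := by
    ext i; simp [mulVec, dotProduct]
  have him : (fun i => ((complexify A *ᵥ u.ofLp) i).im) = A *ᵥ fun i => (u i).im := by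
    ext i; simp [mulVec, dotProduct]
  refine le_of_sq_le_sq ?_ (by positivity)
  rw [mul_pow, norm_sq_toLp_eq_add, norm_sq_toLp_eq_add u.ofLp, hre, him, mul_add, ← mul_pow,
    ← mul_pow]
  gcongr <;> exact norm_toLp_mulVec_le A _

/-- The generalized resolvent `(z - s A)⁻¹` of a real matrix; `s = 1` gives the resolvent. -/
noncomputable def genResolvent (z s : ℂ) (A : Matrix ι ι ℝ) : Matrix ι ι ℂ :=
  (z • (1 : Matrix ι ι ℂ) - s • complexify A)⁻¹

variable {z s : ℂ} {A : Matrix ι ι ℝ}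

theorem star_dotProduct_sub_mulVec (u : ι → ℂ) :
    star u ⬝ᵥ (z • (1 : Matrix ι ι ℂ) - s • complexify A) *ᵥ u
      = z * ‖toLp 2 u‖ ^ 2 - s * (star u ⬝ᵥ complexify A *ᵥ u) := by
  rw [sub_mulVec, smul_mulVec, smul_mulVec, one_mulVec, dotProduct_sub, dotProduct_smul,
    dotProduct_smul, star_dotProduct_self_eq_norm_sq, smul_eq_mul, smul_eq_mul]
  rfl

theorem im_mul_norm_sq_le (hs : s.im ≤ 0) (hA : A.PosSemidef) (u : ι → ℂ) :
    z.im * ‖toLp 2 u‖ ^ 2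
      ≤ (star u ⬝ᵥ (z • (1 : Matrix ι ι ℂ) - s • complexify A) *ᵥ u).im := by
  have hq := Complex.le_def.1 ((posSemidef_complexify hA).dotProduct_mulVec_nonneg u)
  rw [star_dotProduct_sub_mulVec, Complex.sub_im, Complex.mul_im s, ← hq.2,
    ← Complex.ofReal_pow, Complex.im_mul_ofReal]
  simp only [Complex.zero_im, mul_zero, zero_add]
  linarith [mul_nonpos_of_nonpos_of_nonneg hs hq.1]

theorem im_mul_norm_le_norm_mulVec (hs : s.im ≤ 0) (hA : A.PosSemidef) (u : ι → ℂ) :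
    z.im * ‖toLp 2 u‖
      ≤ ‖toLp 2 ((z • (1 : Matrix ι ι ℂ) - s • complexify A) *ᵥ u)‖ := by
  rcases (norm_nonneg (toLp 2 u)).eq_or_lt with hu | hu
  · rw [← hu, mul_zero]
    positivity
  refine le_of_mul_le_mul_left ?_ hu
  calc ‖toLp 2 u‖ * (z.im * ‖toLp 2 u‖) = z.im * ‖toLp 2 u‖ ^ 2 := by ring
    _ ≤ ‖star u ⬝ᵥ (z • (1 : Matrix ι ι ℂ) - s • complexify A) *ᵥ u‖ :=
        (im_mul_norm_sq_le hs hA u).trans ((le_abs_self _).trans (Complex.abs_im_le_norm _))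
    _ ≤ ‖toLp 2 u‖ * ‖toLp 2 ((z • (1 : Matrix ι ι ℂ) - s • complexify A) *ᵥ u)‖ := by
        rw [← norm_toLp_star u]
        exact norm_dotProduct_le_norm_mul_norm _ _

theorem isUnit_sub (hz : 0 < z.im) (hs : s.im ≤ 0) (hA : A.PosSemidef) :
    IsUnit (z • (1 : Matrix ι ι ℂ) - s • complexify A) :=
  isUnit_of_mul_norm_le_norm_mulVec hz (im_mul_norm_le_norm_mulVec hs hA)

theorem norm_genResolvent_le (hz : 0 < z.im) (hs : s.im ≤ 0) (hA : A.PosSemidef) :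
    ‖genResolvent z s A‖ ≤ 1 / z.im :=
  norm_inv_le_of_mul_norm_le_norm_mulVec hz (im_mul_norm_le_norm_mulVec hs hA)

theorem mul_genResolvent (hz : 0 < z.im) (hs : s.im ≤ 0) (hA : A.PosSemidef) :
    (z • (1 : Matrix ι ι ℂ) - s • complexify A) * genResolvent z s A = 1 :=
  mul_nonsing_inv _ ((isUnit_iff_isUnit_det _).1 (isUnit_sub hz hs hA))

theorem genResolvent_mul (hz : 0 < z.im) (hs : s.im ≤ 0) (hA : A.PosSemidef) :
    genResolvent z s A * (z • (1 : Matrix ι ι ℂ) - s • complexify A) = 1 :=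
  nonsing_inv_mul _ ((isUnit_iff_isUnit_det _).1 (isUnit_sub hz hs hA))

theorem transpose_genResolvent (hA : A.IsHermitian) :
    (genResolvent z s A)ᵀ = genResolvent z s A := by
  rw [genResolvent, transpose_nonsing_inv, transpose_sub, transpose_smul, transpose_smul,
    transpose_one, transpose_complexify hA]

theorem exists_complexify_eq_mul_diagonal_mul (hA : A.IsHermitian) :
    ∃ V W : Matrix ι ι ℂ, V * W = 1 ∧ W * V = 1 ∧
      complexify A = V * diagonal (fun j => (hA.eigenvalues j : ℂ)) * W := by
  set U : Matrix ι ι ℝ := (hA.eigenvectorUnitary : Matrix ι ι ℝ)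
  have hspec : A = U * diagonal hA.eigenvalues * star U := by
    have h := hA.spectral_theorem
    rwa [Unitary.conjStarAlgAut_apply] at h
  refine ⟨complexify U, complexify (star U), ?_, ?_, ?_⟩
  · rw [← complexify_mul, Unitary.mul_star_self_of_mem hA.eigenvectorUnitary.2]
    simp
  · rw [← complexify_mul, Unitary.star_mul_self_of_mem hA.eigenvectorUnitary.2]
    simp
  · have hdiag : complexify (diagonal hA.eigenvalues)
        = diagonal fun j => (hA.eigenvalues j : ℂ) := diagonal_map Complex.ofReal_zero
    rw [← hdiag, ← complexify_mul, ← complexify_mul, ← hspec]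

theorem trace_genResolvent (hA : A.IsHermitian) (hne : ∀ j, z - s * hA.eigenvalues j ≠ 0) :
    (genResolvent z s A).trace = ∑ j, 1 / (z - s * hA.eigenvalues j) := by
  obtain ⟨V, W, hVW, hWV, hspec⟩ := exists_complexify_eq_mul_diagonal_mul hA
  have hsub : z • (1 : Matrix ι ι ℂ) - s • complexify A
      = V * diagonal (fun j => z - s * (hA.eigenvalues j : ℂ)) * W := by
    have hdiag : diagonal (fun j => z - s * (hA.eigenvalues j : ℂ))
        = z • (1 : Matrix ι ι ℂ) - s • diagonal fun j => (hA.eigenvalues j : ℂ) := by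
      rw [smul_one_eq_diagonal, ← diagonal_smul, diagonal_sub]
      rfl
    rw [hdiag, hspec, Matrix.mul_sub, Matrix.sub_mul]
    simp [hVW]
  have hinv : genResolvent z s A
      = V * diagonal (fun j => 1 / (z - s * (hA.eigenvalues j : ℂ))) * W := by
    refine inv_eq_right_inv ?_
    rw [hsub, show ∀ D E : Matrix ι ι ℂ, V * D * W * (V * E * W) = V * (D * (W * V) * E) * W from
      fun D E => by simp only [Matrix.mul_assoc], hWV, Matrix.mul_one, diagonal_mul_diagonal]
    simp only [mul_one_div_cancel (hne _), diagonal_one, Matrix.mul_one, hVW]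
  rw [hinv, trace_mul_comm, ← Matrix.mul_assoc, hWV, Matrix.one_mul, trace_diagonal]

theorem coe_esd (hA : A.IsHermitian) : (esd hA : Measure ℝ)
    = ((Fintype.card ι : ℝ≥0)⁻¹) • ∑ j, Measure.dirac (hA.eigenvalues j) := by
  rw [esd, FiniteMeasure.toMeasure_smul, FiniteMeasure.toMeasure_sum]
  rfl

theorem integral_esd {E : Type*} [NormedAddCommGroup E] [NormedSpace ℝ E] [CompleteSpace E]
    (hA : A.IsHermitian) (f : ℝ → E) :
    ∫ t, f t ∂(esd hA : Measure ℝ)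
      = (Fintype.card ι : ℝ)⁻¹ • ∑ j, f (hA.eigenvalues j) := by
  rw [coe_esd, integral_smul_nnreal_measure,
    integral_finsetSum_measure fun j _ => integrable_dirac (by simp)]
  simp only [integral_dirac]
  rw [NNReal.smul_def]
  simp

theorem sub_mul_ofReal_ne_zero (hz : 0 < z.im) (hs : s.im ≤ 0) {t : ℝ} (ht : 0 ≤ t) :
    z - s * t ≠ 0 := fun h => by
  have him := congrArg Complex.im h
  rw [Complex.sub_im, Complex.im_mul_ofReal, Complex.zero_im] at him
  linarith [mul_nonpos_of_nonpos_of_nonneg hs ht]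

theorem integral_esd_one_div (hz : 0 < z.im) (hs : s.im ≤ 0) (hA : A.PosSemidef) :
    ∫ t : ℝ, 1 / (z - s * (t : ℂ)) ∂(esd hA.isHermitian : Measure ℝ)
      = (Fintype.card ι : ℂ)⁻¹ * (genResolvent z s A).trace := by
  rw [integral_esd, trace_genResolvent hA.isHermitian fun j =>
    sub_mul_ofReal_ne_zero hz hs (hA.eigenvalues_nonneg j), Complex.real_smul]
  push_cast
  rfl

theorem stieltjesTransform_esd (hz : 0 < z.im) (hA : A.PosSemidef) :
    stieltjesTransform (esd hA.isHermitian) z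
      = (Fintype.card ι : ℂ)⁻¹ * (genResolvent z 1 A).trace := by
  rw [← integral_esd_one_div hz (by simp) hA]
  simp only [stieltjesTransform, one_mul]

/-- The quadratic form `vᵀ B v` of a complex matrix at a real vector. -/
noncomputable def realQuad (B : Matrix ι ι ℂ) (v : ι → ℝ) : ℂ :=
  (Complex.ofReal ∘ v) ⬝ᵥ B *ᵥ (Complex.ofReal ∘ v)

/-- The factor `1 / (1 - c vᵀ (z - A)⁻¹ v)` in the rank one update of the resolvent. -/
noncomputable def rankOneFactor (z : ℂ) (A : Matrix ι ι ℝ) (c : ℝ) (v : ι → ℝ) : ℂ :=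
  (1 - c * realQuad (genResolvent z 1 A) v)⁻¹

theorem norm_realQuad_le (B : Matrix ι ι ℂ) (v : ι → ℝ) :
    ‖realQuad B v‖ ≤ ‖B‖ * ∑ i, v i ^ 2 := by
  refine (norm_dotProduct_mulVec_le B _).trans_eq ?_
  rw [norm_toLp_ofReal_comp, EuclideanSpace.real_norm_sq_eq]

theorem realQuad_genResolvent (hz : 0 < z.im) (hA : A.PosSemidef) (v : ι → ℝ) :
    ∃ q : ℝ, 0 ≤ q ∧ realQuad (genResolvent z 1 A) v
      = (starRingEnd ℂ) z
        * (‖toLp 2 (genResolvent z 1 A *ᵥ (Complex.ofReal ∘ v))‖ ^ 2 : ℝ) - q := by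
  set w : ι → ℂ := Complex.ofReal ∘ v
  set u := genResolvent z 1 A *ᵥ w with hu
  have hq := Complex.le_def.1 ((posSemidef_complexify hA).dotProduct_mulVec_nonneg u)
  have hquad : star u ⬝ᵥ complexify A *ᵥ u
      = ((star u ⬝ᵥ complexify A *ᵥ u).re : ℂ) := Complex.ext rfl hq.2.symm
  have hw : star w = w := by
    ext i
    simp [w]
  have hform := star_dotProduct_sub_mulVec (z := z) (s := 1) (A := A) u
  rw [hu, mulVec_mulVec, mul_genResolvent hz (by simp) hA, one_mulVec, ← hu, hquad, one_mul]
    at hform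
  refine ⟨_, hq.1, ?_⟩
  have hstar : realQuad (genResolvent z 1 A) v = star (star u ⬝ᵥ w) := by
    rw [← star_dotProduct, hw]
    rfl
  rw [hstar, hform]
  simp

variable {c : ℝ}

theorem im_le_im_mul_one_sub_realQuad (hz : 0 < z.im) (hA : A.PosSemidef) (hc : 0 ≤ c)
    (v : ι → ℝ) : z.im ≤ (z * (1 - c * realQuad (genResolvent z 1 A) v)).im := by
  obtain ⟨q, hq, h⟩ := realQuad_genResolvent hz hA v
  have hexpand : (z * (1 - c * realQuad (genResolvent z 1 A) v)).im = z.im + z.im * (c * q) := by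
    rw [h]
    generalize ‖toLp 2 (genResolvent z 1 A *ᵥ (Complex.ofReal ∘ v))‖ ^ 2 = r
    simp
    ring
  rw [hexpand]
  exact le_add_of_nonneg_right (by positivity)

theorem im_one_sub_realQuad (hz : 0 < z.im) (hA : A.PosSemidef) (c : ℝ) (v : ι → ℝ) :
    (1 - c * realQuad (genResolvent z 1 A) v).im
      = c * z.im * ‖toLp 2 (genResolvent z 1 A *ᵥ (Complex.ofReal ∘ v))‖ ^ 2 := by
  obtain ⟨q, -, h⟩ := realQuad_genResolvent hz hA v
  rw [h]
  generalize ‖toLp 2 (genResolvent z 1 A *ᵥ (Complex.ofReal ∘ v))‖ ^ 2 = r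
  simp
  ring

theorem one_sub_realQuad_ne_zero (hz : 0 < z.im) (hA : A.PosSemidef) (hc : 0 ≤ c)
    (v : ι → ℝ) : 1 - c * realQuad (genResolvent z 1 A) v ≠ 0 := fun h => by
  have him := im_le_im_mul_one_sub_realQuad hz hA hc v
  rw [h, mul_zero, Complex.zero_im] at him
  exact hz.not_ge him

theorem norm_rankOneFactor_le (hz : 0 < z.im) (hA : A.PosSemidef) (hc : 0 ≤ c)
    (v : ι → ℝ) : ‖rankOneFactor z A c v‖ ≤ ‖z‖ / z.im := by
  have him : z.im ≤ ‖z‖ * ‖1 - c * realQuad (genResolvent z 1 A) v‖ := by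
    rw [← norm_mul]
    exact (im_le_im_mul_one_sub_realQuad hz hA hc v).trans
      ((le_abs_self _).trans (Complex.abs_im_le_norm _))
  have hpos := norm_pos_iff.2 (one_sub_realQuad_ne_zero hz hA hc v)
  rwa [rankOneFactor, norm_inv, inv_eq_one_div, div_le_div_iff₀ hpos hz, one_mul]

theorem mul_norm_rankOneFactor_mul_le (hz : 0 < z.im) (hA : A.PosSemidef) (hc : 0 ≤ c)
    (v : ι → ℝ) :
    c * ‖rankOneFactor z A c v‖ * ‖toLp 2 (genResolvent z 1 A *ᵥ (Complex.ofReal ∘ v))‖ ^ 2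
      ≤ 1 / z.im := by
  have him := (le_abs_self _).trans (Complex.abs_im_le_norm
    (1 - c * realQuad (genResolvent z 1 A) v))
  rw [im_one_sub_realQuad hz hA] at him
  have hpos := norm_pos_iff.2 (one_sub_realQuad_ne_zero hz hA hc v)
  rw [rankOneFactor, norm_inv, ← div_eq_mul_inv, div_mul_eq_mul_div, div_le_div_iff₀ hpos hz]
  linarith

theorem im_inv_nonpos {w : ℂ} (hw : 0 ≤ w.im) : w⁻¹.im ≤ 0 := by
  rw [Complex.inv_im]
  exact div_nonpos_of_nonpos_of_nonneg (neg_nonpos.2 hw) (Complex.normSq_nonneg _)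

theorem im_rankOneFactor_nonpos (hz : 0 < z.im) (hA : A.PosSemidef) (hc : 0 ≤ c)
    (v : ι → ℝ) : (rankOneFactor z A c v).im ≤ 0 := by
  refine im_inv_nonpos ?_
  rw [im_one_sub_realQuad hz hA]
  positivity

theorem im_rankOneFactor_div_nonpos (hz : 0 < z.im) (hA : A.PosSemidef) (hc : 0 ≤ c)
    (v : ι → ℝ) : (rankOneFactor z A c v / z).im ≤ 0 := by
  rw [rankOneFactor, div_eq_mul_inv, ← mul_inv, mul_comm]
  exact im_inv_nonpos (hz.le.trans (im_le_im_mul_one_sub_realQuad hz hA hc v))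

theorem genResolvent_add_sub_genResolvent (hz : 0 < z.im) (hA : A.PosSemidef) (hc : 0 ≤ c)
    (v : ι → ℝ) :
    genResolvent z 1 (A + c • vecMulVec v v) - genResolvent z 1 A
      = (c : ℂ) • (genResolvent z 1 (A + c • vecMulVec v v)
        * vecMulVec (Complex.ofReal ∘ v) (Complex.ofReal ∘ v) * genResolvent z 1 A) := by
  have hunit : IsUnit (z • (1 : Matrix ι ι ℂ) - (1 : ℂ) • complexify (A + c • vecMulVec v v))
      ↔ IsUnit (z • (1 : Matrix ι ι ℂ) - (1 : ℂ) • complexify A) :=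
    iff_of_true (isUnit_sub hz (by simp) (hA.add (posSemidef_smul_vecMulVec hc v)))
      (isUnit_sub hz (by simp) hA)
  unfold genResolvent
  rw [Matrix.inv_sub_inv hunit, ← Matrix.smul_mul, ← Matrix.mul_smul]
  congr 2
  ext i j
  simp [vecMulVec_apply]

theorem genResolvent_add_mulVec (hz : 0 < z.im) (hA : A.PosSemidef) (hc : 0 ≤ c)
    (v : ι → ℝ) :
    genResolvent z 1 (A + c • vecMulVec v v) *ᵥ (Complex.ofReal ∘ v)
      = rankOneFactor z A c v • (genResolvent z 1 A *ᵥ (Complex.ofReal ∘ v)) := by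
  set w : ι → ℂ := Complex.ofReal ∘ v
  set R := genResolvent z 1 (A + c • vecMulVec v v)
  set R₀ := genResolvent z 1 A
  have hsub : R *ᵥ w - R₀ *ᵥ w = ((c : ℂ) * realQuad R₀ v) • R *ᵥ w := by
    rw [← sub_mulVec, genResolvent_add_sub_genResolvent hz hA hc, smul_mulVec, ← mulVec_mulVec,
      ← mulVec_mulVec, vecMulVec_mulVec, op_smul_eq_smul, mulVec_smul, smul_smul]
    rfl
  have hmul : R₀ *ᵥ w = (1 - c * realQuad R₀ v) • R *ᵥ w := by
    rw [sub_smul, one_smul, ← hsub, sub_sub_cancel]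
  rw [hmul, rankOneFactor, smul_smul, inv_mul_cancel₀ (one_sub_realQuad_ne_zero hz hA hc v),
    one_smul]

theorem trace_mul_genResolvent_add_sub (hz : 0 < z.im) (hA : A.PosSemidef) (hc : 0 ≤ c)
    (v : ι → ℝ) (B : Matrix ι ι ℂ) :
    (B * (genResolvent z 1 (A + c • vecMulVec v v) - genResolvent z 1 A)).trace
      = c * rankOneFactor z A c v * ((genResolvent z 1 A *ᵥ (Complex.ofReal ∘ v))
        ⬝ᵥ B *ᵥ (genResolvent z 1 A *ᵥ (Complex.ofReal ∘ v))) := by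
  have hsymm : (Complex.ofReal ∘ v) ᵥ* genResolvent z 1 A
      = genResolvent z 1 A *ᵥ (Complex.ofReal ∘ v) := by
    rw [← vecMul_transpose, transpose_genResolvent hA.isHermitian]
  rw [genResolvent_add_sub_genResolvent hz hA hc, Matrix.mul_smul, mul_vecMulVec, vecMulVec_mul,
    genResolvent_add_mulVec hz hA hc, mul_vecMulVec, trace_smul, trace_vecMulVec, mulVec_smul,
    smul_dotProduct, hsymm, dotProduct_comm, smul_eq_mul, smul_eq_mul, mul_assoc]

theorem norm_trace_mul_genResolvent_add_sub_le (hz : 0 < z.im) (hA : A.PosSemidef)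
    (hc : 0 ≤ c) (v : ι → ℝ) (B : Matrix ι ι ℂ) :
    ‖(B * (genResolvent z 1 (A + c • vecMulVec v v) - genResolvent z 1 A)).trace‖
      ≤ ‖B‖ / z.im := by
  rw [trace_mul_genResolvent_add_sub hz hA hc, norm_mul, norm_mul, Complex.norm_real,
    Real.norm_of_nonneg hc]
  set u := genResolvent z 1 A *ᵥ (Complex.ofReal ∘ v)
  calc c * ‖rankOneFactor z A c v‖ * ‖u ⬝ᵥ B *ᵥ u‖
      ≤ c * ‖rankOneFactor z A c v‖ * (‖B‖ * ‖toLp 2 u‖ ^ 2) :=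
        mul_le_mul_of_nonneg_left (norm_dotProduct_mulVec_le B u) (by positivity)
    _ = ‖B‖ * (c * ‖rankOneFactor z A c v‖ * ‖toLp 2 u‖ ^ 2) := by ring
    _ ≤ ‖B‖ * (1 / z.im) :=
        mul_le_mul_of_nonneg_left (mul_norm_rankOneFactor_mul_le hz hA hc v) (norm_nonneg _)
    _ = ‖B‖ / z.im := by ring

end Resolvent

section SampleCovariance

open Matrix
open scoped Matrix.Norms.L2Operator

variable {ι : Type*} {p : ℕ}

/-- The contribution of the columns in `J` to the sample covariance matrix. -/
noncomputable def partialCov (J : Finset (Fin p)) (x : Fin p → ι → ℝ) : Matrix ι ι ℝ :=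
  ∑ j ∈ J, (p : ℝ)⁻¹ • vecMulVec (x j) (x j)

theorem sampleCov_eq_partialCov (Z : Matrix ι (Fin p) ℝ) :
    sampleCov Z = partialCov Finset.univ fun j i => Z i j := by
  ext a b
  simp only [sampleCov, partialCov, Matrix.smul_apply, mul_apply, transpose_apply,
    Matrix.sum_apply, vecMulVec_apply, smul_eq_mul, Finset.mul_sum, one_div]

theorem partialCov_univ_eq_add (x : Fin p → ι → ℝ) (j : Fin p) :
    partialCov Finset.univ x
      = partialCov (Finset.univ.erase j) x + (p : ℝ)⁻¹ • vecMulVec (x j) (x j) :=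
  (Finset.sum_erase_add _ _ (Finset.mem_univ j)).symm

theorem partialCov_erase_update (x : Fin p → ι → ℝ) (j : Fin p) (v : ι → ℝ) :
    partialCov (Finset.univ.erase j) (Function.update x j v)
      = partialCov (Finset.univ.erase j) x :=
  Finset.sum_congr rfl fun k hk => by rw [Function.update_of_ne (Finset.ne_of_mem_erase hk)]

theorem continuous_partialCov (J : Finset (Fin p)) :
    Continuous fun x : Fin p → ι → ℝ => partialCov J x :=
  continuous_finsetSum _ fun j _ =>
    ((continuous_apply j).matrix_vecMulVec (continuous_apply j)).fun_const_smul _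

theorem posSemidef_partialCov [Finite ι] (J : Finset (Fin p)) (x : Fin p → ι → ℝ) :
    (partialCov J x).PosSemidef :=
  posSemidef_sum _ fun _ _ => posSemidef_smul_vecMulVec (by positivity) _

variable [Fintype ι]

theorem continuous_realQuad {X : Type*} [TopologicalSpace X] {B : X → Matrix ι ι ℂ}
    {v : X → ι → ℝ} (hB : Continuous B) (hv : Continuous v) :
    Continuous fun x => realQuad (B x) (v x) := by
  have h : Continuous fun x => Complex.ofReal ∘ v x :=
    continuous_pi fun i => Complex.continuous_ofReal.comp ((continuous_apply i).comp hv)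
  exact h.dotProduct (hB.matrix_mulVec h)

theorem trace_complexify_partialCov_mul (J : Finset (Fin p)) (x : Fin p → ι → ℝ)
    (B : Matrix ι ι ℂ) :
    (complexify (partialCov J x) * B).trace = (p : ℂ)⁻¹ * ∑ j ∈ J, realQuad B (x j) := by
  have hsum : complexify (partialCov J x)
      = ∑ j ∈ J, (p : ℂ)⁻¹ • vecMulVec (Complex.ofReal ∘ x j) (Complex.ofReal ∘ x j) := by
    ext a b
    simp [partialCov, Matrix.sum_apply, vecMulVec_apply]
  rw [hsum, Finset.sum_mul, trace_sum, Finset.mul_sum]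
  refine Finset.sum_congr rfl fun j _ => ?_
  rw [Matrix.smul_mul, trace_smul, vecMulVec_mul, trace_vecMulVec, smul_eq_mul, realQuad,
    dotProduct_comm, dotProduct_mulVec]

variable [DecidableEq ι]

theorem continuous_genResolvent_partialCov {z : ℂ} (hz : 0 < z.im) (J : Finset (Fin p)) :
    Continuous fun x : Fin p → ι → ℝ => genResolvent z 1 (partialCov J x) := by
  have hM : Continuous fun x : Fin p → ι → ℝ =>
      z • (1 : Matrix ι ι ℂ) - (1 : ℂ) • complexify (partialCov J x) :=
    continuous_const.sub (((continuous_partialCov J).matrix_map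
      Complex.continuous_ofReal).fun_const_smul _)
  simp_rw [genResolvent, Matrix.inv_def, Ring.inverse_eq_inv']
  refine (hM.matrix_det.inv₀ fun x => ?_).smul hM.matrix_adjugate
  exact ((isUnit_iff_isUnit_det _).1
    (isUnit_sub hz (by simp) (posSemidef_partialCov J x))).ne_zero

/-- The rank one factor of the `j`-th column relative to the other columns. -/
noncomputable def leaveOneOutFactor (z : ℂ) (x : Fin p → ι → ℝ) (j : Fin p) : ℂ :=
  rankOneFactor z (partialCov (Finset.univ.erase j) x) (p : ℝ)⁻¹ (x j)

/-- The normalized trace of the resolvent of the sample covariance matrix, that is, the Stieltjes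
transform of its empirical spectral distribution. -/
noncomputable def covStieltjes (z : ℂ) (x : Fin p → ι → ℝ) : ℂ :=
  (Fintype.card ι : ℂ)⁻¹ * (genResolvent z 1 (partialCov Finset.univ x)).trace

/-- If `m` is the Stieltjes transform at `z` of the spectral distribution of the `N × N` matrix
`p⁻¹ Z Zᵀ`, then `companion (N / p) z m` is `z` times that of the `p × p` matrix `p⁻¹ Zᵀ Z`. -/
noncomputable def companion (γ : ℝ) (z m : ℂ) : ℂ := 1 - γ + γ * z * m

variable {z s : ℂ}

theorem norm_leaveOneOutFactor_le (hz : 0 < z.im) (x : Fin p → ι → ℝ) (j : Fin p) :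
    ‖leaveOneOutFactor z x j‖ ≤ ‖z‖ / z.im :=
  norm_rankOneFactor_le hz (posSemidef_partialCov _ x) (by positivity) _

theorem norm_covStieltjes_le [Nonempty ι] (hz : 0 < z.im) (x : Fin p → ι → ℝ) :
    ‖covStieltjes z x‖ ≤ 1 / z.im := by
  have hN : (0 : ℝ) < Fintype.card ι := by exact_mod_cast Fintype.card_pos
  rw [covStieltjes, norm_mul, norm_inv, Complex.norm_natCast, inv_mul_le_iff₀ hN]
  exact (norm_trace_le_card_mul _).trans (mul_le_mul_of_nonneg_left
    (norm_genResolvent_le hz (by simp) (posSemidef_partialCov _ x)) hN.le)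

theorem continuous_covStieltjes (hz : 0 < z.im) :
    Continuous fun x : Fin p → ι → ℝ => covStieltjes z x :=
  continuous_const.mul (continuous_genResolvent_partialCov hz _).matrix_trace

theorem norm_trace_genResolvent_partialCov_sub_erase_le (hz : 0 < z.im) (x : Fin p → ι → ℝ)
    (j : Fin p) (B : Matrix ι ι ℂ) :
    ‖(B * genResolvent z 1 (partialCov Finset.univ x)).trace
      - (B * genResolvent z 1 (partialCov (Finset.univ.erase j) x)).trace‖ ≤ ‖B‖ / z.im := by
  rw [← trace_sub, ← Matrix.mul_sub, partialCov_univ_eq_add x j]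
  exact norm_trace_mul_genResolvent_add_sub_le hz (posSemidef_partialCov _ x) (by positivity) _ B

theorem norm_covStieltjes_update_sub_le [Nonempty ι] (hz : 0 < z.im) (x : Fin p → ι → ℝ)
    (j : Fin p) (v : ι → ℝ) :
    ‖covStieltjes z (Function.update x j v) - covStieltjes z x‖
      ≤ 2 / (Fintype.card ι * z.im) := by
  have hN : (0 : ℝ) < Fintype.card ι := by exact_mod_cast Fintype.card_pos
  have herase := fun y : Fin p → ι → ℝ =>
    norm_trace_genResolvent_partialCov_sub_erase_le hz y j (1 : Matrix ι ι ℂ)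
  simp only [Matrix.one_mul, norm_one] at herase
  have hupdate := herase (Function.update x j v)
  rw [partialCov_erase_update] at hupdate
  have htri := norm_sub_le_norm_sub_add_norm_sub
    (genResolvent z 1 (partialCov Finset.univ (Function.update x j v))).trace
    (genResolvent z 1 (partialCov (Finset.univ.erase j) x)).trace
    (genResolvent z 1 (partialCov Finset.univ x)).trace
  rw [norm_sub_rev (genResolvent z 1 (partialCov (Finset.univ.erase j) x)).trace] at htri
  rw [covStieltjes, covStieltjes, ← mul_sub, norm_mul, norm_inv, Complex.norm_natCast,
    inv_mul_le_iff₀ hN]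
  calc _ ≤ 1 / z.im + 1 / z.im := htri.trans (add_le_add hupdate (herase x))
    _ = Fintype.card ι * (2 / (Fintype.card ι * z.im)) := by field_simp; norm_num

theorem realQuad_genResolvent_partialCov_mul (hz : 0 < z.im) (x : Fin p → ι → ℝ) (j : Fin p)
    (B : Matrix ι ι ℂ) :
    realQuad (genResolvent z 1 (partialCov Finset.univ x) * B) (x j)
      = leaveOneOutFactor z x j
        * realQuad (genResolvent z 1 (partialCov (Finset.univ.erase j) x) * B) (x j) := by
  have hsymm : ∀ J : Finset (Fin p), realQuad (genResolvent z 1 (partialCov J x) * B) (x j)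
      = (genResolvent z 1 (partialCov J x) *ᵥ (Complex.ofReal ∘ x j))
        ⬝ᵥ (B *ᵥ (Complex.ofReal ∘ x j)) := fun J => by
    rw [realQuad, ← mulVec_mulVec, dotProduct_mulVec, ← mulVec_transpose,
      transpose_genResolvent (posSemidef_partialCov J x).isHermitian]
  rw [hsymm, hsymm, partialCov_univ_eq_add x j, genResolvent_add_mulVec hz
    (posSemidef_partialCov _ x) (by positivity), smul_dotProduct]
  rfl

theorem inv_mul_realQuad_genResolvent_partialCov (hz : 0 < z.im) (x : Fin p → ι → ℝ)
    (j : Fin p) :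
    (p : ℂ)⁻¹ * realQuad (genResolvent z 1 (partialCov Finset.univ x)) (x j)
      = leaveOneOutFactor z x j - 1 := by
  have hcancel := inv_mul_cancel₀ (one_sub_realQuad_ne_zero hz
    (posSemidef_partialCov (Finset.univ.erase j) x) (c := (p : ℝ)⁻¹) (by positivity) (x j))
  have hfull := realQuad_genResolvent_partialCov_mul hz x j 1
  rw [Matrix.mul_one, Matrix.mul_one] at hfull
  rw [← rankOneFactor, ← leaveOneOutFactor, Complex.ofReal_inv, Complex.ofReal_natCast]
    at hcancel
  rw [hfull]
  linear_combination -hcancel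

theorem companion_covStieltjes [Nonempty ι] (hp : 0 < p) (hz : 0 < z.im)
    (x : Fin p → ι → ℝ) :
    companion (Fintype.card ι / p) z (covStieltjes z x)
      = (p : ℂ)⁻¹ * ∑ j, leaveOneOutFactor z x j := by
  have htrace := congrArg trace
    (mul_genResolvent (s := 1) hz (by simp) (posSemidef_partialCov Finset.univ x))
  rw [Matrix.sub_mul, trace_sub, Matrix.smul_mul, Matrix.smul_mul, one_smul, Matrix.one_mul,
    trace_smul, trace_one, trace_complexify_partialCov_mul, smul_eq_mul, Finset.mul_sum]
    at htrace
  simp only [inv_mul_realQuad_genResolvent_partialCov hz, Finset.sum_sub_distrib,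
    Finset.sum_const, Finset.card_univ, Fintype.card_fin, nsmul_eq_mul, mul_one] at htrace
  have hp' : (p : ℂ) ≠ 0 := by exact_mod_cast hp.ne'
  have hN : (Fintype.card ι : ℂ) ≠ 0 := by exact_mod_cast Fintype.card_ne_zero
  rw [companion, covStieltjes]
  push_cast
  field_simp
  linear_combination htrace

theorem im_companion_covStieltjes_nonpos [Nonempty ι] (hp : 0 < p) (hz : 0 < z.im)
    (x : Fin p → ι → ℝ) : (companion (Fintype.card ι / p) z (covStieltjes z x)).im ≤ 0 := by
  rw [companion_covStieltjes hp hz, ← Complex.ofReal_natCast, ← Complex.ofReal_inv,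
    Complex.im_ofReal_mul, Complex.im_sum]
  exact mul_nonpos_of_nonneg_of_nonpos (by positivity) (Finset.sum_nonpos fun j _ =>
    im_rankOneFactor_nonpos hz (posSemidef_partialCov _ x) (by positivity) _)

theorem im_companion_covStieltjes_div_nonpos [Nonempty ι] (hp : 0 < p) (hz : 0 < z.im)
    (x : Fin p → ι → ℝ) : (companion (Fintype.card ι / p) z (covStieltjes z x) / z).im ≤ 0 := by
  rw [companion_covStieltjes hp hz, mul_div_assoc, Finset.sum_div, ← Complex.ofReal_natCast,
    ← Complex.ofReal_inv, Complex.im_ofReal_mul, Complex.im_sum]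
  exact mul_nonpos_of_nonneg_of_nonpos (by positivity) (Finset.sum_nonpos fun j _ =>
    im_rankOneFactor_div_nonpos hz (posSemidef_partialCov _ x) (by positivity) _)

variable {T : Matrix ι ι ℝ}

theorem trace_genResolvent_sub_trace_genResolvent (hz : 0 < z.im) (hs : s.im ≤ 0)
    (hT : T.PosSemidef) (x : Fin p → ι → ℝ) :
    (genResolvent z 1 (partialCov Finset.univ x)).trace - (genResolvent z s T).trace
      = (p : ℂ)⁻¹ * ∑ j, leaveOneOutFactor z x j * realQuad
          (genResolvent z 1 (partialCov (Finset.univ.erase j) x) * genResolvent z s T) (x j)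
        - s * (genResolvent z s T * complexify T
          * genResolvent z 1 (partialCov Finset.univ x)).trace := by
  set S := partialCov Finset.univ x
  set R := genResolvent z 1 S
  set D := genResolvent z s T
  have hR : (z • (1 : Matrix ι ι ℂ) - (1 : ℂ) • complexify S) * R = 1 :=
    mul_genResolvent hz (by simp) (posSemidef_partialCov _ x)
  have hD : D * (z • (1 : Matrix ι ι ℂ) - s • complexify T) = 1 := genResolvent_mul hz hs hT
  have hsub : R - D = D * (complexify S * R) - s • (D * complexify T * R) := by
    calc R - D = D * (z • (1 : Matrix ι ι ℂ) - s • complexify T) * R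
          - D * ((z • (1 : Matrix ι ι ℂ) - (1 : ℂ) • complexify S) * R) := by
            rw [hR, hD, Matrix.one_mul, Matrix.mul_one]
      _ = D * (complexify S * R) - s • (D * complexify T * R) := by
        simp only [Matrix.mul_sub, Matrix.sub_mul, Matrix.mul_smul, Matrix.smul_mul,
          Matrix.mul_one, Matrix.one_mul, one_smul, Matrix.mul_assoc]
        abel
  rw [← trace_sub, hsub, trace_sub, trace_smul, trace_mul_comm, Matrix.mul_assoc,
    trace_complexify_partialCov_mul, smul_eq_mul]
  simp only [R, S, realQuad_genResolvent_partialCov_mul hz]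

end SampleCovariance

section SelfConsistentEquation

open scoped BoundedContinuousFunction

/-- The integrand of the companion equation `z = g⁻¹ + γ ∫ t / (1 - t g) dH(t)`, which is the
self-consistent equation in the unknown `g = companion γ z m / z`. -/
noncomputable def companionKernel (g : ℂ) (t : ℝ) : ℂ := t / (1 - t * g)

theorem ne_zero_of_im_ne_zero {w : ℂ} (hw : w.im ≠ 0) : w ≠ 0 := by
  rintro rfl
  exact hw Complex.zero_im

section Kernel

variable {g g' : ℂ}

theorem one_sub_ofReal_mul_ne_zero (hg : g.im < 0) (t : ℝ) : 1 - t * g ≠ 0 := fun h => by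
  have him := congrArg Complex.im h
  have hre := congrArg Complex.re h
  simp only [Complex.sub_im, Complex.one_im, Complex.im_ofReal_mul, Complex.zero_im, zero_sub,
    neg_eq_zero, mul_eq_zero, hg.ne, or_false] at him
  simp [him] at hre

theorem continuous_companionKernel (hg : g.im < 0) : Continuous (companionKernel g) :=
  Complex.continuous_ofReal.div (by fun_prop) (one_sub_ofReal_mul_ne_zero hg)

theorem norm_companionKernel_le (hg : g.im < 0) (t : ℝ) :
    ‖companionKernel g t‖ ≤ 1 / -g.im := by
  rw [companionKernel, norm_div, Complex.norm_real, div_le_div_iff₀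
    (norm_pos_iff.2 (one_sub_ofReal_mul_ne_zero hg t)) (neg_pos.2 hg), one_mul]
  have him : |(1 - t * g).im| = |t| * -g.im := by
    rw [Complex.sub_im, Complex.one_im, Complex.im_ofReal_mul, zero_sub, abs_neg, abs_mul,
      abs_of_neg hg]
  exact him.symm.trans_le (Complex.abs_im_le_norm _)

theorem im_companionKernel (hg : g.im < 0) (t : ℝ) :
    (companionKernel g t).im = g.im * ‖companionKernel g t‖ ^ 2 := by
  have hne := (Complex.normSq_pos.2 (one_sub_ofReal_mul_ne_zero hg t)).ne'
  rw [← Complex.normSq_eq_norm_sq, companionKernel, Complex.normSq_div, Complex.normSq_ofReal,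
    Complex.div_im]
  simp only [Complex.ofReal_im, Complex.ofReal_re, Complex.sub_im, Complex.one_im,
    Complex.im_ofReal_mul]
  field_simp
  ring

theorem companionKernel_sub_companionKernel (hg : g.im < 0) (hg' : g'.im < 0) (t : ℝ) :
    companionKernel g t - companionKernel g' t
      = (g - g') * (companionKernel g t * companionKernel g' t) := by
  have hne := one_sub_ofReal_mul_ne_zero hg t
  have hne' := one_sub_ofReal_mul_ne_zero hg' t
  simp only [companionKernel]
  field_simp
  ring

variable {H : Measure ℝ} [IsFiniteMeasure H] {γ : ℝ} {z : ℂ}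

theorem integrable_companionKernel (hg : g.im < 0) : Integrable (companionKernel g) H :=
  (integrable_const (1 / -g.im)).mono' (continuous_companionKernel hg).aestronglyMeasurable
    (ae_of_all _ (norm_companionKernel_le hg))

theorem integrable_norm_companionKernel_sq (hg : g.im < 0) :
    Integrable (fun t => ‖companionKernel g t‖ ^ 2) H := by
  refine (integrable_const ((1 / -g.im) ^ 2)).mono'
    ((continuous_companionKernel hg).norm.pow 2).aestronglyMeasurable (ae_of_all _ fun t => ?_)
  rw [norm_pow, norm_norm]
  exact pow_le_pow_left₀ (norm_nonneg _) (norm_companionKernel_le hg t) 2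

theorem im_integral_companionKernel (hg : g.im < 0) :
    (∫ t, companionKernel g t ∂H).im = g.im * ∫ t, ‖companionKernel g t‖ ^ 2 ∂H := by
  have him := integral_im (𝕜 := ℂ) (integrable_companionKernel (H := H) hg)
  simp only [RCLike.im_eq_complex_im] at him
  rw [← him, ← integral_const_mul]
  exact integral_congr_ae (ae_of_all _ (im_companionKernel hg))

theorem mul_integral_norm_companionKernel_sq_lt_one (hz : 0 < z.im) (hg : g.im < 0)
    (h : z = g⁻¹ + γ * ∫ t, companionKernel g t ∂H) :
    γ * (‖g‖ ^ 2 * ∫ t, ‖companionKernel g t‖ ^ 2 ∂H) < 1 := by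
  have hgn : 0 < ‖g‖ ^ 2 := pow_pos (norm_pos_iff.2 (ne_zero_of_im_ne_zero hg.ne)) 2
  have him := congrArg Complex.im h
  rw [Complex.add_im, Complex.inv_im, Complex.im_ofReal_mul, im_integral_companionKernel hg,
    Complex.normSq_eq_norm_sq] at him
  set I := ∫ t, ‖companionKernel g t‖ ^ 2 ∂H
  have hprod : z.im * ‖g‖ ^ 2 = -g.im * (1 - γ * (‖g‖ ^ 2 * I)) := by
    rw [him, add_mul, div_mul_cancel₀ _ hgn.ne']
    ring
  have hpos : 0 < -g.im * (1 - γ * (‖g‖ ^ 2 * I)) := hprod ▸ mul_pos hz hgn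
  linarith [pos_of_mul_pos_right hpos (neg_pos.2 hg).le]

theorem mul_integral_companionKernel_mul_eq_one (hg : g.im < 0) (hg' : g'.im < 0)
    (h : z = g⁻¹ + γ * ∫ t, companionKernel g t ∂H)
    (h' : z = g'⁻¹ + γ * ∫ t, companionKernel g' t ∂H) (hne : g ≠ g') :
    γ * (g * g' * ∫ t, companionKernel g t * companionKernel g' t ∂H) = 1 := by
  have hdiff : ∫ t, companionKernel g t ∂H - ∫ t, companionKernel g' t ∂H
      = (g - g') * ∫ t, companionKernel g t * companionKernel g' t ∂H := by
    rw [← integral_sub (integrable_companionKernel hg) (integrable_companionKernel hg'),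
      ← integral_const_mul]
    exact integral_congr_ae (ae_of_all _ (companionKernel_sub_companionKernel hg hg'))
  have hinv : (g⁻¹ - g'⁻¹) * (g * g') = g' - g := by
    have hg0 := ne_zero_of_im_ne_zero hg.ne
    have hg0' := ne_zero_of_im_ne_zero hg'.ne
    field_simp
  refine mul_left_cancel₀ (sub_ne_zero.2 hne) ?_
  linear_combination g * g' * (h' - h) - hinv - γ * g * g' * hdiff

theorem norm_mul_integral_companionKernel_mul_le (hg : g.im < 0) (hg' : g'.im < 0) :
    ‖g * g' * ∫ t, companionKernel g t * companionKernel g' t ∂H‖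
      ≤ (‖g‖ ^ 2 * ∫ t, ‖companionKernel g t‖ ^ 2 ∂H
        + ‖g'‖ ^ 2 * ∫ t, ‖companionKernel g' t‖ ^ 2 ∂H) / 2 := by
  have hint := (integrable_norm_companionKernel_sq (H := H) hg).const_mul (‖g‖ ^ 2)
  have hint' := (integrable_norm_companionKernel_sq (H := H) hg').const_mul (‖g'‖ ^ 2)
  rw [← integral_const_mul, ← integral_const_mul, ← integral_const_mul,
    ← integral_add hint hint', ← integral_div]
  refine norm_integral_le_of_norm_le ((hint.add hint').div_const 2) (ae_of_all _ fun t => ?_)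
  simp only [norm_mul]
  linarith [two_mul_le_add_sq (‖g‖ * ‖companionKernel g t‖) (‖g'‖ * ‖companionKernel g' t‖)]

theorem eq_of_eq_inv_add_integral_companionKernel (hγ : 0 ≤ γ) (hz : 0 < z.im) (hg : g.im < 0)
    (hg' : g'.im < 0) (h : z = g⁻¹ + γ * ∫ t, companionKernel g t ∂H)
    (h' : z = g'⁻¹ + γ * ∫ t, companionKernel g' t ∂H) : g = g' := by
  by_contra hne
  have hone := congrArg norm (mul_integral_companionKernel_mul_eq_one hg hg' h h' hne)
  rw [norm_mul, Complex.norm_real, Real.norm_of_nonneg hγ, norm_one] at hone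
  have hamgm := mul_le_mul_of_nonneg_left
    (norm_mul_integral_companionKernel_mul_le (H := H) hg hg') hγ
  linarith [mul_integral_norm_companionKernel_sq_lt_one hz hg h,
    mul_integral_norm_companionKernel_sq_lt_one hz hg' h']

end Kernel

section Integrand

variable {z s s' : ℂ}

theorem norm_one_div_sub_mul_le (hz : 0 < z.im) (hs : s.im ≤ 0) {t : ℝ} (ht : 0 ≤ t) :
    ‖1 / (z - s * t)‖ ≤ 1 / z.im := by
  rw [norm_div, norm_one]
  have him : z.im ≤ (z - s * t).im := by
    rw [Complex.sub_im, Complex.im_mul_ofReal]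
    linarith [mul_nonpos_of_nonpos_of_nonneg hs ht]
  exact one_div_le_one_div_of_le hz (him.trans ((le_abs_self _).trans (Complex.abs_im_le_norm _)))

theorem integrable_one_div_sub_mul {H : Measure ℝ} [IsFiniteMeasure H] (hz : 0 < z.im)
    (hs : s.im ≤ 0) (hH : ∀ᵐ t ∂H, 0 ≤ t) : Integrable (fun t : ℝ => 1 / (z - s * t)) H :=
  (integrable_const (1 / z.im)).mono' (Measurable.const_div (by fun_prop) _).aestronglyMeasurable
    (hH.mono fun _ => norm_one_div_sub_mul_le hz hs)

theorem norm_one_div_sub_mul_sub_le (hz : 0 < z.im) (hs : s.im ≤ 0) (hs' : s'.im ≤ 0) {t : ℝ}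
    (ht : 0 ≤ t) :
    ‖1 / (z - s * t) - 1 / (z - s' * t)‖ ≤ ‖s - s'‖ * (t / z.im ^ 2) := by
  have hne := sub_mul_ofReal_ne_zero hz hs ht
  have hne' := sub_mul_ofReal_ne_zero hz hs' ht
  have hdiff : 1 / (z - s * t) - 1 / (z - s' * t)
      = (s - s') * (t * (1 / (z - s * t) * (1 / (z - s' * t)))) := by
    rw [div_sub_div _ _ hne hne', one_div_mul_one_div]
    ring
  rw [hdiff, norm_mul, norm_mul, norm_mul, Complex.norm_real, Real.norm_of_nonneg ht]
  have hprod : ‖1 / (z - s * t)‖ * ‖1 / (z - s' * t)‖ ≤ 1 / z.im * (1 / z.im) :=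
    mul_le_mul (norm_one_div_sub_mul_le hz hs ht) (norm_one_div_sub_mul_le hz hs' ht)
      (norm_nonneg _) (one_div_nonneg.2 hz.le)
  rw [one_div_mul_one_div, ← sq] at hprod
  rw [div_eq_mul_one_div t]
  gcongr

end Integrand

/-- The conditions on `s = companion γ z m` that characterize it when `m` is the Stieltjes
transform, at a point `z` of the upper half plane, of a limiting spectral distribution. -/
structure IsCompanionSolution (H : Measure ℝ) (γ : ℝ) (z s : ℂ) : Prop where
  im_nonpos : s.im ≤ 0
  im_div_nonpos : (s / z).im ≤ 0
  eq_companion : s = companion γ z (∫ t : ℝ, 1 / (z - s * t) ∂H)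

namespace IsCompanionSolution

variable {H : Measure ℝ} [IsProbabilityMeasure H] {γ : ℝ} {z s s' : ℂ}

theorem ne_zero (h : IsCompanionSolution H γ z s) (hz : z ≠ 0) : s ≠ 0 := by
  rintro rfl
  have heq := h.eq_companion
  simp [companion, hz] at heq

theorem im_div_neg (h : IsCompanionSolution H γ z s) (hz : 0 < z.im) : (s / z).im < 0 := by
  refine h.im_div_nonpos.lt_of_ne fun him => ?_
  have hz0 := ne_zero_of_im_ne_zero hz.ne'
  obtain ⟨r, hr⟩ : ∃ r : ℝ, s = r * z :=
    ⟨(s / z).re, (div_eq_iff hz0).1 (Complex.ext (by simp) (by simp [him]))⟩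
  have hreal : z * ∫ t : ℝ, 1 / (z - s * t) ∂H = ((∫ t : ℝ, 1 / (1 - r * t) ∂H : ℝ) : ℂ) := by
    rw [← integral_const_mul, ← integral_complex_ofReal]
    refine integral_congr_ae (ae_of_all _ fun t => ?_)
    have hfactor : z - r * z * t = z * (1 - r * t) := by ring
    push_cast
    rw [hr, hfactor, mul_one_div, div_mul_cancel_left₀ hz0, one_div]
  have hsim : s.im = 0 := by
    rw [h.eq_companion, companion, mul_assoc, hreal]
    simp
  have hr0 : r = 0 := by
    rw [hr, Complex.im_ofReal_mul] at hsim
    exact (mul_eq_zero.1 hsim).resolve_right hz.ne'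
  exact h.ne_zero hz0 (by rw [hr, hr0, Complex.ofReal_zero, zero_mul])

theorem eq_inv_add_integral_companionKernel (h : IsCompanionSolution H γ z s) (hz : 0 < z.im) :
    z = (s / z)⁻¹ + γ * ∫ t, companionKernel (s / z) t ∂H := by
  have hz0 := ne_zero_of_im_ne_zero hz.ne'
  have hg := h.im_div_neg hz
  have hexpand : z * ∫ t : ℝ, 1 / (z - s * t) ∂H
      = 1 + s / z * ∫ t, companionKernel (s / z) t ∂H := by
    have hint : Integrable (fun t => s / z * companionKernel (s / z) t) H :=
      (integrable_companionKernel hg).const_mul _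
    have hadd : 1 + ∫ t, s / z * companionKernel (s / z) t ∂H
        = ∫ t, (1 + s / z * companionKernel (s / z) t) ∂H := by
      rw [integral_add (integrable_const _) hint]
      simp
    rw [← integral_const_mul, ← integral_const_mul, hadd]
    refine integral_congr_ae (ae_of_all _ fun t => ?_)
    have hne := one_sub_ofReal_mul_ne_zero hg t
    have hfactor : z - s * t = z * (1 - t * (s / z)) := by
      field_simp
    simp only [companionKernel]
    rw [hfactor, mul_one_div, div_mul_cancel_left₀ hz0]
    generalize s / z = g at hne
    field_simp
    ring
  have heq := h.eq_companion
  rw [companion, mul_assoc, hexpand] at heq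
  have hs0 := h.ne_zero hz0
  rw [inv_div]
  field_simp at heq ⊢
  linear_combination heq

theorem unique (h : IsCompanionSolution H γ z s) (h' : IsCompanionSolution H γ z s')
    (hγ : 0 ≤ γ) (hz : 0 < z.im) : s = s' :=
  (div_left_inj' (ne_zero_of_im_ne_zero hz.ne')).1
    (eq_of_eq_inv_add_integral_companionKernel hγ hz (h.im_div_neg hz) (h'.im_div_neg hz)
      (h.eq_inv_add_integral_companionKernel hz) (h'.eq_inv_add_integral_companionKernel hz))

end IsCompanionSolution

section Limit

variable {ι : Type*} {l : Filter ι} {Hs : ι → FiniteMeasure ℝ} {H : FiniteMeasure ℝ} {K : ℝ}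

theorem ae_mem_of_tendsto {X : Type*} [MeasurableSpace X] [TopologicalSpace X]
    [OpensMeasurableSpace X] [HasOuterApproxClosed X] [l.NeBot] {μs : ι → FiniteMeasure X}
    {μ : FiniteMeasure X} (h : Tendsto μs l (𝓝 μ)) {F : Set X} (hF : IsClosed F)
    (hs : ∀ i, ∀ᵐ x ∂(μs i : Measure X), x ∈ F) : ∀ᵐ x ∂(μ : Measure X), x ∈ F := by
  have hmass : Tendsto (fun i => (μs i : Measure X) Set.univ) l (𝓝 ((μ : Measure X) Set.univ)) := by
    simpa only [FiniteMeasure.ennreal_mass] using ENNReal.tendsto_coe.2 h.mass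
  have hlimsup := FiniteMeasure.limsup_measure_closed_le_of_tendsto h hF
  have hfull (i : ι) : (μs i : Measure X) F = (μs i : Measure X) Set.univ :=
    (ae_iff_measure_eq hF.measurableSet.nullMeasurableSet).1 (hs i)
  simp only [hfull, hmass.limsup_eq] at hlimsup
  exact (ae_iff_measure_eq hF.measurableSet.nullMeasurableSet).2
    ((measure_mono (Set.subset_univ F)).antisymm hlimsup)

theorem tendsto_integral_one_div_sub_const_mul [l.NeBot] (h : Tendsto Hs l (𝓝 H))
    (hHs : ∀ i, ∀ᵐ t ∂(Hs i : Measure ℝ), 0 ≤ t) {z s : ℂ} (hz : 0 < z.im) (hs : s.im ≤ 0) :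
    Tendsto (fun i => ∫ t : ℝ, 1 / (z - s * t) ∂(Hs i : Measure ℝ)) l
      (𝓝 (∫ t : ℝ, 1 / (z - s * t) ∂(H : Measure ℝ))) := by
  let f : ℝ →ᵇ ℂ := BoundedContinuousFunction.ofNormedAddCommGroup
    (fun t => 1 / (z - s * (max t 0 : ℝ)))
    (continuous_const.div (by fun_prop) fun t => sub_mul_ofReal_ne_zero hz hs (le_max_right _ _))
    (1 / z.im) (fun t => norm_one_div_sub_mul_le hz hs (le_max_right _ _))
  have integral_f {μ : FiniteMeasure ℝ} (hμ : ∀ᵐ t ∂(μ : Measure ℝ), 0 ≤ t) :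
      ∫ t, f t ∂(μ : Measure ℝ) = ∫ t : ℝ, 1 / (z - s * t) ∂(μ : Measure ℝ) := by
    refine integral_congr_ae (hμ.mono fun t ht => ?_)
    change 1 / (z - s * (max t 0 : ℝ)) = _
    rw [max_eq_left ht]
  have hlim := (FiniteMeasure.tendsto_iff_forall_integral_rclike_tendsto ℂ).1 h f
  rw [integral_f (ae_mem_of_tendsto h isClosed_Ici hHs)] at hlim
  exact hlim.congr fun i => integral_f (hHs i)

theorem tendsto_integral_one_div_sub_mul [l.NeBot] (h : Tendsto Hs l (𝓝 H))
    (hHs : ∀ i, ∀ᵐ t ∂(Hs i : Measure ℝ), t ∈ Set.Icc 0 K) {z s : ℂ} (hz : 0 < z.im)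
    {ss : ι → ℂ} (hss : Tendsto ss l (𝓝 s)) (him : ∀ᶠ i in l, (ss i).im ≤ 0) :
    Tendsto (fun i => ∫ t : ℝ, 1 / (z - ss i * t) ∂(Hs i : Measure ℝ)) l
      (𝓝 (∫ t : ℝ, 1 / (z - s * t) ∂(H : Measure ℝ))) := by
  have hs : s.im ≤ 0 := le_of_tendsto ((Complex.continuous_im.tendsto _).comp hss) him
  have hpos (i : ι) : ∀ᵐ t ∂(Hs i : Measure ℝ), 0 ≤ t := (hHs i).mono fun t ht => ht.1
  suffices hdiff : Tendsto (fun i => ∫ t : ℝ, 1 / (z - ss i * t) ∂(Hs i : Measure ℝ)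
      - ∫ t : ℝ, 1 / (z - s * t) ∂(Hs i : Measure ℝ)) l (𝓝 0) by
    simpa using hdiff.add (tendsto_integral_one_div_sub_const_mul h hpos hz hs)
  have hbound : Tendsto (fun i => ‖ss i - s‖ * (K / z.im ^ 2) * (Hs i : Measure ℝ).real Set.univ)
      l (𝓝 0) := by
    have hmass : Tendsto (fun i => (Hs i : Measure ℝ).real Set.univ) l
        (𝓝 ((H : Measure ℝ).real Set.univ)) := NNReal.tendsto_coe.2 h.mass
    simpa using ((tendsto_iff_norm_sub_tendsto_zero.1 hss).mul_const (K / z.im ^ 2)).mul hmass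
  refine squeeze_zero_norm' ?_ hbound
  filter_upwards [him] with i hi
  rw [← integral_sub (integrable_one_div_sub_mul hz hi (hpos i))
    (integrable_one_div_sub_mul hz hs (hpos i))]
  refine norm_integral_le_of_norm_le_const ((hHs i).mono fun t ht => ?_)
  refine (norm_one_div_sub_mul_sub_le hz hi hs ht.1).trans ?_
  gcongr
  exact ht.2

end Limit

section ApproximateSolution

variable {ι : Type*} {l : Filter ι} {Hs : ι → FiniteMeasure ℝ}
  {H : ProbabilityMeasure ℝ} {K γ : ℝ} {z : ℂ} {γs : ι → ℝ} {M : ι → ℂ}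

theorem tendsto_companion (hγs : Tendsto γs l (𝓝 γ)) {m : ℂ} (hM : Tendsto M l (𝓝 m)) :
    Tendsto (fun i => companion (γs i) z (M i)) l (𝓝 (companion γ z m)) := by
  have hγC : Tendsto (fun i => (γs i : ℂ)) l (𝓝 γ) :=
    (Complex.continuous_ofReal.tendsto _).comp hγs
  exact (tendsto_const_nhds.sub hγC).add ((hγC.mul_const z).mul hM)

theorem companion_injective (hγ : γ ≠ 0) (hz : z ≠ 0) : Function.Injective (companion γ z) :=
  fun _ _ h => mul_left_cancel₀ (mul_ne_zero (Complex.ofReal_ne_zero.2 hγ) hz)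
    (add_left_cancel h)

theorem eq_integral_and_isCompanionSolution_of_tendsto [l.NeBot]
    (hlim : Tendsto Hs l (𝓝 H.toFiniteMeasure))
    (hHs : ∀ i, ∀ᵐ t ∂(Hs i : Measure ℝ), t ∈ Set.Icc 0 K) (hz : 0 < z.im)
    (hγs : Tendsto γs l (𝓝 γ)) (him : ∀ᶠ i in l, (companion (γs i) z (M i)).im ≤ 0)
    (him_div : ∀ᶠ i in l, (companion (γs i) z (M i) / z).im ≤ 0)
    (heq : Tendsto (fun i => M i - ∫ t : ℝ, 1 / (z - companion (γs i) z (M i) * t)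
      ∂(Hs i : Measure ℝ)) l (𝓝 0)) {m : ℂ} (hM : Tendsto M l (𝓝 m)) :
    m = ∫ t : ℝ, 1 / (z - companion γ z m * t) ∂(H : Measure ℝ) ∧
      IsCompanionSolution H γ z (companion γ z m) := by
  have hs := tendsto_companion (z := z) hγs hM
  have hm : m = ∫ t : ℝ, 1 / (z - companion γ z m * t) ∂(H : Measure ℝ) := by
    have hadd := heq.add (tendsto_integral_one_div_sub_mul hlim hHs hz hs him)
    simp only [sub_add_cancel, zero_add] at hadd
    exact tendsto_nhds_unique hM hadd
  exact ⟨hm, le_of_tendsto ((Complex.continuous_im.tendsto _).comp hs) him,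
    le_of_tendsto ((Complex.continuous_im.tendsto _).comp (hs.div_const z)) him_div, by rw [← hm]⟩

/-- Bounded approximate solutions have cluster points, and all of these coincide because the
self-consistent equation has only one solution. -/
theorem exists_tendsto_of_approx_isCompanionSolution {Hs : ℕ → FiniteMeasure ℝ} {γs : ℕ → ℝ}
    {M : ℕ → ℂ} (hlim : Tendsto Hs atTop (𝓝 H.toFiniteMeasure))
    (hHs : ∀ n, ∀ᵐ t ∂(Hs n : Measure ℝ), t ∈ Set.Icc 0 K) (hz : 0 < z.im) (hγ : 0 < γ)
    (hγs : Tendsto γs atTop (𝓝 γ)) {B : ℝ} (hM : ∀ᶠ n in atTop, ‖M n‖ ≤ B)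
    (him : ∀ᶠ n in atTop, (companion (γs n) z (M n)).im ≤ 0)
    (him_div : ∀ᶠ n in atTop, (companion (γs n) z (M n) / z).im ≤ 0)
    (heq : Tendsto (fun n => M n - ∫ t : ℝ, 1 / (z - companion (γs n) z (M n) * t)
      ∂(Hs n : Measure ℝ)) atTop (𝓝 0)) :
    ∃ m, Tendsto M atTop (𝓝 m) ∧ m = ∫ t : ℝ, 1 / (z - companion γ z m * t) ∂(H : Measure ℝ) ∧
      IsCompanionSolution H γ z (companion γ z m) := by
  have cluster {φ : ℕ → ℕ} (hφ : StrictMono φ) {m : ℂ} (hm : Tendsto (M ∘ φ) atTop (𝓝 m)) :=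
    have hφ := hφ.tendsto_atTop
    eq_integral_and_isCompanionSolution_of_tendsto (hlim.comp hφ) (fun n => hHs (φ n)) hz
      (hγs.comp hφ) (hφ.eventually him) (hφ.eventually him_div) (heq.comp hφ) hm
  have hball : ∀ᶠ n in atTop, M n ∈ Metric.closedBall 0 B := by simpa using hM
  have hcompact := isCompact_closedBall (0 : ℂ) B
  obtain ⟨m, -, φ, hφ, hm⟩ := hcompact.tendsto_subseq' hball.frequently
  refine ⟨m, hcompact.tendsto_nhds_of_unique_mapClusterPt hball fun m' _ hm' => ?_, cluster hφ hm⟩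
  obtain ⟨ψ, hψ, hψm'⟩ := hm'.tendsto_subseq
  exact companion_injective hγ.ne' (ne_zero_of_im_ne_zero hz.ne')
    ((cluster hψ hψm').2.unique (cluster hφ hm).2 hγ.le hz)

theorem tendsto_mul_I_mul_integral {H : Measure ℝ} [IsProbabilityMeasure H]
    (hH : ∀ᵐ t ∂H, 0 ≤ t) {s : ℝ → ℂ} (him : ∀ y, 0 < y → (s y).im ≤ 0) {B : ℝ}
    (hs : ∀ y, 0 < y → ‖s y‖ ≤ B) :
    Tendsto (fun y : ℝ => y * Complex.I * ∫ t : ℝ, 1 / (y * Complex.I - s y * t) ∂H) atTop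
      (𝓝 1) := by
  have him_pos {y : ℝ} (hy : 0 < y) : 0 < (y * Complex.I).im := by simpa using hy
  have norm_mul_I {y : ℝ} (hy : 0 < y) : ‖(y * Complex.I : ℂ)‖ = y := by simp [abs_of_pos hy]
  have hratio : Tendsto (fun y : ℝ => s y / (y * Complex.I)) atTop (𝓝 0) := by
    refine squeeze_zero_norm' (a := fun y => B / y) ?_ (tendsto_const_nhds.div_atTop tendsto_id)
    filter_upwards [eventually_gt_atTop 0] with y hy
    rw [norm_div, norm_mul_I hy]
    exact div_le_div_of_nonneg_right (hs y hy) hy.le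
  suffices hlim : Tendsto (fun y : ℝ => ∫ t : ℝ, y * Complex.I * (1 / (y * Complex.I - s y * t)) ∂H)
      atTop (𝓝 (∫ _, 1 ∂H)) by
    simpa [integral_const_mul] using hlim
  refine tendsto_integral_filter_of_dominated_convergence (fun _ => 1)
    (Eventually.of_forall fun y => (Measurable.const_mul
      (Measurable.const_div (by fun_prop) _) _).aestronglyMeasurable) ?_
    (integrable_const _) (ae_of_all _ fun t => ?_)
  · filter_upwards [eventually_gt_atTop 0] with y hy
    filter_upwards [hH] with t ht
    have hle := norm_one_div_sub_mul_le (him_pos hy) (him y hy) ht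
    rw [Complex.mul_I_im, Complex.ofReal_re] at hle
    rw [norm_mul, norm_mul_I hy]
    exact (mul_le_mul_of_nonneg_left hle hy.le).trans_eq (mul_one_div_cancel hy.ne')
  · have hinv : Tendsto (fun y : ℝ => (1 - s y / (y * Complex.I) * t)⁻¹) atTop (𝓝 1) := by
      have hsub : Tendsto (fun y : ℝ => 1 - s y / (y * Complex.I) * t) atTop (𝓝 1) := by
        simpa using tendsto_const_nhds.sub (hratio.mul_const (t : ℂ))
      simpa using hsub.inv₀ one_ne_zero
    refine hinv.congr' ?_
    filter_upwards [eventually_gt_atTop 0] with y hy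
    have hy0 := ne_zero_of_im_ne_zero (him_pos hy).ne'
    rw [div_mul_eq_mul_div, one_sub_div hy0, inv_div, mul_one_div]

theorem norm_companion_le {m : ℂ} (h : ‖z * m‖ ≤ 1) : ‖companion γ z m‖ ≤ ‖(1 - γ : ℂ)‖ + |γ| := by
  refine (norm_add_le _ _).trans (add_le_add_right ?_ _)
  rw [mul_assoc, norm_mul, Complex.norm_real, Real.norm_eq_abs]
  exact mul_le_of_le_one_right (abs_nonneg γ) h

theorem tendsto_mul_I_mul_of_eq_integral {H : Measure ℝ} [IsProbabilityMeasure H]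
    (hH : ∀ᵐ t ∂H, 0 ≤ t) {m : ℂ → ℂ}
    (hm : ∀ z : ℂ, 0 < z.im → m z = ∫ t : ℝ, 1 / (z - companion γ z (m z) * t) ∂H)
    (him : ∀ z : ℂ, 0 < z.im → (companion γ z (m z)).im ≤ 0) :
    Tendsto (fun y : ℝ => y * Complex.I * m (y * Complex.I)) atTop (𝓝 1) := by
  have him_pos (y : ℝ) (hy : 0 < y) : 0 < (y * Complex.I).im := by simpa using hy
  have hs (y : ℝ) (hy : 0 < y) : ‖companion γ (y * Complex.I) (m (y * Complex.I))‖
      ≤ ‖(1 - γ : ℂ)‖ + |γ| := by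
    have hle : ‖m (y * Complex.I)‖ ≤ 1 / y := by
      rw [hm _ (him_pos y hy)]
      simpa using norm_integral_le_of_norm_le_const
        (hH.mono fun _ => norm_one_div_sub_mul_le (him_pos y hy) (him _ (him_pos y hy)))
    refine norm_companion_le ?_
    rw [norm_mul, norm_mul, Complex.norm_I, mul_one, Complex.norm_real, Real.norm_of_nonneg hy.le]
    exact (mul_le_mul_of_nonneg_left hle hy.le).trans_eq (mul_one_div_cancel hy.ne')
  refine (tendsto_mul_I_mul_integral hH (fun y hy => him _ (him_pos y hy)) hs).congr' ?_
  filter_upwards [eventually_gt_atTop 0] with y hy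
  rw [← hm _ (him_pos y hy)]

end ApproximateSolution

end SelfConsistentEquation

section Expectation

open Matrix
open scoped Matrix.Norms.L2Operator

variable {ι : Type*} [Fintype ι]

/-- The deviation of the quadratic form `vᵀ B v` from its mean, when `v` has covariance `T`. -/
noncomputable def quadFluctuation (T : Matrix ι ι ℝ) (B : Matrix ι ι ℂ) (v : ι → ℝ) : ℂ :=
  realQuad B v - (B * complexify T).trace

theorem continuous_quadFluctuation {X : Type*} [TopologicalSpace X] (T : Matrix ι ι ℝ)
    {B : X → Matrix ι ι ℂ} {v : X → ι → ℝ} (hB : Continuous B) (hv : Continuous v) :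
    Continuous fun x => quadFluctuation T (B x) (v x) :=
  (continuous_realQuad hB hv).sub (hB.matrix_mul continuous_const).matrix_trace

variable [DecidableEq ι]

/-- Quadratic forms of a random vector with law `L` concentrate around their traces against `T`,
in mean and with relative error `ε`. -/
structure ConcentratedColumn (L : Measure (ι → ℝ)) (T : Matrix ι ι ℝ) (ε : ℝ) : Prop where
  integrable_sq : ∀ i, Integrable (fun v : ι → ℝ => v i ^ 2) L
  integral_norm_quadFluctuation_le : ∀ B : Matrix ι ι ℂ,
    ∫ v, ‖quadFluctuation T B v‖ ∂L ≤ ε * Fintype.card ι * ‖B‖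

theorem ConcentratedColumn.mul_card_nonneg {L : Measure (ι → ℝ)} {T : Matrix ι ι ℝ}
    {ε : ℝ} (hL : ConcentratedColumn L T ε) : 0 ≤ ε * Fintype.card ι := by
  cases isEmpty_or_nonempty ι
  · simp
  have h := (integral_nonneg fun v => norm_nonneg _).trans
    (hL.integral_norm_quadFluctuation_le 1)
  rwa [norm_one, mul_one] at h

theorem norm_quadFluctuation_le (T : Matrix ι ι ℝ) (B : Matrix ι ι ℂ) (v : ι → ℝ) :
    ‖quadFluctuation T B v‖ ≤ ‖B‖ * (∑ i, v i ^ 2 + Fintype.card ι * ‖T‖) := by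
  have htrace : ‖(B * complexify T).trace‖ ≤ Fintype.card ι * (‖B‖ * ‖T‖) := by
    refine (norm_trace_le_card_mul _).trans ?_
    gcongr
    exact (norm_mul_le _ _).trans (by gcongr; exact norm_complexify_le T)
  calc ‖quadFluctuation T B v‖ ≤ ‖B‖ * ∑ i, v i ^ 2 + Fintype.card ι * (‖B‖ * ‖T‖) :=
        (norm_sub_le _ _).trans (add_le_add (norm_realQuad_le B v) htrace)
    _ = ‖B‖ * (∑ i, v i ^ 2 + Fintype.card ι * ‖T‖) := by ring

variable {p : ℕ} {z s : ℂ} {T : Matrix ι ι ℝ} {B : Matrix ι ι ℂ}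

theorem norm_genResolvent_mul_le (hz : 0 < z.im) (hs : s.im ≤ 0) (hT : T.PosSemidef)
    (B : Matrix ι ι ℂ) : ‖genResolvent z s T * B‖ ≤ ‖B‖ / z.im := by
  refine (norm_mul_le _ _).trans ?_
  rw [div_eq_mul_one_div, mul_comm]
  exact mul_le_mul_of_nonneg_left (norm_genResolvent_le hz hs hT) (norm_nonneg _)

/-- The fluctuation of the quadratic form of the `j`-th column with the matrix `R B`, where `R` is
the resolvent built from the other columns, so that `R` is independent of the `j`-th column. -/
noncomputable def leaveOneOutFluctuation (z : ℂ) (T : Matrix ι ι ℝ) (B : Matrix ι ι ℂ)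
    (x : Fin p → ι → ℝ) (j : Fin p) : ℂ :=
  quadFluctuation T (genResolvent z 1 (partialCov (Finset.univ.erase j) x) * B) (x j)

theorem norm_genResolvent_partialCov_mul_le (hz : 0 < z.im) (J : Finset (Fin p))
    (x : Fin p → ι → ℝ) (B : Matrix ι ι ℂ) :
    ‖genResolvent z 1 (partialCov J x) * B‖ ≤ ‖B‖ / z.im :=
  norm_genResolvent_mul_le hz (by simp) (posSemidef_partialCov J x) B

theorem continuous_leaveOneOutFluctuation (hz : 0 < z.im) (T : Matrix ι ι ℝ) (B : Matrix ι ι ℂ)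
    (j : Fin p) : Continuous fun x : Fin p → ι → ℝ => leaveOneOutFluctuation z T B x j :=
  continuous_quadFluctuation T
    ((continuous_genResolvent_partialCov hz _).matrix_mul continuous_const) (continuous_apply j)

theorem norm_realQuad_genResolvent_mul_sub_le (hz : 0 < z.im) (x : Fin p → ι → ℝ) (j : Fin p)
    (T : Matrix ι ι ℝ) (B : Matrix ι ι ℂ) :
    ‖realQuad (genResolvent z 1 (partialCov (Finset.univ.erase j) x) * B) (x j)
        - (B * complexify T * genResolvent z 1 (partialCov Finset.univ x)).trace‖
      ≤ ‖leaveOneOutFluctuation z T B x j‖ + ‖B * complexify T‖ / z.im := by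
  have herase := norm_trace_genResolvent_partialCov_sub_erase_le hz x j (B * complexify T)
  rw [norm_sub_rev] at herase
  refine (norm_sub_le_norm_sub_add_norm_sub _ _ _).trans (add_le_add_right herase _) |>.trans_eq ?_
  rw [leaveOneOutFluctuation, quadFluctuation, Matrix.mul_assoc _ B, trace_mul_comm _ (B * _)]

theorem trace_genResolvent_sub_eq_sum_add [Nonempty ι] (hp : 0 < p) (hz : 0 < z.im)
    (hT : T.PosSemidef) {M : ℂ} (hM : (companion (Fintype.card ι / p) z M).im ≤ 0)
    (x : Fin p → ι → ℝ) {D : Matrix ι ι ℂ}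
    (hD : D = genResolvent z (companion (Fintype.card ι / p) z M) T) {τ : ℂ}
    (hτ : τ = (D * complexify T * genResolvent z 1 (partialCov Finset.univ x)).trace) :
    (genResolvent z 1 (partialCov Finset.univ x)).trace - D.trace
      = (p : ℂ)⁻¹ * ∑ j, leaveOneOutFactor z x j * (realQuad
          (genResolvent z 1 (partialCov (Finset.univ.erase j) x) * D) (x j) - τ)
        + Fintype.card ι / p * z * (covStieltjes z x - M) * τ := by
  have hdiff := trace_genResolvent_sub_trace_genResolvent hz hM hT x
  have hcompanion := companion_covStieltjes hp hz x
  rw [← hD, ← hτ] at hdiff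
  simp only [companion, Complex.ofReal_div, Complex.ofReal_natCast] at hdiff hcompanion
  rw [hdiff]
  simp only [mul_sub, Finset.sum_sub_distrib, ← Finset.sum_mul]
  linear_combination -τ * hcompanion

theorem norm_trace_genResolvent_sub_le [Nonempty ι] (hp : 0 < p) (hz : 0 < z.im)
    (hT : T.PosSemidef) {M : ℂ} (hM : (companion (Fintype.card ι / p) z M).im ≤ 0)
    (x : Fin p → ι → ℝ) {D : Matrix ι ι ℂ}
    (hD : D = genResolvent z (companion (Fintype.card ι / p) z M) T) :
    ‖(genResolvent z 1 (partialCov Finset.univ x)).trace - D.trace‖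
      ≤ ‖z‖ / z.im * ((p : ℝ)⁻¹ * ∑ j, (‖leaveOneOutFluctuation z T D x j‖ + ‖T‖ / z.im ^ 2))
        + Fintype.card ι * (‖T‖ / z.im ^ 2) * (Fintype.card ι / p * ‖z‖)
          * ‖covStieltjes z x - M‖ := by
  set τ := (D * complexify T * genResolvent z 1 (partialCov Finset.univ x)).trace with hτ
  have hDT : ‖D * complexify T‖ / z.im ≤ ‖T‖ / z.im ^ 2 := by
    rw [sq, ← div_div, hD]
    gcongr
    exact (norm_genResolvent_mul_le hz hM hT _).trans (by gcongr; exact norm_complexify_le T)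
  have hτ_norm : ‖τ‖ ≤ Fintype.card ι * (‖T‖ / z.im ^ 2) := by
    rw [hτ, trace_mul_comm]
    refine (norm_trace_le_card_mul _).trans ?_
    gcongr
    exact (norm_genResolvent_partialCov_mul_le hz _ x _).trans hDT
  have hsummand (j : Fin p) : ‖leaveOneOutFactor z x j * (realQuad
      (genResolvent z 1 (partialCov (Finset.univ.erase j) x) * D) (x j) - τ)‖
      ≤ ‖z‖ / z.im * (‖leaveOneOutFluctuation z T D x j‖ + ‖T‖ / z.im ^ 2) := by
    rw [norm_mul]
    refine mul_le_mul (norm_leaveOneOutFactor_le hz x j) ?_ (norm_nonneg _) (by positivity)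
    exact (norm_realQuad_genResolvent_mul_sub_le hz x j T D).trans (by gcongr)
  rw [trace_genResolvent_sub_eq_sum_add hp hz hT hM x hD hτ]
  refine (norm_add_le _ _).trans (add_le_add ?_ ?_)
  · rw [norm_mul, norm_inv, Complex.norm_natCast, mul_left_comm, Finset.mul_sum]
    gcongr
    exact norm_sum_le_of_le _ fun j _ => hsummand j
  · rw [norm_mul, norm_mul, norm_mul, norm_div, Complex.norm_natCast, Complex.norm_natCast]
    calc _ ≤ Fintype.card ι / p * ‖z‖ * ‖covStieltjes z x - M‖
          * (Fintype.card ι * (‖T‖ / z.im ^ 2)) := by gcongr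
      _ = _ := by ring

/-- The expectation of `covStieltjes` over `p` independent columns with law `L`. -/
noncomputable def meanCovStieltjes (p : ℕ) (L : Measure (ι → ℝ)) (z : ℂ) : ℂ :=
  ∫ x : Fin p → ι → ℝ, covStieltjes z x ∂(Measure.pi fun _ => L)

variable (L : Measure (ι → ℝ)) [IsProbabilityMeasure L]

theorem integrable_leaveOneOutFluctuation (hL : ∀ i, Integrable (fun v : ι → ℝ => v i ^ 2) L)
    (hz : 0 < z.im) (T : Matrix ι ι ℝ) (B : Matrix ι ι ℂ) (j : Fin p) :
    Integrable (fun x : Fin p → ι → ℝ => leaveOneOutFluctuation z T B x j)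
      (Measure.pi fun _ => L) := by
  have hsq : Integrable (fun x : Fin p → ι → ℝ => ∑ i, x j i ^ 2) (Measure.pi fun _ => L) :=
    integrable_finsetSum _ fun i _ =>
      integrable_comp_eval (μ := fun _ => L) (i := j) (f := fun v : ι → ℝ => v i ^ 2) (hL i)
  refine ((hsq.add (integrable_const (Fintype.card ι * ‖T‖))).const_mul (‖B‖ / z.im)).mono'
    (continuous_leaveOneOutFluctuation hz T B j).aestronglyMeasurable (ae_of_all _ fun x => ?_)
  refine (norm_quadFluctuation_le _ _ _).trans (mul_le_mul_of_nonneg_right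
    (norm_genResolvent_partialCov_mul_le hz _ x B) ?_)
  exact add_nonneg (Finset.sum_nonneg fun i _ => sq_nonneg _) (by positivity)

theorem integral_norm_leaveOneOutFluctuation_le {ε : ℝ}
    (hL : ConcentratedColumn L T ε) (hz : 0 < z.im) (B : Matrix ι ι ℂ) (j : Fin p) :
    ∫ x : Fin p → ι → ℝ, ‖leaveOneOutFluctuation z T B x j‖ ∂(Measure.pi fun _ => L)
      ≤ ε * Fintype.card ι * (‖B‖ / z.im) := by
  rw [integral_pi_eq_integral_update (fun _ => L) j
    (integrable_leaveOneOutFluctuation L hL.integrable_sq hz T B j).norm]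
  have hinner (x : Fin p → ι → ℝ) :
      ∫ v, ‖leaveOneOutFluctuation z T B (Function.update x j v) j‖ ∂L
        ≤ ε * Fintype.card ι * (‖B‖ / z.im) := by
    simp only [leaveOneOutFluctuation, partialCov_erase_update, Function.update_self]
    exact (hL.integral_norm_quadFluctuation_le _).trans (mul_le_mul_of_nonneg_left
      (norm_genResolvent_partialCov_mul_le hz _ x B) hL.mul_card_nonneg)
  refine (integral_mono_of_nonneg (ae_of_all _ fun x => integral_nonneg fun v => norm_nonneg _)
    (integrable_const _) (ae_of_all _ hinner)).trans_eq (by simp)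

theorem integrable_covStieltjes [Nonempty ι] (hz : 0 < z.im) :
    Integrable (fun x : Fin p → ι → ℝ => covStieltjes z x) (Measure.pi fun _ => L) :=
  (integrable_const (1 / z.im)).mono' (continuous_covStieltjes hz).aestronglyMeasurable
    (ae_of_all _ (norm_covStieltjes_le hz))

theorem norm_meanCovStieltjes_le [Nonempty ι] (hz : 0 < z.im) :
    ‖meanCovStieltjes p L z‖ ≤ 1 / z.im := by
  simpa [meanCovStieltjes] using norm_integral_le_of_norm_le_const
    (μ := Measure.pi fun _ : Fin p => L) (ae_of_all _ (norm_covStieltjes_le hz))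

theorem integrable_companion_covStieltjes [Nonempty ι] (γ : ℝ) (hz : 0 < z.im) :
    Integrable (fun x : Fin p → ι → ℝ => companion γ z (covStieltjes z x))
      (Measure.pi fun _ => L) :=
  (integrable_const _).add ((integrable_covStieltjes L hz).const_mul _)

theorem companion_meanCovStieltjes [Nonempty ι] (γ : ℝ) (hz : 0 < z.im) :
    companion γ z (meanCovStieltjes p L z)
      = ∫ x : Fin p → ι → ℝ, companion γ z (covStieltjes z x) ∂(Measure.pi fun _ => L) := by
  simp only [companion]
  rw [integral_add (integrable_const _) ((integrable_covStieltjes L hz).const_mul _),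
    integral_const_mul, integral_const, probReal_univ, one_smul, meanCovStieltjes]

theorem im_companion_meanCovStieltjes_nonpos [Nonempty ι] (hp : 0 < p) (hz : 0 < z.im) :
    (companion (Fintype.card ι / p) z (meanCovStieltjes p L z)).im ≤ 0 := by
  have him := integral_im (𝕜 := ℂ)
    (integrable_companion_covStieltjes (p := p) L (Fintype.card ι / p) hz)
  rw [companion_meanCovStieltjes L _ hz]
  exact him.symm.trans_le (integral_nonpos (im_companion_covStieltjes_nonpos hp hz))

theorem im_companion_meanCovStieltjes_div_nonpos [Nonempty ι] (hp : 0 < p) (hz : 0 < z.im) :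
    (companion (Fintype.card ι / p) z (meanCovStieltjes p L z) / z).im ≤ 0 := by
  have him := integral_im (𝕜 := ℂ)
    ((integrable_companion_covStieltjes (p := p) L (Fintype.card ι / p) hz).div_const z)
  rw [companion_meanCovStieltjes L _ hz, ← integral_div]
  exact him.symm.trans_le (integral_nonpos (im_companion_covStieltjes_div_nonpos hp hz))

theorem integral_sum_norm_leaveOneOutFluctuation_add_le {ε : ℝ}
    (hL : ConcentratedColumn L T ε) (hz : 0 < z.im) (B : Matrix ι ι ℂ) (c : ℝ) :
    ∫ x : Fin p → ι → ℝ, ∑ j, (‖leaveOneOutFluctuation z T B x j‖ + c) ∂(Measure.pi fun _ => L)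
      ≤ p * (ε * Fintype.card ι * (‖B‖ / z.im) + c) := by
  have hint (j : Fin p) := (integrable_leaveOneOutFluctuation L hL.integrable_sq hz T B j).norm
  have hint_add (j : Fin p) : Integrable (fun x : Fin p → ι → ℝ =>
      ‖leaveOneOutFluctuation z T B x j‖ + c) (Measure.pi fun _ => L) :=
    (hint j).add (integrable_const c)
  rw [integral_finsetSum _ fun j _ => hint_add j]
  refine (Finset.sum_le_card_nsmul _ _ (ε * Fintype.card ι * (‖B‖ / z.im) + c)
    fun j _ => ?_).trans_eq (by rw [Finset.card_univ, Fintype.card_fin, nsmul_eq_mul])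
  rw [integral_add (hint j) (integrable_const c), integral_const, probReal_univ, one_smul]
  exact add_le_add_left (integral_norm_leaveOneOutFluctuation_le L hL hz B j) c

theorem meanCovStieltjes_sub_integral_esd [Nonempty ι] (hz : 0 < z.im) (hs : s.im ≤ 0)
    (hT : T.PosSemidef) :
    meanCovStieltjes p L z - ∫ t : ℝ, 1 / (z - s * t) ∂(esd hT.isHermitian : Measure ℝ)
      = (Fintype.card ι : ℂ)⁻¹ * ∫ x : Fin p → ι → ℝ,
        ((genResolvent z 1 (partialCov Finset.univ x)).trace - (genResolvent z s T).trace)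
        ∂(Measure.pi fun _ => L) := by
  have hint : Integrable (fun x : Fin p → ι → ℝ =>
      (Fintype.card ι : ℂ)⁻¹ * (genResolvent z 1 (partialCov Finset.univ x)).trace)
      (Measure.pi fun _ => L) := integrable_covStieltjes L hz
  rw [integral_esd_one_div hz hs hT, ← integral_const_mul]
  simp only [mul_sub]
  rw [integral_sub hint (integrable_const _), integral_const, probReal_univ, one_smul]
  rfl

theorem norm_meanCovStieltjes_sub_integral_esd_le [Nonempty ι] {ε : ℝ}
    (hL : ConcentratedColumn L T ε) (hT : T.PosSemidef) (hp : 0 < p) (hz : 0 < z.im) :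
    ‖meanCovStieltjes p L z - ∫ t : ℝ,
        1 / (z - companion (Fintype.card ι / p) z (meanCovStieltjes p L z) * t)
        ∂(esd hT.isHermitian : Measure ℝ)‖
      ≤ ‖z‖ / z.im * (ε / z.im ^ 2 + ‖T‖ / z.im ^ 2 / Fintype.card ι)
        + ‖T‖ / z.im ^ 2 * (Fintype.card ι / p * ‖z‖)
          * ∫ x : Fin p → ι → ℝ, ‖covStieltjes z x - meanCovStieltjes p L z‖
            ∂(Measure.pi fun _ => L) := by
  set M := meanCovStieltjes p L z
  have hs := im_companion_meanCovStieltjes_nonpos L hp hz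
  set D := genResolvent z (companion (Fintype.card ι / p) z M) T with hD
  have hfluct := integral_sum_norm_leaveOneOutFluctuation_add_le (p := p) L hL hz D (‖T‖ / z.im ^ 2)
  have hdev : Integrable (fun x : Fin p → ι → ℝ => ‖covStieltjes z x - M‖)
      (Measure.pi fun _ => L) := ((integrable_covStieltjes L hz).sub (integrable_const M)).norm
  have hsum : Integrable (fun x : Fin p → ι → ℝ =>
      ∑ j, (‖leaveOneOutFluctuation z T D x j‖ + ‖T‖ / z.im ^ 2)) (Measure.pi fun _ => L) :=
    integrable_finsetSum _ fun j _ =>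
      (integrable_leaveOneOutFluctuation L hL.integrable_sq hz T D j).norm.add (integrable_const _)
  rw [meanCovStieltjes_sub_integral_esd L hz hs hT, norm_mul, norm_inv, Complex.norm_natCast,
    inv_mul_le_iff₀ (by exact_mod_cast Fintype.card_pos)]
  have hbound : Integrable (fun x : Fin p → ι → ℝ =>
      ‖z‖ / z.im * ((p : ℝ)⁻¹ * ∑ j, (‖leaveOneOutFluctuation z T D x j‖ + ‖T‖ / z.im ^ 2))
        + Fintype.card ι * (‖T‖ / z.im ^ 2) * (Fintype.card ι / p * ‖z‖) * ‖covStieltjes z x - M‖)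
      (Measure.pi fun _ => L) := ((hsum.const_mul _).const_mul _).add (hdev.const_mul _)
  refine (norm_integral_le_of_norm_le hbound
    (ae_of_all _ fun x => norm_trace_genResolvent_sub_le hp hz hT hs x hD)).trans ?_
  rw [integral_add ((hsum.const_mul _).const_mul _) (hdev.const_mul _),
    integral_const_mul, integral_const_mul, integral_const_mul]
  calc _ ≤ ‖z‖ / z.im * ((p : ℝ)⁻¹ * (p * (ε * Fintype.card ι * (1 / z.im / z.im)
          + ‖T‖ / z.im ^ 2))) + Fintype.card ι * (‖T‖ / z.im ^ 2) * (Fintype.card ι / p * ‖z‖)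
          * ∫ x : Fin p → ι → ℝ, ‖covStieltjes z x - M‖ ∂(Measure.pi fun _ => L) := by
        gcongr
        refine hfluct.trans ?_
        gcongr
        · exact hL.mul_card_nonneg
        · exact norm_genResolvent_le hz hs hT
    _ = _ := by field_simp

theorem measureReal_norm_covStieltjes_sub_ge_le [Nonempty ι] (hz : 0 < z.im) {δ : ℝ}
    (hδ : 0 ≤ δ) :
    (Measure.pi fun _ : Fin p => L).real {x | δ ≤ ‖covStieltjes z x - meanCovStieltjes p L z‖}
      ≤ 4 * Real.exp (-((δ * Fintype.card ι * z.im) ^ 2 / (8 * p))) := by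
  have hdiff : HasBoundedDifferences (fun x : Fin p → ι → ℝ => covStieltjes z x)
      fun _ => (2 / (Fintype.card ι * z.im)).toNNReal := fun x j v =>
    (norm_covStieltjes_update_sub_le hz x j v).trans (Real.le_coe_toNNReal _)
  refine (hdiff.measureReal_norm_sub_integral_ge_le (fun _ => L) (integrable_covStieltjes L hz)
    (continuous_covStieltjes hz).measurable hδ).trans_eq ?_
  rw [Finset.sum_const, Finset.card_univ, Fintype.card_fin, nsmul_eq_mul,
    Real.coe_toNNReal _ (by positivity)]
  congr 3
  field_simp
  ring

end Expectation

section ColouredTensorLaw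

open Matrix
open scoped Matrix.Norms.L2Operator

section MulVec

variable {ι : Type*} [Fintype ι] {A T : Matrix ι ι ℝ}

theorem realQuad_mulVec (A : Matrix ι ι ℝ) (B : Matrix ι ι ℂ) (v : ι → ℝ) :
    realQuad B (A *ᵥ v) = realQuad (complexify Aᵀ * B * complexify A) v := by
  rw [realQuad, realQuad, ← complexify_mulVec, ← mulVec_mulVec, ← mulVec_mulVec,
    dotProduct_mulVec _ (complexify Aᵀ), complexify, complexify, transpose_map, vecMul_transpose]

theorem quadFluctuation_mulVec (A T : Matrix ι ι ℝ) (B : Matrix ι ι ℂ) (v : ι → ℝ) :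
    quadFluctuation (A * T * Aᵀ) B (A *ᵥ v)
      = quadFluctuation T (complexify Aᵀ * B * complexify A) v := by
  rw [quadFluctuation, quadFluctuation, realQuad_mulVec, complexify_mul, complexify_mul,
    ← Matrix.mul_assoc B, trace_mul_comm _ (complexify Aᵀ)]
  simp only [Matrix.mul_assoc]

variable [DecidableEq ι]

theorem norm_complexify_transpose_mul_mul_le (A : Matrix ι ι ℝ) (B : Matrix ι ι ℂ) :
    ‖complexify Aᵀ * B * complexify A‖ ≤ ‖A‖ ^ 2 * ‖B‖ := by
  have htranspose : ‖complexify Aᵀ‖ ≤ ‖A‖ := by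
    rw [← l2_opNorm_conjTranspose A, conjTranspose_eq_transpose_of_trivial]
    exact norm_complexify_le Aᵀ
  calc ‖complexify Aᵀ * B * complexify A‖ ≤ ‖complexify Aᵀ‖ * ‖B‖ * ‖complexify A‖ :=
        (norm_mul_le _ _).trans (by gcongr; exact norm_mul_le _ _)
    _ ≤ ‖A‖ * ‖B‖ * ‖A‖ := by gcongr; exact norm_complexify_le A
    _ = ‖A‖ ^ 2 * ‖B‖ := by ring

theorem ConcentratedColumn.map_mulVec {L : Measure (ι → ℝ)} {ε : ℝ}
    (hL : ConcentratedColumn L T ε) (A : Matrix ι ι ℝ) :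
    ConcentratedColumn (L.map (A *ᵥ ·)) (A * T * Aᵀ) (‖A‖ ^ 2 * ε) where
  integrable_sq i := by
    have hA : Measurable (A *ᵥ · : (ι → ℝ) → ι → ℝ) :=
      (continuous_const.matrix_mulVec continuous_id).measurable
    rw [integrable_map_measure ((measurable_pi_apply i).pow_const 2).aestronglyMeasurable
      hA.aemeasurable]
    refine ((integrable_finsetSum Finset.univ fun k _ => hL.integrable_sq k).const_mul
      (∑ k, A i k ^ 2)).mono' (by fun_prop) (ae_of_all _ fun v => ?_)
    rw [Function.comp_apply, Real.norm_of_nonneg (sq_nonneg _)]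
    exact Finset.sum_mul_sq_le_sq_mul_sq Finset.univ (A i) v
  integral_norm_quadFluctuation_le B := by
    have hA : Measurable (A *ᵥ · : (ι → ℝ) → ι → ℝ) :=
      (continuous_const.matrix_mulVec continuous_id).measurable
    rw [integral_map hA.aemeasurable
      (continuous_quadFluctuation _ continuous_const continuous_id').norm.aestronglyMeasurable]
    simp only [quadFluctuation_mulVec]
    calc _ ≤ ε * Fintype.card ι * (‖A‖ ^ 2 * ‖B‖) :=
          (hL.integral_norm_quadFluctuation_le _).trans (mul_le_mul_of_nonneg_left
            (norm_complexify_transpose_mul_mul_le A B) hL.mul_card_nonneg)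
      _ = ‖A‖ ^ 2 * ε * Fintype.card ι * ‖B‖ := by ring

end MulVec

theorem integral_norm_le_sqrt_integral_norm_sq {Ω E : Type*} [MeasurableSpace Ω]
    [NormedAddCommGroup E] {P : Measure Ω} [IsProbabilityMeasure P] {f : Ω → E}
    (hf : AEStronglyMeasurable f P) (hint : Integrable (fun ω => ‖f ω‖ ^ 2) P) :
    ∫ ω, ‖f ω‖ ∂P ≤ √(∫ ω, ‖f ω‖ ^ 2 ∂P) := by
  have hvar := variance_eq_sub ((memLp_two_iff_integrable_sq_norm hf).2 hint).norm
  exact Real.le_sqrt_of_sq_le (sub_nonneg.1 (hvar.symm.trans_ge (variance_nonneg _ _)))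

variable {n d : ℕ} {ν : Measure ℝ}

theorem continuous_tensorVector : Continuous (tensorVector (n := n) d) :=
  continuous_pi fun _ => continuous_finsetProd _ fun i _ => continuous_apply i

theorem quadFluctuation_one_tensorVector (B : Matrix (TensorIndex n d) (TensorIndex n d) ℂ)
    (x : Fin n → ℝ) :
    quadFluctuation 1 B (tensorVector d x)
      = ∑ p : TensorIndex n d × TensorIndex n d, tensorFluctuation p x • B p.1 p.2 := by
  have htrace : (B * complexify 1).trace
      = ∑ s, ∑ t, ((if s = t then 1 else 0 : ℝ) : ℂ) * B s t := by
    simp only [trace, diag_apply, apply_ite Complex.ofReal, Complex.ofReal_one, Complex.ofReal_zero]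
    simp
  rw [quadFluctuation, htrace, realQuad, Fintype.sum_prod_type]
  simp only [dotProduct, mulVec, Finset.mul_sum, ← Finset.sum_sub_distrib]
  refine Finset.sum_congr rfl fun s _ => Finset.sum_congr rfl fun t _ => ?_
  rw [tensorFluctuation, Complex.real_smul, Complex.ofReal_sub, Complex.ofReal_mul]
  simp only [Function.comp_apply]
  ring

variable [IsProbabilityMeasure ν]

instance : IsProbabilityMeasure (tensorLaw n d ν) :=
  Measure.isProbabilityMeasure_map continuous_tensorVector.measurable.aemeasurable

instance (T : Matrix (TensorIndex n d) (TensorIndex n d) ℝ) :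
    IsProbabilityMeasure (colouredTensorLaw ν T) :=
  Measure.isProbabilityMeasure_map
    (continuous_const.matrix_mulVec continuous_id).measurable.aemeasurable

theorem integral_norm_quadFluctuation_one_tensorVector_le (h : IsSymmUnit ν)
    (B : Matrix (TensorIndex n d) (TensorIndex n d) ℂ) :
    ∫ x, ‖quadFluctuation 1 B (tensorVector d x)‖ ∂(Measure.pi fun _ : Fin n => ν)
      ≤ √(tensorVarianceRatio n d (∫ x, x ^ 4 ∂ν)) * n.choose d * ‖B‖ := by
  have hmeas : AEStronglyMeasurable (fun x => quadFluctuation 1 B (tensorVector d x))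
      (Measure.pi fun _ : Fin n => ν) :=
    (continuous_quadFluctuation 1 continuous_const continuous_tensorVector).aestronglyMeasurable
  simp only [quadFluctuation_one_tensorVector] at hmeas ⊢
  refine (integral_norm_le_sqrt_integral_norm_sq hmeas (integrable_norm_sum_smul_sq
    (integrable_tensorFluctuation_mul h) _)).trans (Real.sqrt_le_iff.2 ⟨by positivity, ?_⟩)
  have hratio : 0 ≤ tensorVarianceRatio n d (∫ x, x ^ 4 ∂ν) :=
    tensorVarianceRatio_nonneg h.one_le_integral_pow_four
  have hentries := sum_norm_sq_apply_le_card_mul B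
  rw [card_tensorIndex] at hentries
  calc _ ≤ n.choose d * tensorVarianceRatio n d (∫ x, x ^ 4 ∂ν) * (n.choose d * ‖B‖ ^ 2) := by
        refine (integral_norm_sum_tensorFluctuation_smul_sq_le h _).trans ?_
        gcongr
    _ = _ := by rw [mul_pow, mul_pow, Real.sq_sqrt hratio]; ring

theorem concentratedColumn_tensorLaw (h : IsSymmUnit ν) :
    ConcentratedColumn (tensorLaw n d ν) 1 √(tensorVarianceRatio n d (∫ x, x ^ 4 ∂ν)) where
  integrable_sq s := by
    rw [tensorLaw, integrable_map_measure ((measurable_pi_apply s).pow_const 2).aestronglyMeasurable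
      continuous_tensorVector.measurable.aemeasurable]
    simpa only [Function.comp_def, sq] using integrable_tensorVector_mul h s s
  integral_norm_quadFluctuation_le B := by
    rw [tensorLaw, integral_map continuous_tensorVector.measurable.aemeasurable
      (continuous_quadFluctuation _ continuous_const continuous_id').norm.aestronglyMeasurable,
      card_tensorIndex]
    exact integral_norm_quadFluctuation_one_tensorVector_le h B

theorem concentratedColumn_colouredTensorLaw (h : IsSymmUnit ν)
    {T : Matrix (TensorIndex n d) (TensorIndex n d) ℝ} (hT : T.PosSemidef) :
    ConcentratedColumn (colouredTensorLaw ν T) T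
      (‖T‖ * √(tensorVarianceRatio n d (∫ x, x ^ 4 ∂ν))) := by
  have hT_nonneg : 0 ≤ T := nonneg_iff_posSemidef.2 hT
  have hsqrt := (nonneg_iff_posSemidef.1 (CFC.sqrt_nonneg T)).isHermitian
  have hmap := (concentratedColumn_tensorLaw h).map_mulVec (CFC.sqrt T)
  rwa [Matrix.mul_one, ← conjTranspose_eq_transpose_of_trivial, hsqrt,
    CFC.sqrt_mul_sqrt_self T, CFC.norm_sqrt T, Real.sq_sqrt (norm_nonneg T)] at hmap

end ColouredTensorLaw

section SpectralDistribution

open scoped Matrix.Norms.L2Operator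

variable {ι : Type*} [Fintype ι] [DecidableEq ι] {A B : Matrix ι ι ℝ}

theorem esd_congr (h : A = B) (hA : A.IsHermitian) (hB : B.IsHermitian) : esd hA = esd hB := by
  subst h
  rfl

theorem isProbabilityMeasure_esd [Nonempty ι] (hA : A.IsHermitian) :
    IsProbabilityMeasure (esd hA : Measure ℝ) := by
  have hmass := integral_esd hA fun _ => (1 : ℝ)
  rw [isProbabilityMeasure_iff_real]
  simpa using hmass

theorem toFiniteMeasure_normalize_esd [Nonempty ι] (hA : A.IsHermitian) :
    (esd hA).normalize.toFiniteMeasure = esd hA :=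
  congrArg ProbabilityMeasure.toFiniteMeasure (ProbabilityMeasure.toFiniteMeasure_normalize_eq_self
    (⟨esd hA, isProbabilityMeasure_esd hA⟩ : ProbabilityMeasure ℝ))

theorem ae_esd (hA : A.IsHermitian) {q : ℝ → Prop} (h : ∀ j, q (hA.eigenvalues j)) :
    ∀ᵐ t ∂(esd hA : Measure ℝ), q t := by
  rw [ae_iff, coe_esd, Measure.smul_apply, Measure.finsetSum_apply]
  simp [h]

theorem eigenvalues_le_norm (hA : A.IsHermitian) (j : ι) : hA.eigenvalues j ≤ ‖A‖ := by
  have : Nonempty ι := ⟨j⟩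
  exact (le_abs_self _).trans (spectrum.norm_le_norm_of_mem (hA.eigenvalues_mem_spectrum_real j))

theorem ae_esd_mem_Icc (hA : A.PosSemidef) {K : ℝ} (hK : ‖A‖ ≤ K) :
    ∀ᵐ t ∂(esd hA.isHermitian : Measure ℝ), t ∈ Set.Icc 0 K :=
  ae_esd _ fun j => ⟨hA.eigenvalues_nonneg j, (eigenvalues_le_norm _ j).trans hK⟩

theorem stieltjesTransform_normalize_esd_partialCov [Nonempty ι] {p : ℕ} {z : ℂ} (hz : 0 < z.im)
    (x : Fin p → ι → ℝ) :
    stieltjesTransform (esd (posSemidef_partialCov Finset.univ x).isHermitian).normalize z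
      = covStieltjes z x := by
  rw [covStieltjes, ← stieltjesTransform_esd hz (posSemidef_partialCov Finset.univ x)]
  exact congrArg (fun μ : FiniteMeasure ℝ => stieltjesTransform μ z)
    (toFiniteMeasure_normalize_esd _)

end SpectralDistribution

section BorelCantelli

variable {Ω : Type*} [MeasurableSpace Ω] {P : Measure Ω} [IsFiniteMeasure P]

theorem ae_tendsto_zero_of_summable_measureReal {E : Type*} [SeminormedAddCommGroup E]
    {f : ℕ → Ω → E} (h : ∀ δ > 0, Summable fun n => P.real {ω | δ ≤ ‖f n ω‖}) :
    ∀ᵐ ω ∂P, Tendsto (fun n => f n ω) atTop (𝓝 0) := by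
  obtain ⟨δ, -, hδ_pos, hδ⟩ := exists_seq_strictAnti_tendsto (0 : ℝ)
  have hsmall : ∀ k, ∀ᵐ ω ∂P, ∀ᶠ n in atTop, ω ∉ {ω | δ k ≤ ‖f n ω‖} := fun k =>
    ae_eventually_notMem (by simpa using (h (δ k) (hδ_pos k)).tsum_ofReal_ne_top)
  filter_upwards [ae_all_iff.2 hsmall] with ω hω
  rw [NormedAddGroup.tendsto_nhds_zero]
  intro ε hε
  obtain ⟨k, hk⟩ := (hδ.eventually_lt_const hε).exists
  exact (hω k).mono fun n hn => (not_le.1 hn).trans hk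

end BorelCantelli

section Asymptotics

theorem le_choose_of_pos_of_lt {n d : ℕ} (hd : 0 < d) (hdn : d < n) : n ≤ n.choose d := by
  induction n, hdn using Nat.le_induction with
  | base => simp
  | succ m hdm ih =>
    obtain ⟨e, rfl⟩ := Nat.exists_eq_succ_of_ne_zero hd.ne'
    have hpos : 0 < m.choose e := Nat.choose_pos (by omega)
    rw [Nat.choose_succ_succ]
    omega

theorem tensorVarianceRatio_le (n d : ℕ) {κ : ℝ} (hκ : 1 ≤ κ) :
    tensorVarianceRatio n d κ ≤ (Real.exp ((d : ℝ) ^ 2 * κ / n) - 1)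
      + 2 * ((d : ℝ) ^ 2 * κ / n) * Real.exp ((d : ℝ) ^ 2 * κ / n) := by
  have hratio : (d : ℝ) * ((d : ℝ) / n) ≤ (d : ℝ) ^ 2 * κ / n := by
    rw [← mul_div_assoc, ← sq]
    gcongr
    exact le_mul_of_one_le_right (sq_nonneg _) hκ
  have hpow : (1 + (κ - 1) * ((d : ℝ) / n)) ^ d ≤ Real.exp ((d : ℝ) ^ 2 * κ / n) := by
    calc (1 + (κ - 1) * ((d : ℝ) / n)) ^ d ≤ Real.exp (κ * ((d : ℝ) / n)) ^ d := by
          refine pow_le_pow_left₀ (zero_le_one.trans (one_le_one_add_mul_div hκ n d)) ?_ d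
          rw [add_comm]
          refine le_trans ?_ (Real.add_one_le_exp _)
          gcongr
          exact sub_le_self κ zero_le_one
      _ = Real.exp ((d : ℝ) ^ 2 * κ / n) := by
          rw [← Real.exp_nat_mul]
          congr 1
          ring
  rw [tensorVarianceRatio, mul_assoc 2]
  gcongr

theorem tendsto_tensorVarianceRatio {d : ℕ → ℕ} {κ : ℕ → ℝ} (hκ : ∀ᶠ n in atTop, 1 ≤ κ n)
    (hlim : Tendsto (fun n => (d n : ℝ) ^ 2 * κ n / n) atTop (𝓝 0)) :
    Tendsto (fun n => tensorVarianceRatio n (d n) (κ n)) atTop (𝓝 0) := by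
  have hcont : Continuous fun x : ℝ => (Real.exp x - 1) + 2 * x * Real.exp x := by fun_prop
  refine squeeze_zero' (hκ.mono fun n hn => tensorVarianceRatio_nonneg hn)
    (hκ.mono fun n hn => tensorVarianceRatio_le n (d n) hn) ?_
  simpa [Function.comp_def] using (hcont.tendsto 0).comp hlim

theorem eventually_lt_of_tendsto_sq_mul_div {d : ℕ → ℕ} {κ : ℕ → ℝ}
    (hκ : ∀ᶠ n in atTop, 1 ≤ κ n)
    (hlim : Tendsto (fun n => (d n : ℝ) ^ 2 * κ n / n) atTop (𝓝 0)) :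
    ∀ᶠ n in atTop, d n < n := by
  filter_upwards [hκ, hlim.eventually_lt_const one_pos, eventually_gt_atTop 0] with n hκn hn hpos
  rw [div_lt_one (by exact_mod_cast hpos)] at hn
  have hsq : (d n : ℝ) ^ 2 < n := (le_mul_of_one_le_right (sq_nonneg _) hκn).trans_lt hn
  exact (Nat.le_self_pow two_ne_zero _).trans_lt (by exact_mod_cast hsq)

theorem tendsto_div_of_tendsto_log_div_log {α : Type*} {l : Filter α} {C r : α → ℝ} {c : ℝ}
    (hc : 1 < c) (hC : ∀ᶠ n in l, c ≤ C n) (hr : ∀ᶠ n in l, 1 < r n)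
    (hlog : Tendsto (fun n => Real.log (C n) / Real.log (r n)) l (𝓝 0)) :
    Tendsto (fun n => C n / r n) l (𝓝 0) := by
  have hlog_pos : ∀ᶠ n in l, 0 < Real.log (C n) / Real.log (r n) := by
    filter_upwards [hC, hr] with n hCn hrn
    exact div_pos (Real.log_pos (hc.trans_le hCn)) (Real.log_pos hrn)
  have hlog_r : Tendsto (fun n => Real.log (r n)) l atTop := by
    have hinv := (tendsto_nhdsWithin_iff.2 ⟨hlog, hlog_pos⟩).inv_tendsto_nhdsGT_zero
    refine tendsto_atTop_mono' l ?_ (hinv.const_mul_atTop (Real.log_pos hc))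
    filter_upwards [hC, hr] with n hCn hrn
    have hr0 := Real.log_pos hrn
    have hlogC : Real.log c ≤ Real.log (C n) := Real.log_le_log (one_pos.trans hc) hCn
    rw [Pi.inv_apply, inv_div, mul_div_left_comm]
    exact mul_le_of_le_one_right hr0.le
      ((div_le_one ((Real.log_pos hc).trans_le hlogC)).2 hlogC)
  have hexponent : Tendsto (fun n => Real.log (r n) * (Real.log (C n) / Real.log (r n) - 1))
      l atBot := hlog_r.atTop_mul_neg neg_one_lt_zero (by simpa using hlog.sub_const 1)
  refine (Real.tendsto_exp_atBot.comp hexponent).congr' ?_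
  filter_upwards [hC, hr] with n hCn hrn
  rw [Function.comp_apply, mul_sub_one, mul_div_cancel₀ _ (Real.log_pos hrn).ne', Real.exp_sub,
    Real.exp_log (by linarith), Real.exp_log (by linarith)]

theorem tendsto_sq_mul_div {d : ℕ → ℕ} {C κ : ℕ → ℝ} (hd_pos : ∀ᶠ n in atTop, 0 < d n)
    (hd_lt : ∀ᶠ n : ℕ in atTop, (d n : ℝ) < √n) (hC : ∀ᶠ n in atTop, 2 ≤ C n)
    (hκ_nonneg : ∀ n, 0 ≤ κ n)
    (hκ : ∀ᶠ n in atTop, κ n ≤ (C n * 2) ^ 2)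
    (hlog : Tendsto (fun n : ℕ => Real.log (C n) / Real.log (√n / d n)) atTop (𝓝 0)) :
    Tendsto (fun n => (d n : ℝ) ^ 2 * κ n / n) atTop (𝓝 0) := by
  have hratio : ∀ᶠ n : ℕ in atTop, 1 < √n / d n := by
    filter_upwards [hd_pos, hd_lt] with n hpos hlt
    exact (one_lt_div (Nat.cast_pos.2 hpos)).2 hlt
  have hlim := ((tendsto_div_of_tendsto_log_div_log one_lt_two hC hratio hlog).pow 2).const_mul 4
  rw [zero_pow two_ne_zero, mul_zero] at hlim
  refine squeeze_zero' (.of_forall fun n => by have := hκ_nonneg n; positivity) ?_ hlim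
  filter_upwards [hκ] with n hκn
  calc (d n : ℝ) ^ 2 * κ n / n ≤ (d n : ℝ) ^ 2 * (C n * 2) ^ 2 / n := by gcongr
    _ = 4 * (C n / (√n / d n)) ^ 2 := by
      rw [div_div_eq_mul_div, div_pow, Real.sq_sqrt (Nat.cast_nonneg n)]
      ring

end Asymptotics

section Convergence

open scoped Matrix.Norms.L2Operator

variable {ι : ℕ → Type*} [∀ n, Fintype (ι n)] {p : ℕ → ℕ} {γ : ℝ}

theorem eventually_nonempty_of_le_card (hcard : ∀ᶠ n in atTop, n ≤ Fintype.card (ι n)) :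
    ∀ᶠ n in atTop, Nonempty (ι n) := by
  filter_upwards [hcard, eventually_gt_atTop 0] with n hn hpos
  exact Fintype.card_pos_iff.1 (hpos.trans_le hn)

theorem eventually_pos_of_tendsto_div {a : ℕ → ℝ} (hγ : 0 < γ)
    (hlim : Tendsto (fun n => a n / p n) atTop (𝓝 γ)) : ∀ᶠ n in atTop, 0 < p n := by
  filter_upwards [hlim.eventually_const_lt hγ] with n hn
  refine Nat.pos_of_ne_zero fun hp => ?_
  simp [hp] at hn

theorem exp_neg_sq_div_le {p N n : ℕ} {δ y : ℝ} (hratio : γ / 2 ≤ (N : ℝ) / p)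
    (hn : n ≤ N) :
    Real.exp (-((δ * N * y) ^ 2 / (8 * p))) ≤ Real.exp (-((δ * y) ^ 2 * γ / 16)) ^ n := by
  rw [← Real.exp_nat_mul, Real.exp_le_exp, mul_neg, neg_le_neg_iff]
  calc n * ((δ * y) ^ 2 * γ / 16) = (δ * y) ^ 2 / 8 * (γ / 2 * n) := by ring
    _ ≤ (δ * y) ^ 2 / 8 * ((N : ℝ) / p * N) := by gcongr
    _ = (δ * N * y) ^ 2 / (8 * p) := by ring

variable [∀ n, DecidableEq (ι n)] {T : ∀ n, Matrix (ι n) (ι n) ℝ}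

theorem ae_nonneg_of_tendsto_esd (hT : ∀ n, (T n).PosSemidef) {H : ProbabilityMeasure ℝ}
    (hT_lim : Tendsto (fun n => esd (hT n).isHermitian) atTop (𝓝 H.toFiniteMeasure)) :
    ∀ᵐ t ∂(H : Measure ℝ), 0 ≤ t :=
  ae_mem_of_tendsto hT_lim isClosed_Ici fun n => ae_esd _ (hT n).eigenvalues_nonneg

variable {L : ∀ n, Measure (ι n → ℝ)} [∀ n, IsProbabilityMeasure (L n)]
  {K : ℝ} {ε : ℕ → ℝ} {z : ℂ}
  {Ω : Type*} [MeasurableSpace Ω] {P : Measure Ω} [IsProbabilityMeasure P]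
  {X : ∀ n, Ω → Fin (p n) → ι n → ℝ}

theorem ae_tendsto_covStieltjes_sub (hcard : ∀ᶠ n in atTop, n ≤ Fintype.card (ι n)) (hγ : 0 < γ)
    (hγ_lim : Tendsto (fun n => (Fintype.card (ι n) : ℝ) / p n) atTop (𝓝 γ))
    (hX : ∀ᶠ n in atTop, HasLaw (X n) (Measure.pi fun _ => L n) P) (hz : 0 < z.im) :
    ∀ᵐ ω ∂P, Tendsto (fun n => covStieltjes z (X n ω) - meanCovStieltjes (p n) (L n) z)
      atTop (𝓝 0) := by
  refine ae_tendsto_zero_of_summable_measureReal fun δ hδ => ?_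
  have hq : Real.exp (-((δ * z.im) ^ 2 * γ / 16)) < 1 :=
    Real.exp_lt_one_iff.2 (neg_lt_zero.2 (by positivity))
  refine Summable.of_norm_bounded_eventually_nat
    ((summable_geometric_of_lt_one (Real.exp_pos _).le hq).mul_left 4) ?_
  filter_upwards [hcard, eventually_nonempty_of_le_card hcard, hX,
    hγ_lim.eventually_const_le (half_lt_self hγ)] with n hn hne hXn hratio
  have hset : MeasurableSet {x : Fin (p n) → ι n → ℝ |
      δ ≤ ‖covStieltjes z x - meanCovStieltjes (p n) (L n) z‖} :=
    (isClosed_le continuous_const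
      ((continuous_covStieltjes hz).sub continuous_const).norm).measurableSet
  rw [Real.norm_of_nonneg measureReal_nonneg]
  exact (hXn.measureReal_eq hset).trans_le
    ((measureReal_norm_covStieltjes_sub_ge_le (L n) hz hδ.le).trans
      (mul_le_mul_of_nonneg_left (exp_neg_sq_div_le hratio hn) (by norm_num)))

theorem tendsto_integral_norm_covStieltjes_sub
    (hcard : ∀ᶠ n in atTop, n ≤ Fintype.card (ι n)) (hγ : 0 < γ)
    (hγ_lim : Tendsto (fun n => (Fintype.card (ι n) : ℝ) / p n) atTop (𝓝 γ))
    (hX : ∀ᶠ n in atTop, HasLaw (X n) (Measure.pi fun _ => L n) P) (hz : 0 < z.im) :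
    Tendsto (fun n => ∫ x : Fin (p n) → ι n → ℝ, ‖covStieltjes z x
      - meanCovStieltjes (p n) (L n) z‖ ∂(Measure.pi fun _ => L n)) atTop (𝓝 0) := by
  have hcont (n : ℕ) : Continuous fun x : Fin (p n) → ι n → ℝ =>
      ‖covStieltjes z x - meanCovStieltjes (p n) (L n) z‖ :=
    ((continuous_covStieltjes hz).sub continuous_const).norm
  have hdom : Tendsto (fun n => ∫ ω, ‖covStieltjes z (X n ω)
      - meanCovStieltjes (p n) (L n) z‖ ∂P) atTop (𝓝 (∫ _, (0 : ℝ) ∂P)) := by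
    refine tendsto_integral_filter_of_dominated_convergence (fun _ => 1 / z.im + 1 / z.im) ?_ ?_
      (integrable_const _) ?_
    · filter_upwards [hX] with n hXn
      exact ((hcont n).measurable.comp_aemeasurable hXn.aemeasurable).aestronglyMeasurable
    · filter_upwards [eventually_nonempty_of_le_card hcard] with n hne
      refine ae_of_all _ fun ω => ?_
      rw [norm_norm]
      exact norm_sub_le_of_le (norm_covStieltjes_le hz _) (norm_meanCovStieltjes_le (L n) hz)
    · filter_upwards [ae_tendsto_covStieltjes_sub hcard hγ hγ_lim hX hz] with ω hω
      exact tendsto_zero_iff_norm_tendsto_zero.1 hω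
  rw [integral_zero] at hdom
  refine hdom.congr' ?_
  filter_upwards [hX] with n hXn
  exact hXn.integral_comp (hcont n).aestronglyMeasurable

theorem tendsto_meanCovStieltjes_sub_integral_esd (hT : ∀ n, (T n).PosSemidef)
    (hTK : ∀ n, ‖T n‖ ≤ K) (hL : ∀ᶠ n in atTop, ConcentratedColumn (L n) (T n) (ε n))
    (hε : Tendsto ε atTop (𝓝 0)) (hcard : ∀ᶠ n in atTop, n ≤ Fintype.card (ι n)) (hγ : 0 < γ)
    (hγ_lim : Tendsto (fun n => (Fintype.card (ι n) : ℝ) / p n) atTop (𝓝 γ))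
    (hX : ∀ᶠ n in atTop, HasLaw (X n) (Measure.pi fun _ => L n) P) (hz : 0 < z.im) :
    Tendsto (fun n => meanCovStieltjes (p n) (L n) z - ∫ t : ℝ,
        1 / (z - companion (Fintype.card (ι n) / p n) z (meanCovStieltjes (p n) (L n) z) * t)
        ∂(esd (hT n).isHermitian : Measure ℝ)) atTop (𝓝 0) := by
  have hN : Tendsto (fun n => (Fintype.card (ι n) : ℝ)) atTop atTop :=
    tendsto_atTop_mono' _ (hcard.mono fun n hn => Nat.cast_le.2 hn) tendsto_natCast_atTop_atTop
  have hlim : Tendsto (fun n => ‖z‖ / z.im * (ε n / z.im ^ 2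
        + K / z.im ^ 2 / Fintype.card (ι n))
      + K / z.im ^ 2 * (Fintype.card (ι n) / p n * ‖z‖)
        * ∫ x : Fin (p n) → ι n → ℝ, ‖covStieltjes z x - meanCovStieltjes (p n) (L n) z‖
          ∂(Measure.pi fun _ => L n)) atTop
      (𝓝 (‖z‖ / z.im * (0 / z.im ^ 2 + 0) + K / z.im ^ 2 * (γ * ‖z‖) * 0)) :=
    (((hε.div_const _).add (tendsto_const_nhds.div_atTop hN)).const_mul _).add
      (((hγ_lim.mul_const _).const_mul _).mul
        (tendsto_integral_norm_covStieltjes_sub hcard hγ hγ_lim hX hz))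
  rw [zero_div, add_zero, mul_zero, mul_zero, add_zero] at hlim
  refine squeeze_zero_norm' ?_ hlim
  filter_upwards [eventually_nonempty_of_le_card hcard,
    eventually_pos_of_tendsto_div hγ hγ_lim, hL] with n hne hp hLn
  refine (norm_meanCovStieltjes_sub_integral_esd_le (L n) hLn (hT n) hp hz).trans ?_
  gcongr <;> exact hTK n

theorem exists_tendsto_meanCovStieltjes (hT : ∀ n, (T n).PosSemidef)
    (hTK : ∀ n, ‖T n‖ ≤ K) (hL : ∀ᶠ n in atTop, ConcentratedColumn (L n) (T n) (ε n))
    (hε : Tendsto ε atTop (𝓝 0)) (hcard : ∀ᶠ n in atTop, n ≤ Fintype.card (ι n)) (hγ : 0 < γ)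
    (hγ_lim : Tendsto (fun n => (Fintype.card (ι n) : ℝ) / p n) atTop (𝓝 γ))
    {H : ProbabilityMeasure ℝ}
    (hT_lim : Tendsto (fun n => esd (hT n).isHermitian) atTop (𝓝 H.toFiniteMeasure))
    (hX : ∀ᶠ n in atTop, HasLaw (X n) (Measure.pi fun _ => L n) P) (hz : 0 < z.im) :
    ∃ m, Tendsto (fun n => meanCovStieltjes (p n) (L n) z) atTop (𝓝 m) ∧
      m = ∫ t : ℝ, 1 / (z - companion γ z m * t) ∂(H : Measure ℝ) ∧
      (companion γ z m).im ≤ 0 := by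
  have hne := eventually_nonempty_of_le_card hcard
  have hp := eventually_pos_of_tendsto_div hγ hγ_lim
  obtain ⟨m, hm, hm_eq, hsol⟩ := exists_tendsto_of_approx_isCompanionSolution hT_lim
    (fun n => ae_esd_mem_Icc (hT n) (hTK n)) hz hγ hγ_lim
    (hne.mono fun n _ => norm_meanCovStieltjes_le (L n) hz)
    ((hne.and hp).mono fun n ⟨_, hpn⟩ => im_companion_meanCovStieltjes_nonpos (L n) hpn hz)
    ((hne.and hp).mono fun n ⟨_, hpn⟩ => im_companion_meanCovStieltjes_div_nonpos (L n) hpn hz)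
    (tendsto_meanCovStieltjes_sub_integral_esd hT hTK hL hε hcard hγ hγ_lim hX hz)
  exact ⟨m, hm, hm_eq, hsol.im_nonpos⟩

theorem exists_tendsto_esd_of_ae_tendsto_covStieltjes
    (hcard : ∀ᶠ n in atTop, n ≤ Fintype.card (ι n)) {m : ℂ → ℂ}
    (h : ∀ z : ℂ, 0 < z.im → ∀ᵐ ω ∂P, Tendsto (fun n => covStieltjes z (X n ω)) atTop (𝓝 (m z)))
    (hm : Tendsto (fun y : ℝ => y * Complex.I * m (y * Complex.I)) atTop (𝓝 1)) :
    ∃ μ : ProbabilityMeasure ℝ,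
      (∀ᵐ ω ∂P, Tendsto (fun n => esd (posSemidef_partialCov Finset.univ (X n ω)).isHermitian)
        atTop (𝓝 μ.toFiniteMeasure)) ∧ ∀ z : ℂ, 0 < z.im → stieltjesTransform μ z = m z := by
  have hne := eventually_nonempty_of_le_card hcard
  obtain ⟨μ, hμ, hμm⟩ := exists_ae_tendsto_of_ae_tendsto_stieltjesTransform (P := P)
    (μs := fun n ω => (esd (posSemidef_partialCov Finset.univ (X n ω)).isHermitian).normalize)
    (fun z hz => (h z hz).mono fun ω hω => hω.congr' (hne.mono fun n _ =>
      (stieltjesTransform_normalize_esd_partialCov hz (X n ω)).symm)) hm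
  refine ⟨μ, hμ.mono fun ω hω => ?_, hμm⟩
  exact ((ProbabilityMeasure.tendsto_nhds_iff_toFiniteMeasure_tendsto_nhds _).1 hω).congr'
    (hne.mono fun n _ => toFiniteMeasure_normalize_esd _)

theorem exists_tendsto_esd_of_concentratedColumn (hT : ∀ n, (T n).PosSemidef)
    (hTK : ∀ n, ‖T n‖ ≤ K) (hL : ∀ᶠ n in atTop, ConcentratedColumn (L n) (T n) (ε n))
    (hε : Tendsto ε atTop (𝓝 0)) (hcard : ∀ᶠ n in atTop, n ≤ Fintype.card (ι n)) (hγ : 0 < γ)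
    (hγ_lim : Tendsto (fun n => (Fintype.card (ι n) : ℝ) / p n) atTop (𝓝 γ))
    {H : ProbabilityMeasure ℝ}
    (hT_lim : Tendsto (fun n => esd (hT n).isHermitian) atTop (𝓝 H.toFiniteMeasure))
    (hX : ∀ᶠ n in atTop, HasLaw (X n) (Measure.pi fun _ => L n) P) :
    ∃ μ : ProbabilityMeasure ℝ,
      (∀ᵐ ω ∂P, Tendsto (fun n => esd (posSemidef_partialCov Finset.univ (X n ω)).isHermitian)
        atTop (𝓝 μ.toFiniteMeasure)) ∧
      ∀ z : ℂ, 0 < z.im →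
        (companion γ z (stieltjesTransform μ z)).im ≤ 0 ∧
        stieltjesTransform μ z
          = ∫ t : ℝ, 1 / (z - companion γ z (stieltjesTransform μ z) * t) ∂(H : Measure ℝ) := by
  have hlim (z : ℂ) (hz : 0 < z.im) :=
    exists_tendsto_meanCovStieltjes hT hTK hL hε hcard hγ hγ_lim hT_lim hX hz
  choose! m hm hm_eq him using hlim
  have hH : ∀ᵐ t ∂(H : Measure ℝ), 0 ≤ t := ae_nonneg_of_tendsto_esd hT hT_lim
  obtain ⟨μ, hμ, hμm⟩ := exists_tendsto_esd_of_ae_tendsto_covStieltjes (P := P) (X := X) hcard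
    (fun z hz => (ae_tendsto_covStieltjes_sub hcard hγ hγ_lim hX hz).mono fun ω hω => by
      simpa using hω.add (hm z hz)) (tendsto_mul_I_mul_of_eq_integral hH hm_eq him)
  refine ⟨μ, hμ, fun z hz => ?_⟩
  rw [hμm z hz]
  exact ⟨him z hz, hm_eq z hz⟩

end Convergence

section TensorModel

open scoped Matrix.Norms.L2Operator

theorem tendsto_norm_mul_sqrt_tensorVarianceRatio {d : ℕ → ℕ} {κ : ℕ → ℝ} {K : ℝ}
    {T : (n : ℕ) → Matrix (TensorIndex n (d n)) (TensorIndex n (d n)) ℝ} (hTK : ∀ n, ‖T n‖ ≤ K)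
    (hκ : ∀ᶠ n in atTop, 1 ≤ κ n)
    (hlim : Tendsto (fun n => (d n : ℝ) ^ 2 * κ n / n) atTop (𝓝 0)) :
    Tendsto (fun n => ‖T n‖ * √(tensorVarianceRatio n (d n) (κ n))) atTop (𝓝 0) := by
  have hsqrt := (tendsto_tensorVarianceRatio hκ hlim).sqrt.const_mul K
  rw [Real.sqrt_zero, mul_zero] at hsqrt
  exact squeeze_zero (fun n => by positivity)
    (fun n => mul_le_mul_of_nonneg_right (hTK n) (Real.sqrt_nonneg _)) hsqrt

end TensorModel

theorem mainTheorem2_general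
    (d p : ℕ → ℕ) (γ : ℝ) (ν : ℕ → Measure ℝ) [∀ n, IsProbabilityMeasure (ν n)]
    (hd_pos : ∀ᶠ n in atTop, 0 < d n) (hν : ∀ᶠ n in atTop, IsSymmUnit (ν n))
    (hν_lim : Tendsto (fun n => (d n : ℝ) ^ 2 * (∫ x, x ^ 4 ∂(ν n)) / n) atTop (𝓝 0))
    (hγ : 0 < γ)
    (hγ_lim : Tendsto (fun n : ℕ => (n.choose (d n) : ℝ) / (p n : ℝ)) atTop (𝓝 γ))
    (T : (n : ℕ) → Matrix (TensorIndex n (d n)) (TensorIndex n (d n)) ℝ)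
    (hT : ∀ n, (T n).PosSemidef)
    (hT_bdd : BddAbove (Set.range fun n => ‖Matrix.toEuclideanCLM (𝕜 := ℝ) (T n)‖))
    (H : ProbabilityMeasure ℝ)
    (hT_lim : Tendsto (fun n => esd (hT n).isHermitian) atTop (𝓝 H.toFiniteMeasure))
    {Ω : Type*} [MeasurableSpace Ω] (P : Measure Ω) [IsProbabilityMeasure P]
    (Z : (n : ℕ) → Ω → Matrix (TensorIndex n (d n)) (Fin (p n)) ℝ)
    (hZ_law : ∀ᶠ n in atTop, ∀ j : Fin (p n),
      HasLaw (fun ω i => Z n ω i j) (colouredTensorLaw (ν n) (T n)) P)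
    (hZ_indep : ∀ᶠ n in atTop, iIndepFun (fun (j : Fin (p n)) ω i => Z n ω i j) P) :
    ∃ μ : ProbabilityMeasure ℝ,
      (∀ᵐ ω ∂P, Tendsto (fun n => esd (isHermitian_sampleCov (Z n ω))) atTop
        (𝓝 μ.toFiniteMeasure)) ∧
      ∀ z : ℂ, 0 < z.im →
        (∀ᵐ t : ℝ ∂(H : Measure ℝ),
          z - t * (1 - γ + γ * z * stieltjesTransform μ z) ≠ 0) ∧
        Integrable (fun t : ℝ => 1 / (z - t * (1 - γ + γ * z * stieltjesTransform μ z)))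
          (H : Measure ℝ) ∧
        stieltjesTransform μ z =
          ∫ t : ℝ, 1 / (z - t * (1 - γ + γ * z * stieltjesTransform μ z)) ∂(H : Measure ℝ) := by
  obtain ⟨K, hK⟩ := hT_bdd
  have hTK (n : ℕ) : Matrix.instL2OpNormedAddCommGroup.norm (T n) ≤ K := hK ⟨n, rfl⟩
  have hκ : ∀ᶠ n in atTop, 1 ≤ ∫ x, x ^ 4 ∂(ν n) :=
    hν.mono fun _ hn => hn.one_le_integral_pow_four
  have hcard : ∀ᶠ n in atTop, n ≤ Fintype.card (TensorIndex n (d n)) := by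
    filter_upwards [hd_pos, eventually_lt_of_tendsto_sq_mul_div hκ hν_lim] with n hpos hlt
    exact (le_choose_of_pos_of_lt hpos hlt).trans_eq (card_tensorIndex n (d n)).symm
  obtain ⟨μ, hμ, hμz⟩ := exists_tendsto_esd_of_concentratedColumn hT hTK
    (hν.mono fun n hn => concentratedColumn_colouredTensorLaw hn (hT n))
    (tendsto_norm_mul_sqrt_tensorVarianceRatio hTK hκ hν_lim) hcard hγ
    (by simpa only [card_tensorIndex] using hγ_lim) hT_lim
    ((hZ_law.and hZ_indep).mono fun n ⟨hlaw, hindep⟩ => hindep.hasLaw_pi hlaw)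
  refine ⟨μ, hμ.mono fun ω hω => hω.congr fun n =>
    (esd_congr (sampleCov_eq_partialCov _) _ _).symm, fun z hz => ?_⟩
  obtain ⟨him, heq⟩ := hμz z hz
  have hH := ae_nonneg_of_tendsto_esd hT hT_lim
  simp only [mul_comm _ (1 - γ + γ * z * stieltjesTransform μ z)]
  exact ⟨hH.mono fun t => sub_mul_ofReal_ne_zero hz him, integrable_one_div_sub_mul hz him hH, heq⟩

theorem mainTheorem2
    (d p : ℕ → ℕ) (C : ℕ → ℝ) (γ : ℝ)
    -- `ν n` is the law of `x_1 = x(n)`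
    (ν : ℕ → Measure ℝ) [∀ n, IsProbabilityMeasure (ν n)]
    (hd_pos : ∀ n, 2 ≤ n → 1 ≤ d n)
    (hd_lt : ∀ n, 2 ≤ n → (d n : ℝ) < √(n : ℝ))
    (hν_symm : ∀ n, 2 ≤ n → (ν n).map (fun x => -x) = ν n)
    (hν_var : ∀ n, 2 ≤ n → ∫ x, x ^ 2 ∂(ν n) = 1)
    (hC : ∀ n, 2 ≤ n → 2 ≤ C n)
    (hν_mom : ∀ n, 2 ≤ n → ∀ k : ℕ, 1 ≤ k →
      Integrable (fun x : ℝ => x ^ (2 * k)) (ν n) ∧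
        ∫ x, x ^ (2 * k) ∂(ν n) ≤ (C n * k) ^ k)
    (hC_lim : Tendsto (fun n : ℕ => Real.log (C n) / Real.log (√(n : ℝ) / d n)) atTop (𝓝 0))
    -- the asymptotic regime
    (hγ : 0 < γ)
    (hγ_lim : Tendsto (fun n : ℕ => (n.choose (d n) : ℝ) / (p n : ℝ)) atTop (𝓝 γ))
    -- the deterministic matrices `T(n)`, bounded in `ℓ²` operator norm
    (T : (n : ℕ) → Matrix (TensorIndex n (d n)) (TensorIndex n (d n)) ℝ)
    (hT : ∀ n, (T n).PosSemidef)
    (hT_bdd : BddAbove (Set.range fun n => ‖Matrix.toEuclideanCLM (𝕜 := ℝ) (T n)‖))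
    (H : ProbabilityMeasure ℝ)
    (hT_lim : Tendsto (fun n => esd (hT n).isHermitian) atTop (𝓝 H.toFiniteMeasure))
    -- the random matrices, with an arbitrary coupling between different values of `n`
    {Ω : Type*} [MeasurableSpace Ω] (P : Measure Ω) [IsProbabilityMeasure P]
    (Z : (n : ℕ) → Ω → Matrix (TensorIndex n (d n)) (Fin (p n)) ℝ)
    (hZ_law : ∀ n, 2 ≤ n → ∀ j : Fin (p n),
      HasLaw (fun ω i => Z n ω i j) (colouredTensorLaw (ν n) (T n)) P)
    (hZ_indep : ∀ n, 2 ≤ n → iIndepFun (fun (j : Fin (p n)) ω i => Z n ω i j) P) :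
    ∃ μ : ProbabilityMeasure ℝ,
      (∀ᵐ ω ∂P, Tendsto (fun n => esd (isHermitian_sampleCov (Z n ω))) atTop
        (𝓝 μ.toFiniteMeasure)) ∧
      ∀ z : ℂ, 0 < z.im →
        (∀ᵐ t : ℝ ∂(H : Measure ℝ),
          z - t * (1 - γ + γ * z * stieltjesTransform μ z) ≠ 0) ∧
        Integrable (fun t : ℝ => 1 / (z - t * (1 - γ + γ * z * stieltjesTransform μ z)))
          (H : Measure ℝ) ∧
        stieltjesTransform μ z =
          ∫ t : ℝ, 1 / (z - t * (1 - γ + γ * z * stieltjesTransform μ z)) ∂(H : Measure ℝ) := by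
  have large {q : ℕ → Prop} (h : ∀ n, 2 ≤ n → q n) : ∀ᶠ n in atTop, q n :=
    (eventually_ge_atTop 2).mono h
  refine mainTheorem2_general d p γ ν (large hd_pos) (large fun n hn =>
    ⟨hν_symm n hn, hν_var n hn, (hν_mom n hn 2 one_le_two).1⟩) ?_ hγ hγ_lim T hT hT_bdd H hT_lim
    P Z (large hZ_law) (large hZ_indep)
  exact tendsto_sq_mul_div (large hd_pos) (large hd_lt) (large hC)
    (fun n => integral_nonneg fun x => by positivity)
    (large fun n hn => (hν_mom n hn 2 one_le_two).2) hC_lim
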